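/- Let $m>0$, $\nu\in(-1,1)$, and let $V:\mathbb R\to\mathbb R$ be locally integrable with $\lim_{|x|\to\infty}\int_x^{x+1}|V(t)|\,dt=0$. In the complex Hilbert space $L^2(\mathbb R)$ let $D=\frac{d}{dx}$ with $\mathrm{dom}(D)=W^{1,2}(\mathbb R)$, and let $H_V=-\frac{d^2}{dx^2}+m^2+V(x)$ on its maximal domain $$\mathcal D(H_V)=\{f\in L^2(\mathbb R):\ f,f'\in AC_{\mathrm{loc}}(\mathbb R),\ -f''+Vf\in L^2(\mathbb R)\}.$$ Let $\mathcal A_0$ be the operator $$\mathcal A_0=\begin{pmatrix} H_V & -\nu D\\ \nu D & I\end{pmatrix},\qquad \mathrm{dom}(\mathcal A_0)=\mathcal D(H_V)\times W^{1,2}(\mathbb R),$$ in $L^2(\mathbb R)\times L^2(\mathbb R)$, and $\mathcal A$ its closure. Assume that $0\notin\sigma(H_V)$ and let $\overline{S(0)}$ be the closure of the operator $S(0)=I+\nu^2 DH_V^{-1}D$ with $\mathrm{dom}(S(0))=W^{1,2}(\mathbb R)$. For a self-adjoint operator $T$ put $\kappa_-(T)=\dim\mathrm{ran}\,\chi_{(-\infty,0)}(T)\in\{0,1,2,\dots\}\cup\{\infty\}$.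 Then these operators are well defined (in particular $\mathcal D(H_V)\subset W^{1,2}(\mathbb R)$, and $\mathcal A_0$ and $S(0)$ are closable), the operators $H_V$, $\mathcal A$ and $\overline{S(0)}$ are self-adjoint, and $$\kappa_-(\mathcal A)=\kappa_-(H_V)+\kappa_-(\overline{S(0)})<\infty .$$ Moreover, $\mathcal A$ is positive if and only if both $H_V$ and $\overline{S(0)}$ are positive. This holds both when "$T$ is positive" means $\langle Tf,f\rangle>0$ for all $0\ne f\in\mathrm{dom}(T)$ and when it means $\langle Tf,f\rangle\ge 0$ for all $f\in\mathrm{dom}(T)$. -/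

import Mathlib

open MeasureTheory Filter Set
open scoped Topology ZeroAtInfty

noncomputable section

namespace BlockMatrixOp

/-! ### Unbounded operators on a complex Hilbert space -/

section Abstract

variable {H : Type*} [NormedAddCommGroup H] [InnerProductSpace ℂ H]

/-- The bounded operator `R` is the resolvent `(T - z)⁻¹`: it maps `H` into `dom T` and is a two-sided
inverse of `T - z : dom T → H`. -/
def IsResolventAt (T : H →ₗ.[ℂ] H) (z : ℂ) (R : H →L[ℂ] H) : Prop :=
  (∀ x : H, ∃ h : R x ∈ T.domain, T ⟨R x, h⟩ - z • R x = x) ∧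
    ∀ y : T.domain, R (T y - z • (y : H)) = y

/-- The resolvent set `ρ(T)` of an unbounded operator. -/
def resolventSetOf (T : H →ₗ.[ℂ] H) : Set ℂ := {z | ∃ R : H →L[ℂ] H, IsResolventAt T z R}

/-- The spectrum `σ(T)` of an unbounded operator. -/
def spectrumOf (T : H →ₗ.[ℂ] H) : Set ℂ := (resolventSetOf T)ᶜ

open Classical in
/-- The resolvent `(T - z)⁻¹` (and `0` if `z ∉ ρ(T)`). -/
def resolventOf (T : H →ₗ.[ℂ] H) (z : ℂ) : H →L[ℂ] H :=
  if h : ∃ R : H →L[ℂ] H, IsResolventAt T z R then h.choose else 0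

/-- The functional calculus `f(T)` of an unbounded self-adjoint operator `T`, for a continuous `f`
vanishing at infinity. It is the continuous functional calculus of the bounded normal operator
`(T - i)⁻¹`, in which `t ∈ ℝ` corresponds to `w = (t - i)⁻¹`, i.e. `t = Re w⁻¹`, and `t = ±∞`
corresponds to `w = 0`. -/
def functionOf [CompleteSpace H] (T : H →ₗ.[ℂ] H) (f : C₀(ℝ, ℝ)) : H →L[ℂ] H :=
  cfc (fun w : ℂ => if w = 0 then 0 else ((f (w⁻¹).re : ℝ) : ℂ)) (resolventOf T Complex.I)

/-- For an open set `U ⊆ ℝ` and a self-adjoint `T`, the range of the spectral projection `χ_U(T)`.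
As `χ_U` is the supremum of the continuous functions `0 ≤ f ≤ 1` that vanish at infinity and outside
`U`, this range is the closed span of the ranges of `f(T)` over all continuous `f` that vanish at
infinity and outside `U`. -/
def spectralSubspace [CompleteSpace H] (T : H →ₗ.[ℂ] H) (U : Set ℝ) : Submodule ℂ H :=
  (⨆ f : {f : C₀(ℝ, ℝ) // ∀ t, t ∉ U → f t = 0},
    LinearMap.range (functionOf T f.1).toLinearMap).topologicalClosure

/-- `κ₋(T) = dim ran χ_{(-∞,0)}(T)`, an element of `ℕ ∪ {∞}`. -/
def kappaMinus [CompleteSpace H] (T : H →ₗ.[ℂ] H) : ℕ∞ :=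
  Cardinal.toENat (Module.rank ℂ (spectralSubspace T (Iio 0)))

/-- `T` is positive: `⟨T x, x⟩ > 0` for all `x ≠ 0` in the domain. -/
def IsPositiveOp (T : H →ₗ.[ℂ] H) : Prop :=
  ∀ x : T.domain, (x : H) ≠ 0 → 0 < (inner ℂ (x : H) (T x)).re

/-- `T` is nonnegative: `⟨T x, x⟩ ≥ 0` for all `x` in the domain. -/
def IsNonnegativeOp (T : H →ₗ.[ℂ] H) : Prop :=
  ∀ x : T.domain, 0 ≤ (inner ℂ (x : H) (T x)).re

/-- The product `S T` of unbounded operators on its natural domain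
`{x ∈ dom T : T x ∈ dom S}`. -/
def mulOp (S T : H →ₗ.[ℂ] H) : H →ₗ.[ℂ] H where
  domain :=
    { carrier := {x | ∃ h : x ∈ T.domain, T ⟨x, h⟩ ∈ S.domain}
      zero_mem' := ⟨T.domain.zero_mem, by
        have : T ⟨0, T.domain.zero_mem⟩ = 0 := T.map_zero
        rw [this]; exact S.domain.zero_mem⟩
      add_mem' := by
        rintro x y ⟨hx, hx'⟩ ⟨hy, hy'⟩
        refine ⟨T.domain.add_mem hx hy, ?_⟩
        have : T ⟨x + y, T.domain.add_mem hx hy⟩ = T ⟨x, hx⟩ + T ⟨y, hy⟩ :=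
          T.map_add ⟨x, hx⟩ ⟨y, hy⟩
        rw [this]; exact S.domain.add_mem hx' hy'
      smul_mem' := by
        rintro c x ⟨hx, hx'⟩
        refine ⟨T.domain.smul_mem c hx, ?_⟩
        have : T ⟨c • x, T.domain.smul_mem c hx⟩ = c • T ⟨x, hx⟩ := T.map_smul c ⟨x, hx⟩
        rw [this]; exact S.domain.smul_mem c hx' }
  toFun :=
    { toFun := fun x => S ⟨T ⟨x.1, x.2.1⟩, x.2.2⟩
      map_add' := by
        rintro ⟨x, hx, hx'⟩ ⟨y, hy, hy'⟩
        rw [← S.map_add]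
        exact congrArg S (Subtype.ext (T.map_add ⟨x, hx⟩ ⟨y, hy⟩))
      map_smul' := by
        rintro c ⟨x, hx, hx'⟩
        rw [RingHom.id_apply, ← S.map_smul]
        exact congrArg S (Subtype.ext (T.map_smul c ⟨x, hx⟩)) }

/-- The block operator matrix with rows `(A, B)` and `(C, D)` acting in the Hilbert space `H × H`,
with domain `(dom A ∩ dom C) × (dom B ∩ dom D)`. -/
def blockOp (A B C D : H →ₗ.[ℂ] H) : WithLp 2 (H × H) →ₗ.[ℂ] WithLp 2 (H × H) where
  domain := ((A.domain ⊓ C.domain).prod (B.domain ⊓ D.domain)).comap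
    (WithLp.linearEquiv 2 ℂ (H × H)).toLinearMap
  toFun :=
    { toFun := fun F => WithLp.toLp 2
        (A ⟨F.1.fst, F.2.1.1⟩ + B ⟨F.1.snd, F.2.2.1⟩, C ⟨F.1.fst, F.2.1.2⟩ + D ⟨F.1.snd, F.2.2.2⟩)
      map_add' := by
        rintro ⟨F, ⟨hA, hC⟩, ⟨hB, hD⟩⟩ ⟨G, ⟨hA', hC'⟩, ⟨hB', hD'⟩⟩
        have h1 := A.map_add ⟨F.fst, hA⟩ ⟨G.fst, hA'⟩
        have h2 := B.map_add ⟨F.snd, hB⟩ ⟨G.snd, hB'⟩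
        have h3 := C.map_add ⟨F.fst, hC⟩ ⟨G.fst, hC'⟩
        have h4 := D.map_add ⟨F.snd, hD⟩ ⟨G.snd, hD'⟩
        rw [← WithLp.toLp_add]
        refine congrArg (WithLp.toLp 2) (Prod.ext ?_ ?_)
        · exact (congrArg₂ (· + ·) h1 h2).trans (add_add_add_comm _ _ _ _)
        · exact (congrArg₂ (· + ·) h3 h4).trans (add_add_add_comm _ _ _ _)
      map_smul' := by
        rintro c ⟨F, ⟨hA, hC⟩, ⟨hB, hD⟩⟩
        have h1 := A.map_smul c ⟨F.fst, hA⟩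
        have h2 := B.map_smul c ⟨F.snd, hB⟩
        have h3 := C.map_smul c ⟨F.fst, hC⟩
        have h4 := D.map_smul c ⟨F.snd, hD⟩
        rw [RingHom.id_apply, ← WithLp.toLp_smul]
        refine congrArg (WithLp.toLp 2) (Prod.ext ?_ ?_)
        · exact (congrArg₂ (· + ·) h1 h2).trans (smul_add _ _ _).symm
        · exact (congrArg₂ (· + ·) h3 h4).trans (smul_add _ _ _).symm }

/-- The identity as an everywhere defined operator. -/
def idOp (H : Type*) [NormedAddCommGroup H] [InnerProductSpace ℂ H] : H →ₗ.[ℂ] H :=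
  (LinearMap.id : H →ₗ[ℂ] H).toPMap ⊤

end Abstract

/-! ### Differential operators on `L²(ℝ)` -/

/-- The complex Hilbert space `L²(ℝ)`. -/
abbrev L2R : Type := Lp ℂ 2 (volume : Measure ℝ)

/-- `u ∈ AC_loc(ℝ)`. -/
def ACLoc (u : ℝ → ℂ) : Prop := ∀ a b : ℝ, AbsolutelyContinuousOnInterval u a b

/-- The graph of `D = d/dx` with `dom D = W^{1,2}(ℝ)`: pairs `(f, g)` of `L²` functions such that `f`
has a representative `u ∈ AC_loc(ℝ)` with `u' = g` almost everywhere. -/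
def derivGraph : Submodule ℂ (L2R × L2R) where
  carrier := {p | ∃ u : ℝ → ℂ, ACLoc u ∧ p.1 =ᵐ[volume] u ∧ ∀ᵐ x : ℝ, HasDerivAt u (p.2 x) x}
  zero_mem' := ⟨fun _ => 0, fun a b => by
      simpa [AbsolutelyContinuousOnInterval] using tendsto_const_nhds,
    Lp.coeFn_zero ℂ 2 volume, by
      filter_upwards [Lp.coeFn_zero ℂ 2 (volume : Measure ℝ)] with x hx
      have : ((0 : L2R × L2R).2 : ℝ → ℂ) x = 0 := hx
      rw [this]; exact hasDerivAt_const x 0⟩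
  add_mem' := by
    rintro p q ⟨u, hu, hpu, hud⟩ ⟨v, hv, hqv, hvd⟩
    refine ⟨u + v, fun a b => (hu a b).add (hv a b), ?_, ?_⟩
    · exact (Lp.coeFn_add p.1 q.1).trans (hpu.add hqv)
    · filter_upwards [Lp.coeFn_add p.2 q.2, hud, hvd] with x hx h1 h2
      have : ((p + q).2 : ℝ → ℂ) x = p.2 x + q.2 x := hx
      rw [this]; exact h1.add h2
  smul_mem' := by
    rintro c p ⟨u, hu, hpu, hud⟩
    refine ⟨c • u, fun a b => (hu a b).const_smul c, ?_, ?_⟩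
    · exact (Lp.coeFn_smul c p.1).trans (hpu.const_smul c)
    · filter_upwards [Lp.coeFn_smul c p.2, hud] with x hx h1
      have : ((c • p).2 : ℝ → ℂ) x = c • p.2 x := hx
      rw [this]; exact h1.const_smul c

/-- The graph of `H_V = -d²/dx² + m² + V` on its maximal domain: pairs `(f, g)` of `L²` functions such
that `f` has a representative `u` with `u, u' ∈ AC_loc(ℝ)` (here `u' = v`, `u'' = w`) and
`-u'' + (m² + V) u = g` almost everywhere. -/
def schrodingerGraph (m : ℝ) (V : ℝ → ℝ) : Submodule ℂ (L2R × L2R) where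
  carrier := {p | ∃ u v w : ℝ → ℂ, ACLoc u ∧ ACLoc v ∧ p.1 =ᵐ[volume] u ∧
    (∀ x : ℝ, HasDerivAt u (v x) x) ∧ (∀ᵐ x : ℝ, HasDerivAt v (w x) x) ∧
    ∀ᵐ x : ℝ, p.2 x = -w x + ((m ^ 2 + V x : ℝ) : ℂ) * u x}
  zero_mem' := by
    refine ⟨0, 0, 0, fun a b => by
      simpa [AbsolutelyContinuousOnInterval] using tendsto_const_nhds,
      fun a b => by
      simpa [AbsolutelyContinuousOnInterval] using tendsto_const_nhds,
      Lp.coeFn_zero ℂ 2 volume, fun x => hasDerivAt_const x 0,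
      Eventually.of_forall fun x => hasDerivAt_const x 0, ?_⟩
    filter_upwards [Lp.coeFn_zero ℂ 2 (volume : Measure ℝ)] with x hx
    have : ((0 : L2R × L2R).2 : ℝ → ℂ) x = 0 := hx
    rw [this]; simp
  add_mem' := by
    rintro p q ⟨u, v, w, hu, hv, hpu, huv, hvw, hp⟩ ⟨u', v', w', hu', hv', hpu', huv', hvw', hp'⟩
    refine ⟨u + u', v + v', w + w', fun a b => (hu a b).add (hu' a b),
      fun a b => (hv a b).add (hv' a b), (Lp.coeFn_add p.1 q.1).trans (hpu.add hpu'),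
      fun x => (huv x).add (huv' x), ?_, ?_⟩
    · filter_upwards [hvw, hvw'] with x h1 h2 using h1.add h2
    · filter_upwards [Lp.coeFn_add p.2 q.2, hp, hp'] with x hx h1 h2
      have : ((p + q).2 : ℝ → ℂ) x = p.2 x + q.2 x := hx
      rw [this, h1, h2]; simp only [Pi.add_apply]; ring
  smul_mem' := by
    rintro c p ⟨u, v, w, hu, hv, hpu, huv, hvw, hp⟩
    refine ⟨c • u, c • v, c • w, fun a b => (hu a b).const_smul c,
      fun a b => (hv a b).const_smul c, (Lp.coeFn_smul c p.1).trans (hpu.const_smul c),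
      fun x => (huv x).const_smul c, ?_, ?_⟩
    · filter_upwards [hvw] with x h1 using h1.const_smul c
    · filter_upwards [Lp.coeFn_smul c p.2, hp] with x hx h1
      have : ((c • p).2 : ℝ → ℂ) x = c • p.2 x := hx
      rw [this, h1]; simp only [Pi.smul_apply, smul_eq_mul]; ring

theorem ACLoc.continuous {u : ℝ → ℂ} (hu : ACLoc u) : Continuous u := by
  rw [continuous_iff_continuousAt]
  intro x
  refine (hu (x - 1) (x + 1)).continuousOn.continuousAt ?_
  rw [uIcc_of_le (by linarith)]
  exact Icc_mem_nhds (by linarith) (by linarith)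

/-- `derivGraph` is the graph of an operator. -/
theorem derivGraph_single_valued (p : L2R × L2R) (hp : p ∈ derivGraph) (h0 : p.1 = 0) :
    p.2 = 0 := by
  obtain ⟨u, hu, hpu, hud⟩ := hp
  have hz : u =ᵐ[volume] (fun _ => (0 : ℂ)) := by
    rw [h0] at hpu
    exact hpu.symm.trans (Lp.coeFn_zero ℂ 2 volume)
  have hu0 : u = fun _ => 0 := hu.continuous.ae_eq_iff_eq volume continuous_const |>.1 hz
  rw [Lp.eq_zero_iff_ae_eq_zero]
  filter_upwards [hud] with x hx
  rw [hu0] at hx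
  exact hx.unique (hasDerivAt_const x 0)

/-- `schrodingerGraph` is the graph of an operator. -/
theorem schrodingerGraph_single_valued (m : ℝ) (V : ℝ → ℝ) (p : L2R × L2R)
    (hp : p ∈ schrodingerGraph m V) (h0 : p.1 = 0) : p.2 = 0 := by
  obtain ⟨u, v, w, hu, hv, hpu, huv, hvw, hp⟩ := hp
  have hz : u =ᵐ[volume] (fun _ => (0 : ℂ)) := by
    rw [h0] at hpu
    exact hpu.symm.trans (Lp.coeFn_zero ℂ 2 volume)
  have hu0 : u = fun _ => 0 := hu.continuous.ae_eq_iff_eq volume continuous_const |>.1 hz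
  subst hu0
  have hv0 : v = fun _ => 0 := funext fun x => (huv x).unique (hasDerivAt_const x 0)
  subst hv0
  rw [Lp.eq_zero_iff_ae_eq_zero]
  filter_upwards [hvw, hp] with x h1 h2
  rw [h2, h1.unique (hasDerivAt_const x 0)]
  simp

/-- `D = d/dx` in `L²(ℝ)` with `dom D = W^{1,2}(ℝ)`. -/
def derivOp : L2R →ₗ.[ℂ] L2R := derivGraph.toLinearPMap

/-- `H_V = -d²/dx² + m² + V` in `L²(ℝ)` on its maximal domain `𝒟(H_V)`. -/
def schrodingerOp (m : ℝ) (V : ℝ → ℝ) : L2R →ₗ.[ℂ] L2R := (schrodingerGraph m V).toLinearPMap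

/-- The block operator matrix `𝒜₀` with rows `(H_V, -ν D)` and `(ν D, I)` in `L²(ℝ) × L²(ℝ)`; here
`-ν D` is the (formal) adjoint of `ν D`. -/
def blockA0 (m ν : ℝ) (V : ℝ → ℝ) : WithLp 2 (L2R × L2R) →ₗ.[ℂ] WithLp 2 (L2R × L2R) :=
  blockOp (schrodingerOp m V) (-((ν : ℂ) • derivOp)) ((ν : ℂ) • derivOp) (idOp L2R)

/-- `𝒜`, the closure of `𝒜₀`. -/
def blockA (m ν : ℝ) (V : ℝ → ℝ) : WithLp 2 (L2R × L2R) →ₗ.[ℂ] WithLp 2 (L2R × L2R) :=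
  (blockA0 m ν V).closure

/-- The Schur complement `S(0) = I - (ν D) H_V⁻¹ (-ν D)`. -/
def schurS0 (m ν : ℝ) (V : ℝ → ℝ) : L2R →ₗ.[ℂ] L2R :=
  idOp L2R -
    mulOp ((ν : ℂ) • derivOp) (mulOp (schrodingerOp m V).inverse (-((ν : ℂ) • derivOp)))

end BlockMatrixOp

end

set_option linter.unusedSectionVars false

namespace BlockMatrixOp

/-! ### Resolvents of unbounded self-adjoint operators -/

section Resolvent

variable {H : Type*} [NormedAddCommGroup H] [InnerProductSpace ℂ H] [CompleteSpace H]

/-! Everything is transferred from unbounded operators to bounded self-adjoint operators on form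
domains. The condition on `V` makes it infinitesimally form bounded on `W^{1,2}`: on an interval of
length `δ`, `|f|²` is at most `(2/δ)∫|f|² + 2δ∫|f'|²`, and the mass of `|V|` on such intervals is
uniformly bounded. Hence `‖f'‖² + m²‖f‖² + ∫V|f|²` is given by a bounded self-adjoint `Q` on
`W^{1,2}`, coercive after a shift. A Caccioppoli estimate puts the maximal domain into `W^{1,2}`, so
`Q` represents `H_V` (`exists_sobolev_of_mem_graph`). Since `0` is in the resolvent set, `H_V` is
self-adjoint and `Q` is invertible (`formOf_of_isResolventAt_zero`).

Since `D` is skew-adjoint, the block operator is represented on `W^{1,2} × L²` by `⟨Qf,f⟩ + 2ν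
Re⟨f',g⟩ + ‖g‖²`. This is again coercive after a shift, and the shifted operator has dense range, so
the closure is self-adjoint (`closure_formOf`). Likewise `S(0)` is the restriction to `W^{1,2}` of
the bounded operator `I - ν² d Q⁻¹ d†`, where `d` is the derivative. Completing the square, that is
the shear `f ↦ f + ν Q⁻¹ d† g`, turns the block form into the direct sum of the forms of `Q` and of
this Schur complement (`inner_blockForm_eq_shear`). Both positivity statements follow, strictness
being injectivity of the bounded operators.

For the count, `κ₋(T)` is the negative index of the form of `T` on its domain
(`exists_negIndex_kappaMinus`), which agrees with the index on the form domain when the latter is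
finite (`FormOf.kappaMinus_eq`). Negative indices add over direct sums and are invariant under
linear isomorphisms. Finiteness is where `|ν| < 1` and `m > 0` enter: on functions vanishing at
finitely many suitable points the potential is so small that `⟨Qf,f⟩ ≥ ν²‖f'‖²`, and there the block
form is at least `(|ν|‖f'‖ - ‖g‖)²`. -/

theorem dense_range_of_isSelfAdjoint_of_injective {K : H →L[ℂ] H} (hK : IsSelfAdjoint K)
    (hinj : Function.Injective K) : DenseRange K := by
  have h : K.range.topologicalClosure = ⊤ := by
    rw [Submodule.topologicalClosure_eq_top_iff, ContinuousLinearMap.orthogonal_range,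
      ContinuousLinearMap.isSelfAdjoint_iff'.1 hK]
    exact LinearMap.ker_eq_bot.2 hinj
  have := (Submodule.dense_iff_topologicalClosure_eq_top).2 h
  exact this

/-- An operator with `T + lam = K⁻¹`, `K` bounded self-adjoint and injective, is self-adjoint. -/
theorem isSelfAdjoint_of_graph {T : H →ₗ.[ℂ] H} {K : H →L[ℂ] H} (hK : IsSelfAdjoint K)
    (hinj : Function.Injective K) (lam : ℝ)
    (hT : ∀ x y, (x, y) ∈ T.graph ↔ x = K (y + (lam : ℂ) • x)) : IsSelfAdjoint T := by
  have hmem : ∀ z, (K z, z - (lam : ℂ) • K z) ∈ T.graph := fun z => by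
    rw [hT]; simp
  have hd : Dense (T.domain : Set H) := by
    refine (dense_range_of_isSelfAdjoint_of_injective hK hinj).mono ?_
    rintro _ ⟨z, rfl⟩
    exact LinearPMap.mem_domain_of_mem_graph (hmem z)
  have hsym : ∀ x y, inner ℂ (K x) y = inner ℂ x (K y) := fun x y =>
    hK.isSymmetric x y
  rw [LinearPMap.isSelfAdjoint_def]
  refine LinearPMap.eq_of_eq_graph ?_
  rw [LinearPMap.adjoint_graph_eq_graph_adjoint hd]
  ext ⟨x, y⟩
  rw [Submodule.mem_adjoint_iff, hT]
  -- The pairs `(K z, z - lam K z)` exhaust the graph, so the adjoint condition on `(x, y)` says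
  -- that its defect `x - K (y + lam x)` is orthogonal to every `z`.
  have key : ∀ z, inner ℂ (z - (lam : ℂ) • K z) x - inner ℂ (K z) y
      = inner ℂ z (x - K (y + (lam : ℂ) • x)) := by
    intro z
    simp only [inner_sub_left, inner_sub_right, inner_smul_left, inner_smul_right, hsym, map_add,
      map_smul, inner_add_right, Complex.conj_ofReal]
    ring
  constructor
  · intro h
    have : inner ℂ (x - K (y + (lam : ℂ) • x)) (x - K (y + (lam : ℂ) • x)) = 0 := by
      rw [← key]
      exact h _ _ (hmem _)
    exact sub_eq_zero.1 (inner_self_eq_zero.1 this)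
  · intro h a b hab
    have h2 := (hT a b).1 hab
    have h3 : b = (b + (lam : ℂ) • a) - (lam : ℂ) • K (b + (lam : ℂ) • a) := by
      rw [← h2]; simp
    have h4 := key (b + (lam : ℂ) • a)
    rw [← h3, ← h2] at h4
    dsimp only
    rw [h4, ← h, sub_self, inner_zero_right]

theorem _root_.IsSelfAdjoint.pmap_inner_map_eq {T : H →ₗ.[ℂ] H} (hT : IsSelfAdjoint T) (x y : T.domain) :
    inner ℂ (T x) (y : H) = inner ℂ (x : H) (T y) := by
  have h := LinearPMap.adjoint_isFormalAdjoint hT.dense_domain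
  rw [LinearPMap.isSelfAdjoint_def.1 hT] at h
  exact h x y

theorem _root_.IsSelfAdjoint.pmap_mem_graph_of_forall {T : H →ₗ.[ℂ] H} (hT : IsSelfAdjoint T) (x y : H)
    (h : ∀ z : T.domain, inner ℂ (T z) x = inner ℂ (z : H) y) : (x, y) ∈ T.graph := by
  rw [← LinearPMap.isSelfAdjoint_def.1 hT, LinearPMap.adjoint_graph_eq_graph_adjoint hT.dense_domain,
    Submodule.mem_adjoint_iff]
  intro a b hab
  obtain ⟨z, hz1, hz2⟩ := (LinearPMap.mem_graph_iff _).1 hab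
  dsimp only at *
  rw [← hz1, ← hz2, h, sub_self]

theorem _root_.IsSelfAdjoint.pmap_im_inner_map_self {T : H →ₗ.[ℂ] H} (hT : IsSelfAdjoint T) (x : T.domain) :
    (inner ℂ (x : H) (T x)).im = 0 := by
  have h := hT.pmap_inner_map_eq x x
  rw [← inner_conj_symm] at h
  exact Complex.conj_eq_iff_im.1 h

/-- Since `⟨x, T x⟩` is real, `⟨x, (T - z) x⟩` has imaginary part `-Im z ‖x‖²`; apply
Cauchy–Schwarz. -/
theorem _root_.IsSelfAdjoint.pmap_norm_le_norm_map_sub {T : H →ₗ.[ℂ] H} (hT : IsSelfAdjoint T) (z : ℂ)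
    (x : T.domain) : |z.im| * ‖(x : H)‖ ≤ ‖T x - z • (x : H)‖ := by
  have h1 : (inner ℂ (x : H) (T x - z • (x : H))).im = -z.im * ‖(x : H)‖ ^ 2 := by
    rw [inner_sub_right, inner_smul_right, Complex.sub_im, hT.pmap_im_inner_map_self,
      inner_self_eq_norm_sq_to_K]
    have : ((‖(x : H)‖ : ℂ) ^ 2) = ((‖(x : H)‖ ^ 2 : ℝ) : ℂ) := by push_cast; rfl
    erw [this]
    rw [Complex.mul_im, Complex.ofReal_re, Complex.ofReal_im]
    ring
  have h2 := (Complex.abs_im_le_norm _).trans (norm_inner_le_norm (𝕜 := ℂ) (x : H) (T x - z • (x : H)))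
  rw [h1, abs_mul, abs_neg, abs_of_nonneg (sq_nonneg ‖(x : H)‖)] at h2
  rcases eq_or_ne (x : H) 0 with h0 | h0
  · rw [h0]; simp
  · have : 0 < ‖(x : H)‖ := norm_pos_iff.2 h0
    nlinarith

/-- `T - z` is bounded below and `T` is closed, so its range is closed. A vector orthogonal to the
range is an eigenvector of `T* = T` for the conjugate of `z`, hence zero by the same lower bound. -/
theorem _root_.IsSelfAdjoint.pmap_exists_isResolventAt {T : H →ₗ.[ℂ] H} (hT : IsSelfAdjoint T) {z : ℂ}
    (hz : z.im ≠ 0) : ∃ R : H →L[ℂ] H, IsResolventAt T z R := by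
  let L : T.domain →ₗ[ℂ] H := T.toFun - z • T.domain.subtype
  have hL : ∀ x, L x = T x - z • (x : H) := fun x => rfl
  have hzp : 0 < |z.im| := abs_pos.2 hz
  have hbd : ∀ x, |z.im| * ‖x‖ ≤ ‖L x‖ := fun x => hT.pmap_norm_le_norm_map_sub z x
  have hanti : AntilipschitzWith (|z.im|⁻¹).toNNReal L := by
    refine AddMonoidHomClass.antilipschitz_of_bound L fun x => ?_
    rw [Real.coe_toNNReal _ (by positivity), inv_mul_eq_div, le_div_iff₀ hzp, mul_comm]
    exact hbd x
  have hinj : Function.Injective L := hanti.injective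
  have hclosed : IsClosed (LinearMap.range L : Set H) := by
    refine isClosed_of_closure_subset fun y hy => ?_
    obtain ⟨u, hu, huy⟩ := mem_closure_iff_seq_limit.1 hy
    choose x hx using hu
    have hc : CauchySeq x := by
      have h1 : CauchySeq (fun n => L (x n)) := by simp_rw [hx]; exact huy.cauchySeq
      rw [Metric.cauchySeq_iff'] at h1 ⊢
      intro ε hε
      obtain ⟨N, hN⟩ := h1 (|z.im| * ε) (by positivity)
      refine ⟨N, fun n hn => ?_⟩
      have h2 := hN n hn
      rw [dist_eq_norm, ← map_sub] at h2
      rw [dist_eq_norm]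
      exact lt_of_mul_lt_mul_left ((hbd _).trans_lt h2) hzp.le
    have hc2 : CauchySeq (fun n => (x n : H)) := hc.map uniformContinuous_subtype_val
    obtain ⟨x0, hx0⟩ := cauchySeq_tendsto_of_complete hc2
    have hT' : Tendsto (fun n => ((x n : H), T (x n))) atTop (𝓝 (x0, y + z • x0)) := by
      refine hx0.prodMk_nhds ?_
      have : ∀ n, T (x n) = u n + z • (x n : H) := fun n => by rw [← hx n, hL]; simp
      simp_rw [this]
      exact huy.add (hx0.const_smul z)
    have hmem : (x0, y + z • x0) ∈ (T.graph : Set (H × H)) :=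
      hT.isClosed.mem_of_tendsto hT' (Eventually.of_forall fun n => LinearPMap.mem_graph _ _)
    obtain ⟨w, hw1, hw2⟩ := (LinearPMap.mem_graph_iff _).1 hmem
    dsimp only at hw1 hw2
    exact ⟨w, by rw [hL, hw2, hw1]; simp⟩
  have hrange : LinearMap.range L = ⊤ := by
    have h1 : (LinearMap.range L)ᗮ = ⊥ := by
      rw [Submodule.eq_bot_iff]
      intro y hy
      rw [Submodule.mem_orthogonal] at hy
      have hg : (y, (starRingEnd ℂ z) • y) ∈ T.graph := by
        refine hT.pmap_mem_graph_of_forall _ _ fun w => ?_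
        have := hy (L w) ⟨w, rfl⟩
        rw [hL, inner_sub_left, inner_smul_left, sub_eq_zero] at this
        rw [this, inner_smul_right]
      obtain ⟨w, hw1, hw2⟩ := (LinearPMap.mem_graph_iff _).1 hg
      dsimp only at hw1 hw2
      have h2 := hT.pmap_norm_le_norm_map_sub (starRingEnd ℂ z) w
      rw [hw2, hw1, sub_self, norm_zero, Complex.conj_im, abs_neg] at h2
      have : ‖y‖ ≤ 0 := by
        by_contra hcon
        push Not at hcon
        nlinarith [mul_pos hzp hcon]
      exact norm_le_zero_iff.1 this
    have h2 := Submodule.topologicalClosure_eq_top_iff.2 h1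
    rwa [hclosed.submodule_topologicalClosure_eq] at h2
  let e : T.domain ≃ₗ[ℂ] H := LinearEquiv.ofBijective L ⟨hinj, LinearMap.range_eq_top.1 hrange⟩
  let R : H →L[ℂ] H := (T.domain.subtype.comp e.symm.toLinearMap).mkContinuous (|z.im|⁻¹) (by
    intro x
    have h1 := hbd (e.symm x)
    have h2 : L (e.symm x) = x := e.apply_symm_apply x
    rw [h2] at h1
    rw [inv_mul_eq_div, le_div_iff₀ hzp, mul_comm]
    exact h1)
  have hR : ∀ x, R x = (e.symm x : H) := fun x => rfl
  refine ⟨R, fun x => ⟨(e.symm x).2, ?_⟩, fun y => ?_⟩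
  · exact e.apply_symm_apply x
  · rw [hR, ← hL]
    exact congrArg _ (e.symm_apply_apply y)

theorem IsResolventAt.apply_mem {T : H →ₗ.[ℂ] H} {z : ℂ} {R : H →L[ℂ] H} (h : IsResolventAt T z R)
    (x : H) : R x ∈ T.domain := (h.1 x).1

theorem IsResolventAt.map_apply {T : H →ₗ.[ℂ] H} {z : ℂ} {R : H →L[ℂ] H} (h : IsResolventAt T z R)
    (x : H) : T ⟨R x, h.apply_mem x⟩ = x + z • R x := by
  obtain ⟨h1, h2⟩ := h.1 x
  rw [← sub_eq_iff_eq_add]; exact h2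

theorem IsResolventAt.injective {T : H →ₗ.[ℂ] H} {z : ℂ} {R : H →L[ℂ] H} (h : IsResolventAt T z R) :
    Function.Injective R := by
  rw [injective_iff_map_eq_zero]
  intro x hx
  have h1 := h.map_apply x
  have h2 : (⟨R x, h.apply_mem x⟩ : T.domain) = 0 := Subtype.ext hx
  rw [h2, T.map_zero, hx, smul_zero, add_zero] at h1
  exact h1.symm

theorem IsResolventAt.isResolventAt_resolventOf {T : H →ₗ.[ℂ] H} {z : ℂ} {R : H →L[ℂ] H}
    (h : IsResolventAt T z R) : IsResolventAt T z (resolventOf T z) := by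
  have h' : ∃ R : H →L[ℂ] H, IsResolventAt T z R := ⟨R, h⟩
  rw [resolventOf, dif_pos h']
  exact h'.choose_spec

theorem IsResolventAt.sub_eq {T : H →ₗ.[ℂ] H} {z w : ℂ} {R S : H →L[ℂ] H} (hR : IsResolventAt T z R)
    (hS : IsResolventAt T w S) (x : H) : R x - S x = (z - w) • R (S x) := by
  have h1 := hR.2 ⟨S x, hS.apply_mem x⟩
  rw [hS.map_apply] at h1
  dsimp only at h1
  rw [add_sub_assoc, ← sub_smul, map_add, map_smul] at h1
  rw [sub_eq_iff_eq_add, ← sub_eq_iff_eq_add', ← neg_sub w z, neg_smul, sub_neg_eq_add, h1]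

theorem IsResolventAt.star_eq {T : H →ₗ.[ℂ] H} (hT : IsSelfAdjoint T) {z : ℂ} {R S : H →L[ℂ] H}
    (hR : IsResolventAt T z R) (hS : IsResolventAt T (starRingEnd ℂ z) S) : star R = S := by
  rw [ContinuousLinearMap.star_eq_adjoint, eq_comm, ContinuousLinearMap.eq_adjoint_iff]
  intro x y
  have h1 := hT.pmap_inner_map_eq ⟨S x, hS.apply_mem x⟩ ⟨R y, hR.apply_mem y⟩
  rw [hR.map_apply, hS.map_apply] at h1
  simp only [inner_add_left, inner_add_right, inner_smul_left, inner_smul_right,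
    Complex.conj_conj] at h1
  have h2 := add_right_cancel h1
  exact h2.symm

/-- The resolvent identity between `i` and `-i`, in both orders, with the resolvent at `-i`
recognised as `R*`. It yields normality of `R` and the location of its spectrum. -/
theorem IsResolventAt.sub_star {T : H →ₗ.[ℂ] H} (hT : IsSelfAdjoint T) {R : H →L[ℂ] H}
    (hR : IsResolventAt T Complex.I R) : R - star R = (2 * Complex.I) • (R * star R) ∧
      R - star R = (2 * Complex.I) • (star R * R) := by
  obtain ⟨S, hS⟩ := IsSelfAdjoint.pmap_exists_isResolventAt hT (z := starRingEnd ℂ Complex.I) (by simp)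
  rw [hR.star_eq hT hS]
  have hc : Complex.I - (starRingEnd ℂ) Complex.I = 2 * Complex.I := by
    rw [Complex.conj_I]; ring
  constructor
  · ext x
    have := hR.sub_eq hS x
    rw [hc] at this
    simpa using this
  · ext x
    have := hS.sub_eq hR x
    rw [← neg_sub Complex.I, hc, neg_smul] at this
    have h2 := congrArg (fun y => -y) this
    simpa using h2

theorem IsResolventAt.isStarNormal {T : H →ₗ.[ℂ] H} (hT : IsSelfAdjoint T) {R : H →L[ℂ] H}
    (hR : IsResolventAt T Complex.I R) : IsStarNormal R := by
  obtain ⟨h1, h2⟩ := hR.sub_star hT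
  rw [h1] at h2
  have h3 : (2 * Complex.I) ≠ 0 := by simp
  exact ⟨(smul_right_injective _ h3 h2).symm⟩

/-- The functional calculus turns `R - R* = 2i R R*` into `w - w̄ = 2i|w|²` on the spectrum: the
circle traced by `w = (t - i)⁻¹` for real `t`, together with `0`. -/
theorem IsResolventAt.spectrum_subset {T : H →ₗ.[ℂ] H} (hT : IsSelfAdjoint T) {R : H →L[ℂ] H}
    (hR : IsResolventAt T Complex.I R) {w : ℂ} (hw : w ∈ spectrum ℂ R) :
    w.im = Complex.normSq w := by
  have hn := hR.isStarNormal hT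
  have h1 := (hR.sub_star hT).1
  have h2 : cfc (fun w : ℂ => w - star w) R = cfc (fun w : ℂ => (2 * Complex.I) * (w * star w)) R := by
    rw [cfc_sub _ _ R, cfc_const_mul _ _ R, cfc_mul _ _ R, cfc_id' ℂ R, cfc_star_id R, h1]
  have h3 := eqOn_of_cfc_eq_cfc h2 (by fun_prop) (by fun_prop) hn hw
  have h4 := congrArg Complex.im h3
  simp at h4
  rw [Complex.normSq_apply]; linarith

end Resolvent

/-! ### Negative index of a quadratic form (law of inertia) -/

section NegIndex

universe u

variable {E F : Type u} [AddCommGroup E] [Module ℂ E] [AddCommGroup F] [Module ℂ F]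

/-- The quadratic form `q` has negative index `c`: there is a subspace `N` of dimension `c` on which
`q` is negative, and `q` is nonnegative on the kernel of a linear map into `N`. -/
def NegIndex (q : E → ℝ) (c : Cardinal.{u}) : Prop :=
  ∃ (N : Submodule ℂ E) (φ : E →ₗ[ℂ] N), (∀ x ∈ N, x ≠ 0 → q x < 0) ∧
    (∀ x, φ x = 0 → 0 ≤ q x) ∧ Module.rank ℂ N = c

/-- `φ ∘ ψ` is injective: on a nonzero kernel vector `q` would be both negative and nonnegative.
This makes the negative index unique and lets either half of its definition bound it. -/
theorem rank_le_of_neg_of_nonneg {q : E → ℝ} {L W : Type u} [AddCommGroup L] [Module ℂ L]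
    [AddCommGroup W] [Module ℂ W] (ψ : L →ₗ[ℂ] E) (hψ : ∀ x, x ≠ 0 → q (ψ x) < 0)
    (φ : E →ₗ[ℂ] W) (hφ : ∀ x, φ x = 0 → 0 ≤ q x) : Module.rank ℂ L ≤ Module.rank ℂ W := by
  refine LinearMap.rank_le_of_injective (φ.comp ψ) ?_
  rw [← LinearMap.ker_eq_bot, LinearMap.ker_eq_bot']
  intro x hx
  by_contra hne
  exact absurd (hφ _ hx) (not_le.2 (hψ x hne))

theorem NegIndex.le_rank {q : E → ℝ} {c : Cardinal.{u}} (h : NegIndex q c) {W : Type u}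
    [AddCommGroup W] [Module ℂ W] (φ : E →ₗ[ℂ] W) (hφ : ∀ x, φ x = 0 → 0 ≤ q x) :
    c ≤ Module.rank ℂ W := by
  obtain ⟨N, -, hN, -, rfl⟩ := h
  exact rank_le_of_neg_of_nonneg (q := q) N.subtype
    (fun x hx => hN x x.2 (by simpa using hx)) φ hφ

theorem NegIndex.rank_le {q : E → ℝ} {c : Cardinal.{u}} (h : NegIndex q c) {L : Type u}
    [AddCommGroup L] [Module ℂ L] (ψ : L →ₗ[ℂ] E) (hψ : ∀ x, x ≠ 0 → q (ψ x) < 0) :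
    Module.rank ℂ L ≤ c := by
  obtain ⟨N, φ, -, hφ, rfl⟩ := h
  exact rank_le_of_neg_of_nonneg ψ hψ φ hφ

theorem NegIndex.of_equiv {q : E → ℝ} {q' : F → ℝ} {c : Cardinal.{u}} (h : NegIndex q c)
    (e : E ≃ₗ[ℂ] F) (he : ∀ x, q' (e x) = q x) : NegIndex q' c := by
  obtain ⟨N, φ, hN, hφ, rfl⟩ := h
  have e' := e.submoduleMap N
  refine ⟨N.map e.toLinearMap, (e.submoduleMap N).toLinearMap ∘ₗ φ ∘ₗ e.symm.toLinearMap, ?_, ?_, ?_⟩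
  · rintro _ ⟨x, hx, rfl⟩ hne
    have := hN x hx (by rintro rfl; simp at hne)
    rwa [← he] at this
  · intro x hx
    have h1 : φ (e.symm x) = 0 := by simpa using hx
    have := hφ _ h1
    rwa [← he, e.apply_symm_apply] at this
  · exact (e.submoduleMap N).symm.rank_eq

/-- `q 0 = q' 0 = 0` is needed because a nonzero pair may have one zero component. -/
theorem NegIndex.prod {q : E → ℝ} {q' : F → ℝ} {c c' : Cardinal.{u}} (h : NegIndex q c)
    (h' : NegIndex q' c') (h0 : q 0 = 0) (h0' : q' 0 = 0) :
    NegIndex (fun x : E × F => q x.1 + q' x.2) (c + c') := by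
  obtain ⟨N, φ, hN, hφ, rfl⟩ := h
  obtain ⟨N', φ', hN', hφ', rfl⟩ := h'
  let e : (N × N') ≃ₗ[ℂ] (N.prod N' : Submodule ℂ (E × F)) :=
    { toFun := fun x => ⟨(x.1, x.2), x.1.2, x.2.2⟩
      invFun := fun x => (⟨x.1.1, x.2.1⟩, ⟨x.1.2, x.2.2⟩)
      map_add' := fun _ _ => rfl
      map_smul' := fun _ _ => rfl
      left_inv := fun _ => rfl
      right_inv := fun _ => rfl }
  refine ⟨N.prod N', e.toLinearMap ∘ₗ (φ.prodMap φ'), ?_, ?_, ?_⟩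
  · rintro ⟨x, y⟩ ⟨hx, hy⟩ hne
    dsimp only at *
    rcases eq_or_ne x 0 with rfl | hx0
    · have : y ≠ 0 := fun h => hne (by rw [h]; rfl)
      rw [h0, zero_add]
      exact hN' y hy this
    · have h1 := hN x hx hx0
      rcases eq_or_ne y 0 with rfl | hy0
      · rwa [h0', add_zero]
      · exact add_neg h1 (hN' y hy hy0)
  · rintro ⟨x, y⟩ hxy
    have h1 : (φ x, φ' y) = 0 := e.map_eq_zero_iff.1 hxy
    rw [Prod.mk_eq_zero] at h1
    exact add_nonneg (hφ x h1.1) (hφ' y h1.2)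
  · rw [← e.rank_eq, rank_prod']

end NegIndex

/-! ### Spectral projections and the negative index -/

section Bounded

universe u

variable {H : Type u} [NormedAddCommGroup H] [InnerProductSpace ℂ H] [CompleteSpace H]

/-- `⟨A x, x⟩ = ‖√A x‖²`. -/
theorem apply_eq_zero_of_isPositive {A : H →L[ℂ] H} (hA : A.IsPositive) {x : H}
    (hx : (inner ℂ (A x) x).re = 0) : A x = 0 := by
  have hA' : 0 ≤ A := (ContinuousLinearMap.nonneg_iff_isPositive A).2 hA
  have h1 : CFC.sqrt A * CFC.sqrt A = A := CFC.sqrt_mul_sqrt_self A hA'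
  have h2 : IsSelfAdjoint (CFC.sqrt A) := (CFC.sqrt_nonneg A).isSelfAdjoint
  have h3 : inner ℂ (A x) x = inner ℂ (CFC.sqrt A x) (CFC.sqrt A x) := by
    conv_lhs => rw [← h1]
    exact h2.isSymmetric _ _
  have h4 : CFC.sqrt A x = 0 := by
    rw [h3] at hx
    exact inner_self_eq_zero.1 (Complex.ext hx (inner_self_im (𝕜 := ℂ) _))
  rw [← h1, mul_apply_eq_comp, h4, map_zero]

/-- On the range of `N` the form is `-⟨N·,·⟩`, since `P N = 0`; it is strict because `N (N z) = 0`
gives `‖N z‖² = ⟨N N z, z⟩ = 0`. On the kernel of `N` only `P` remains, so `N` itself serves as the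
map onto the negative subspace. -/
theorem negIndex_of_isPositive {P N : H →L[ℂ] H} (hP : P.IsPositive) (hN : N.IsPositive)
    (hPN : P * N = 0) :
    NegIndex (fun x => (inner ℂ ((P - N) x) x).re) (Module.rank ℂ N.range) := by
  refine ⟨N.range, N.toLinearMap.rangeRestrict, ?_, ?_, rfl⟩
  · rintro _ ⟨z, rfl⟩ hne
    have h1 : (P - N) (N z) = - N (N z) := by
      have : P (N z) = 0 := congrArg (fun A : H →L[ℂ] H => A z) hPN
      simp [this]
    have h2 : 0 ≤ (inner ℂ (N (N z)) (N z)).re := hN.re_inner_nonneg_left (N z)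
    change (inner ℂ ((P - N) (N z)) (N z)).re < 0
    rw [h1, inner_neg_left, Complex.neg_re, neg_lt_zero]
    refine lt_of_le_of_ne h2 fun h3 => hne ?_
    have h4 := apply_eq_zero_of_isPositive hN h3.symm
    have h5 : inner ℂ (N z) (N z) = 0 := by
      rw [← hN.inner_left_eq_inner_right, h4, inner_zero_left]
    exact inner_self_eq_zero.1 h5
  · intro x hx
    have h1 : N x = 0 := congrArg Subtype.val hx
    dsimp only
    rw [sub_apply, h1, sub_zero]
    exact hP.re_inner_nonneg_left x

theorem exists_negIndex {A : H →L[ℂ] H} (hA : IsSelfAdjoint A) :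
    ∃ c, NegIndex (fun x => (inner ℂ (A x) x).re) c := by
  have h := negIndex_of_isPositive ((ContinuousLinearMap.nonneg_iff_isPositive _).1 (CFC.posPart_nonneg A))
    ((ContinuousLinearMap.nonneg_iff_isPositive _).1 (CFC.negPart_nonneg A)) (CFC.posPart_mul_negPart A)
  rw [CFC.posPart_sub_negPart A hA] at h
  exact ⟨_, h⟩

theorem isPositive_cfc {R : H →L[ℂ] H} {f : ℂ → ℝ} (hf : ∀ w, 0 ≤ f w) :
    (cfc (fun w => (f w : ℂ)) R).IsPositive := by
  rw [← ContinuousLinearMap.nonneg_iff_isPositive]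
  open scoped ComplexOrder in
  exact cfc_nonneg fun w _ => by exact_mod_cast hf w

/-- The function `t ↦ t⁻ / (1 + t²)`. -/
noncomputable def negPartDiv : C₀(ℝ, ℝ) where
  toFun t := max (-t) 0 / (1 + t ^ 2)
  continuous_toFun := by
    refine Continuous.div (by fun_prop) (by fun_prop) fun t => by positivity
  zero_at_infty' := by
    rw [Metric.tendsto_nhds]
    intro ε hε
    filter_upwards [(isCompact_closedBall (0 : ℝ) ε⁻¹).compl_mem_cocompact] with t ht
    have h1 : ε⁻¹ < |t| := by simpa using ht
    rw [Real.dist_eq, sub_zero, abs_div, abs_of_nonneg (le_max_right _ _),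
      abs_of_nonneg (by positivity), div_lt_iff₀ (by positivity)]
    have h2 : max (-t) 0 ≤ |t| := max_le (neg_le_abs t) (abs_nonneg t)
    have h3 : 1 < ε * |t| := by
      have := mul_lt_mul_of_pos_left h1 hε
      rwa [mul_inv_cancel₀ hε.ne'] at this
    have h4 : 0 < |t| := lt_trans (by positivity) h1
    nlinarith [sq_abs t]

/-- `F` is approximated uniformly on the spectrum by `b · F/(b + η)`, whose operator has values in
the range of that of `b`. The error is `F η/(b + η)`. -/
theorem cfc_mem_closure_range {R : H →L[ℂ] H} {F : ℂ → ℂ} {b : ℂ → ℝ} (hb : Continuous b)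
    (hb0 : ∀ w, 0 ≤ b w) (hF : ContinuousOn F (spectrum ℂ R)) (hFb : ∀ w, b w = 0 → F w = 0) (x : H) :
    (cfc F R : H →L[ℂ] H) x ∈ closure (range (cfc (fun w => (b w : ℂ)) R : H →L[ℂ] H)) := by
  by_cases hRn : IsStarNormal R
  swap
  · rw [cfc_apply_of_not_predicate (f := F) _ hRn]
    exact subset_closure ⟨0, map_zero _⟩
  have key : ∀ ε > 0, ∃ y, ‖(cfc F R : H →L[ℂ] H) x - (cfc (fun w => (b w : ℂ)) R : H →L[ℂ] H) y‖ ≤ ε * ‖x‖ := by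
    intro ε hε
    have hK : IsCompact (spectrum ℂ R) := spectrum.isCompact R
    obtain ⟨M, hM⟩ := hK.exists_bound_of_continuousOn hF
    -- Where `‖F‖ < ε` the error is small anyway. The rest of the spectrum is compact and `b` has a
    -- positive minimum there, as `F` vanishes with `b`.
    obtain ⟨η, hη, hη2⟩ : ∃ η > 0, ∀ w ∈ spectrum ℂ R, ε ≤ ‖F w‖ → ‖F w‖ * η ≤ ε * b w := by
      have hS : IsCompact {w ∈ spectrum ℂ R | ε ≤ ‖F w‖} := by
        have := hF.norm.preimage_isClosed_of_isClosed hK.isClosed (isClosed_Ici (a := ε))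
        exact hK.of_isClosed_subset this (fun w hw => hw.1)
      rcases eq_empty_or_nonempty {w ∈ spectrum ℂ R | ε ≤ ‖F w‖} with he | hne
      · refine ⟨1, one_pos, fun w hw hw2 => ?_⟩
        exact absurd (show w ∈ {w ∈ spectrum ℂ R | ε ≤ ‖F w‖} from ⟨hw, hw2⟩) (by rw [he]; simp)
      · obtain ⟨w0, hw0, hmin⟩ := hS.exists_isMinOn hne hb.continuousOn
        have hb1 : 0 < b w0 := lt_of_le_of_ne (hb0 _) fun h => by
          have := hw0.2
          rw [hFb w0 h.symm, norm_zero] at this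
          linarith
        have hMp : 0 < M := lt_of_lt_of_le hε (hw0.2.trans (hM w0 hw0.1))
        refine ⟨ε * b w0 / M, by positivity, fun w hw hw2 => ?_⟩
        have h1 : b w0 ≤ b w := hmin ⟨hw, hw2⟩
        calc ‖F w‖ * (ε * b w0 / M) ≤ M * (ε * b w0 / M) := by
              gcongr; exact hM w hw
          _ = ε * b w0 := by field_simp
          _ ≤ _ := by gcongr
    have hpos : ∀ w, ((b w + η : ℝ) : ℂ) ≠ 0 := fun w => by
      have := hb0 w
      exact_mod_cast (by positivity : b w + η ≠ 0)
    have hG : ContinuousOn (fun w => F w / ((b w + η : ℝ) : ℂ)) (spectrum ℂ R) := by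
      refine hF.div ?_ fun w _ => hpos w
      fun_prop
    have hbc : ContinuousOn (fun w => (b w : ℂ)) (spectrum ℂ R) := by fun_prop
    refine ⟨(cfc (fun w => F w / ((b w + η : ℝ) : ℂ)) R : H →L[ℂ] H) x, ?_⟩
    rw [← mul_apply_eq_comp, ← cfc_mul _ _ R hbc hG, ← sub_apply,
      ← cfc_sub F (fun w => (b w : ℂ) * (F w / ((b w + η : ℝ) : ℂ))) R hF (hbc.mul hG)]
    refine (ContinuousLinearMap.le_opNorm _ _).trans ?_
    refine mul_le_mul_of_nonneg_right ?_ (norm_nonneg x)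
    refine norm_cfc_le hε.le fun w hw => ?_
    have h1 : F w - b w * (F w / ((b w + η : ℝ) : ℂ)) = F w * (η / (b w + η) : ℝ) := by
      have := hpos w
      push_cast at this ⊢
      field_simp
      ring
    have hbw := hb0 w
    rw [h1, norm_mul, Complex.norm_real, Real.norm_of_nonneg (by positivity), mul_div_assoc',
      div_le_iff₀ (by positivity)]
    rcases le_total ε ‖F w‖ with h2 | h2
    · nlinarith [hη2 w hw h2]
    · nlinarith [norm_nonneg (F w)]
  rw [Metric.mem_closure_iff]
  intro ε hε
  obtain ⟨y, hy⟩ := key (ε / (2 * (‖x‖ + 1))) (by positivity)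
  refine ⟨_, ⟨y, rfl⟩, ?_⟩
  rw [dist_eq_norm]
  refine hy.trans_lt ?_
  rw [div_mul_eq_mul_div, div_lt_iff₀ (by positivity)]
  nlinarith [norm_nonneg x]

/-- For `w = (t - i)⁻¹` one has `Re w = t/(1 + t²)`, so the weight `1/(1 + t²)` makes the function
of `T` exactly the negative part of `Re w`. -/
theorem functionOf_negPartDiv {T : H →ₗ.[ℂ] H} (hT : IsSelfAdjoint T)
    (hR : IsResolventAt T Complex.I (resolventOf T Complex.I)) :
    functionOf T negPartDiv =
      cfc (fun w : ℂ => ((max (-w.re) 0 : ℝ) : ℂ)) (resolventOf T Complex.I) := by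
  refine cfc_congr fun w hw => ?_
  have h1 := hR.spectrum_subset hT hw
  split_ifs with h0
  · simp [h0]
  · congr 1
    change max (-(w⁻¹).re) 0 / (1 + (w⁻¹).re ^ 2) = _
    have hn : 0 < Complex.normSq w := Complex.normSq_pos.2 h0
    have h2 : Complex.normSq w = w.re ^ 2 + Complex.normSq w ^ 2 := by
      conv_lhs => rw [Complex.normSq_apply, h1]
      ring
    rw [Complex.inv_re]
    have h3 : max (-(w.re / Complex.normSq w)) 0 = max (-w.re) 0 / Complex.normSq w := by
      rw [← neg_div, ← max_div_div_right hn.le, zero_div]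
    have h4 : 1 + (w.re / Complex.normSq w) ^ 2 = 1 / Complex.normSq w := by
      rw [div_pow, eq_div_iff hn.ne', add_mul, div_mul_eq_mul_div, one_mul, pow_two (Complex.normSq w),
        mul_div_mul_right _ _ hn.ne', ← eq_sub_iff_add_eq', div_eq_iff hn.ne']
      nlinarith
    rw [h3, h4, div_div_eq_mul_div, div_mul_cancel₀ _ hn.ne', div_one]

/-- One function suffices: every admissible `f` vanishes where the negative part of `Re w` does, so
`cfc_mem_closure_range` applies, and `negPartDiv` is itself admissible. -/
theorem spectralSubspace_Iio_zero {T : H →ₗ.[ℂ] H} (hT : IsSelfAdjoint T)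
    (hR : IsResolventAt T Complex.I (resolventOf T Complex.I)) :
    spectralSubspace T (Iio 0) =
      (cfc (fun w : ℂ => ((max (-w.re) 0 : ℝ) : ℂ)) (resolventOf T Complex.I)).range.topologicalClosure := by
  refine le_antisymm (Submodule.topologicalClosure_minimal _ (iSup_le ?_)
    (Submodule.isClosed_topologicalClosure _)) (Submodule.topologicalClosure_mono ?_)
  · rintro ⟨f, hf⟩ _ ⟨x, rfl⟩
    change (functionOf T f : H →L[ℂ] H) x ∈ closure (range (cfc (fun w : ℂ => ((max (-w.re) 0 : ℝ) : ℂ))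
      (resolventOf T Complex.I) : H →L[ℂ] H))
    -- The calculus returns `0` for a function not continuous on the spectrum, so continuity need
    -- not be verified.
    by_cases hc : ContinuousOn (fun w : ℂ => if w = 0 then 0 else ((f (w⁻¹).re : ℝ) : ℂ))
      (spectrum ℂ (resolventOf T Complex.I))
    · refine cfc_mem_closure_range (b := fun w : ℂ => max (-w.re) 0) (by fun_prop)
        (fun w => le_max_right _ _) hc (fun w hw => ?_) x
      split_ifs with h0
      · rfl
      · have h1 : 0 ≤ w.re := by
          have := (le_max_left (-w.re) 0).trans_eq hw
          linarith
        rw [hf, Complex.ofReal_zero]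
        rw [mem_Iio, not_lt, Complex.inv_re]
        exact div_nonneg h1 (Complex.normSq_nonneg w)
    · rw [functionOf, cfc_apply_of_not_continuousOn _ hc]
      exact subset_closure ⟨0, by simp⟩
  · rw [← functionOf_negPartDiv hT hR]
    refine le_iSup (fun f : {f : C₀(ℝ, ℝ) // ∀ t, t ∉ Iio 0 → f t = 0} =>
      LinearMap.range (functionOf T f.1).toLinearMap) ⟨negPartDiv, fun t ht => ?_⟩
    rw [mem_Iio, not_lt] at ht
    change max (-t) 0 / (1 + t ^ 2) = 0
    rw [max_eq_right (by linarith), zero_div]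

theorem toENat_rank_topologicalClosure (N : Submodule ℂ H) :
    Cardinal.toENat (Module.rank ℂ N.topologicalClosure) = Cardinal.toENat (Module.rank ℂ N) := by
  by_cases h : Module.rank ℂ N < Cardinal.aleph0
  · have := Module.rank_lt_aleph0_iff.1 h
    rw [N.closed_of_finiteDimensional.submodule_topologicalClosure_eq]
  · rw [not_lt] at h
    rw [Cardinal.toENat_eq_top.2 h, Cardinal.toENat_eq_top]
    exact h.trans (Submodule.rank_mono N.le_topologicalClosure)

/-- The number of negative eigenvalues is the negative index of the quadratic form of the operator. -/
theorem exists_negIndex_kappaMinus {T : H →ₗ.[ℂ] H} (hT : IsSelfAdjoint T) :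
    ∃ c, NegIndex (fun x : T.domain => (inner ℂ (x : H) (T x)).re) c ∧
      kappaMinus T = Cardinal.toENat c := by
  obtain ⟨_, hR'⟩ := hT.pmap_exists_isResolventAt (z := Complex.I) (by simp)
  have hR := hR'.isResolventAt_resolventOf
  refine ⟨Module.rank ℂ (cfc (fun w : ℂ => ((max (-w.re) 0 : ℝ) : ℂ))
    (resolventOf T Complex.I) : H →L[ℂ] H).range, ?_, by
    rw [kappaMinus, spectralSubspace_Iio_zero hT hR, toENat_rank_topologicalClosure]⟩
  have hn := hR.isStarNormal hT
  generalize resolventOf T Complex.I = R at hR hn ⊢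
  have h1 := negIndex_of_isPositive
    (isPositive_cfc (R := R) (f := fun w => max w.re 0) fun w => le_max_right _ _)
    (isPositive_cfc (R := R) (f := fun w => max (-w.re) 0) fun w => le_max_right _ _) (by
      rw [← cfc_mul _ _ R, ← cfc_const_zero ℂ R]
      refine cfc_congr fun w _ => ?_
      rcases le_total w.re 0 with h | h
      · simp [max_eq_right h]
      · simp [max_eq_right (neg_nonpos.2 h)])
  -- The two operators in `h1` are the positive and negative parts of `Re R = (R + R*)/2`.
  have h2 : (cfc (fun w : ℂ => ((max w.re 0 : ℝ) : ℂ)) R : H →L[ℂ] H) - cfc (fun w : ℂ => ((max (-w.re) 0 : ℝ) : ℂ)) R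
      = (1 / 2 : ℂ) • (R + star R) := by
    rw [← cfc_sub (fun w : ℂ => ((max w.re 0 : ℝ) : ℂ)) (fun w : ℂ => ((max (-w.re) 0 : ℝ) : ℂ)) R]
    have h3 : (1 / 2 : ℂ) • (R + star R) = cfc (fun w : ℂ => (1 / 2 : ℂ) * (w + star w)) R := by
      rw [cfc_const_mul _ _ R, cfc_add R _ _, cfc_id' ℂ R, cfc_star_id R]
    rw [h3]
    refine cfc_congr fun w _ => ?_
    have h4 : max w.re 0 - max (-w.re) 0 = w.re := by
      rcases le_total w.re 0 with h | h
      · rw [max_eq_right h, max_eq_left (by linarith)]; ring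
      · rw [max_eq_left h, max_eq_right (by linarith)]; ring
    rw [← Complex.ofReal_sub, h4]
    apply Complex.ext <;> simp <;> ring
  rw [h2] at h1
  -- `R` identifies `H` with `dom T`, and `⟨R x, T R x⟩ = ⟨R x, x⟩ + i‖R x‖²` has the real part of
  -- `⟨(Re R) x, x⟩`.
  let e : H ≃ₗ[ℂ] T.domain := LinearEquiv.ofBijective
    (LinearMap.codRestrict T.domain R.toLinearMap hR.apply_mem)
    ⟨fun x y hxy => hR.injective (congrArg Subtype.val hxy),
      fun y => ⟨T y - Complex.I • (y : H), Subtype.ext (hR.2 y)⟩⟩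
  refine h1.of_equiv e fun x => ?_
  have h4 : T (e x) = x + Complex.I • R x := hR.map_apply x
  have h5 : (e x : H) = R x := rfl
  rw [h4, h5, inner_add_right, inner_smul_right, inner_self_eq_norm_sq_to_K]
  have h6 : (inner ℂ (star R x) x : ℂ).re = (inner ℂ (R x) x : ℂ).re := by
    rw [ContinuousLinearMap.star_eq_adjoint, ContinuousLinearMap.adjoint_inner_left,
      ← inner_conj_symm, Complex.conj_re]
  simp only [smul_apply, add_apply, inner_smul_left, inner_add_left]
  have h7 : (((‖R x‖ : ℂ) ^ 2)).im = 0 := by rw [← Complex.ofReal_pow, Complex.ofReal_im]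
  simp [Complex.add_re, h6]
  rw [h7]
  ring

end Bounded

/-! ### Operators represented by bounded forms -/

section Forms

open scoped InnerProduct

universe u

variable {H E : Type u} [NormedAddCommGroup H] [InnerProductSpace ℂ H] [CompleteSpace H]
  [NormedAddCommGroup E] [InnerProductSpace ℂ E] [CompleteSpace E]

/-- The operator `T` is represented by the form `⟨Q e, e'⟩` on the space `E` embedded by `j`, and its
domain is dense in `E`. -/
structure FormOf (T : H →ₗ.[ℂ] H) (j : E →L[ℂ] H) (Q : E →L[ℂ] E) : Prop where
  injective : Function.Injective j
  lift : ∀ x y, (x, y) ∈ T.graph → ∃ e, j e = x ∧ Q e = (j†) y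
  dense : Dense {e : E | j e ∈ T.domain}

variable {T : H →ₗ.[ℂ] H} {j : E →L[ℂ] H} {Q : E →L[ℂ] E}

theorem FormOf.map_eq (h : FormOf T j Q) {e : E} (he : j e ∈ T.domain) : Q e = (j†) (T ⟨j e, he⟩) := by
  obtain ⟨e', h1, h2⟩ := h.lift _ _ (T.mem_graph ⟨j e, he⟩)
  rwa [h.injective h1] at h2

theorem FormOf.inner_eq (h : FormOf T j Q) {e : E} (he : j e ∈ T.domain) :
    (inner ℂ (Q e) e).re = (inner ℂ (j e) (T ⟨j e, he⟩)).re := by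
  rw [h.map_eq he, ContinuousLinearMap.adjoint_inner_left, ← inner_conj_symm, Complex.conj_re]

theorem FormOf.exists_eq (h : FormOf T j Q) (x : T.domain) : ∃ e, j e = x := by
  obtain ⟨e, he, -⟩ := h.lift _ _ (T.mem_graph x)
  exact ⟨e, he⟩

theorem FormOf.isNonnegativeOp_iff (h : FormOf T j Q) :
    IsNonnegativeOp T ↔ ∀ e, 0 ≤ (inner ℂ (Q e) e).re := by
  constructor
  · intro h1 e
    have hc : IsClosed {e : E | 0 ≤ (inner ℂ (Q e) e).re} :=
      isClosed_Ici.preimage (f := fun e : E => (inner ℂ (Q e) e).re) (by fun_prop)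
    refine hc.closure_subset_iff.2 (fun e he => ?_) (h.dense e)
    rw [mem_ofPred_eq, h.inner_eq he]
    exact h1 ⟨j e, he⟩
  · rintro h1 ⟨x, hx⟩
    obtain ⟨e, rfl⟩ := h.exists_eq ⟨x, hx⟩
    rw [← h.inner_eq]
    exact h1 e

/-- A vector `e` with `Q e = 0` satisfies `⟨T z, j e⟩ = 0` for all `z`, so self-adjointness puts `j
e` into `ker T`. Conversely `⟨Q e, e⟩ = 0` with `Q ≥ 0` forces `Q e = 0`. -/
theorem FormOf.isPositiveOp_iff (h : FormOf T j Q) (hT : IsSelfAdjoint T) (hQ : IsSelfAdjoint Q) :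
    IsPositiveOp T ↔ (∀ e, 0 ≤ (inner ℂ (Q e) e).re) ∧ Function.Injective Q := by
  constructor
  · intro h1
    refine ⟨h.isNonnegativeOp_iff.1 fun x => ?_, ?_⟩
    · rcases eq_or_ne (x : H) 0 with h0 | h0
      · rw [h0, inner_zero_left, Complex.zero_re]
      · exact (h1 x h0).le
    · rw [injective_iff_map_eq_zero]
      intro e he
      have hg : (j e, (0 : H)) ∈ T.graph := by
        refine hT.pmap_mem_graph_of_forall _ _ fun z => ?_
        obtain ⟨e', h2, h3⟩ := h.lift _ _ (T.mem_graph z)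
        rw [inner_zero_right, ← ContinuousLinearMap.adjoint_inner_left, ← h3]
        have h4 : inner ℂ (Q e') e = inner ℂ e' (Q e) := hQ.isSymmetric e' e
        rw [h4, he, inner_zero_right]
      obtain ⟨z, hz1, hz2⟩ := (LinearPMap.mem_graph_iff _).1 hg
      dsimp only at hz1 hz2
      by_contra hne
      have h2 := h1 z (by rw [hz1]; exact fun h0 => hne (h.injective (by rw [h0, map_zero])))
      rw [hz2, inner_zero_right, Complex.zero_re] at h2
      exact lt_irrefl _ h2
  · rintro ⟨h1, h2⟩ ⟨x, hx⟩ hne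
    obtain ⟨e, rfl⟩ := h.exists_eq ⟨x, hx⟩
    rw [← h.inner_eq]
    refine lt_of_le_of_ne (h1 e) fun h3 => hne ?_
    have hp : Q.IsPositive := ContinuousLinearMap.isPositive_def.2 ⟨hQ.isSymmetric, h1⟩
    have h4 := apply_eq_zero_of_isPositive hp h3.symm
    have h5 : e = 0 := h2 (by rw [h4, map_zero])
    change j e = 0
    rw [h5, map_zero]

/-- A finite-dimensional subspace on which the form is negative can be perturbed into a dense
subspace. -/
theorem rank_le_of_dense {D N : Submodule ℂ E} (hD : Dense (D : Set E)) [FiniteDimensional ℂ N]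
    (hN : ∀ x ∈ N, x ≠ 0 → (inner ℂ (Q x) x).re < 0) {W : Type u} [AddCommGroup W] [Module ℂ W]
    (φ : D →ₗ[ℂ] W) (hφ : ∀ x, φ x = 0 → 0 ≤ (inner ℂ (Q x) (x : E)).re) :
    Module.rank ℂ N ≤ Module.rank ℂ W := by
  let b := Module.finBasis ℂ N
  let n := Module.finrank ℂ N
  let f : (Fin n → E) → (Fin n → ℂ) → E := fun v c => ∑ i, c i • v i
  -- By compactness of the unit sphere of coefficients, negativity on the span is stable under small
  -- changes of the basis; density of `D` provides nearby vectors in `D`, and homogeneity extends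
  -- negativity from the sphere to all coefficients.
  have hev : ∀ᶠ v in 𝓝 (fun i => (b i : E)), ∀ c ∈ Metric.sphere (0 : Fin n → ℂ) 1,
      (inner ℂ (Q (f v c)) (f v c)).re < 0 := by
    refine (isCompact_sphere _ _).eventually_forall_of_forall_eventually fun c hc => ?_
    have hcont : Continuous fun p : (Fin n → E) × (Fin n → ℂ) =>
        (inner ℂ (Q (f p.1 p.2)) (f p.1 p.2)).re := by fun_prop
    refine (hcont.continuousAt (x := (fun i => (b i : E), c))).eventually_lt_const ?_
    have h1 : f (fun i => (b i : E)) c = (∑ i, c i • b i : N) := by simp [f]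
    dsimp only
    rw [h1]
    refine hN _ (Subtype.property _) fun h0 => ?_
    have h2 : (∑ i, c i • b i) = 0 := Subtype.ext h0
    have h3 := Fintype.linearIndependent_iff.1 b.linearIndependent c h2
    have h4 : c = 0 := funext h3
    rw [h4] at hc
    simp at hc
  obtain ⟨v, hv1, hv2⟩ := (hev.and_frequently
    (mem_closure_iff_frequently.1 (dense_pi (s := fun _ : Fin n => (D : Set E)) univ (fun _ _ => hD) _))).exists
  let v' : Fin n → D := fun i => ⟨v i, hv2 i (mem_univ i)⟩
  refine rank_le_of_neg_of_nonneg (q := fun x : D => (inner ℂ (Q x) (x : E)).re)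
    ((Fintype.linearCombination ℂ v').comp b.equivFun.toLinearMap) (fun x hx => ?_) φ hφ
  set c := b.equivFun x with hc
  have hc0 : c ≠ 0 := fun h => hx (b.equivFun.map_eq_zero_iff.1 h)
  have hcn : 0 < ‖c‖ := norm_pos_iff.2 hc0
  have h1 : (((Fintype.linearCombination ℂ v').comp b.equivFun.toLinearMap) x : E) = f v c := by
    simp [Fintype.linearCombination_apply, f, v', hc]
  have h2 := hv1 ((‖c‖⁻¹ : ℂ) • c) (by
    rw [mem_sphere_zero_iff_norm, norm_smul, norm_inv, Complex.norm_real, norm_norm,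
      inv_mul_cancel₀ hcn.ne'])
  have h3 : f v c = (‖c‖ : ℂ) • f v ((‖c‖⁻¹ : ℂ) • c) := by
    have : (‖c‖ : ℂ) ≠ 0 := by exact_mod_cast hcn.ne'
    simp only [f, Pi.smul_apply, smul_eq_mul, Finset.smul_sum, smul_smul]
    refine Finset.sum_congr rfl fun i _ => ?_
    rw [← mul_assoc, mul_inv_cancel₀ this, one_mul]
  rw [h1, h3, map_smul, inner_smul_left, inner_smul_right, Complex.conj_ofReal, ← mul_assoc,
    ← Complex.ofReal_mul, Complex.re_ofReal_mul]
  exact mul_neg_of_pos_of_neg (by positivity) h2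

/-- Restricting to the dense operator domain cannot raise the index. It does not lower it either,
since a finite-dimensional negative subspace can be moved into the domain; this is why `c` must be
finite. -/
theorem FormOf.kappaMinus_eq (h : FormOf T j Q) (hT : IsSelfAdjoint T) {c : Cardinal.{u}}
    (hc : NegIndex (fun e => (inner ℂ (Q e) e).re) c) (hfin : c < Cardinal.aleph0) :
    kappaMinus T = Cardinal.toENat c := by
  obtain ⟨c', hc', hk⟩ := exists_negIndex_kappaMinus hT
  rw [hk]
  congr 1
  let D : Submodule ℂ E := T.domain.comap j.toLinearMap
  have hD : Dense (D : Set E) := h.dense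
  let e : D ≃ₗ[ℂ] T.domain := LinearEquiv.ofBijective (j.toLinearMap.restrict (p := D) (q := T.domain)
      fun x hx => hx) ⟨fun x y hxy => Subtype.ext (h.injective (congrArg Subtype.val hxy)), fun x => by
        obtain ⟨e, he⟩ := h.exists_eq x
        exact ⟨⟨e, by change j e ∈ T.domain; rw [he]; exact x.2⟩, Subtype.ext he⟩⟩
  have hcD : NegIndex (fun x : D => (inner ℂ (Q x) (x : E)).re) c' := by
    refine hc'.of_equiv e.symm fun x => ?_
    obtain ⟨y, rfl⟩ := e.surjective x
    rw [e.symm_apply_apply]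
    exact h.inner_eq y.2
  refine le_antisymm ?_ ?_
  · obtain ⟨N, φ, hN, -, rfl⟩ := hcD
    exact hc.rank_le (D.subtype.comp N.subtype) fun x hx => hN x x.2 (by simpa using hx)
  · obtain ⟨N, -, hN, -, rfl⟩ := hc
    have := Module.rank_lt_aleph0_iff.1 hfin
    obtain ⟨N', φ, -, hφ, rfl⟩ := hcD
    exact rank_le_of_dense hD hN φ hφ

theorem inner_add_smul_re {lam : ℝ} (e : E) :
    (inner ℂ ((Q + (lam : ℂ) • ((j†) ∘L j)) e) e).re = (inner ℂ (Q e) e).re + lam * ‖j e‖ ^ 2 := by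
  have h1 : inner ℂ ((j†) (j e)) e = ((‖j e‖ ^ 2 : ℝ) : ℂ) := by
    rw [ContinuousLinearMap.adjoint_inner_left, inner_self_eq_norm_sq_to_K]; push_cast; rfl
  simp only [add_apply, smul_apply, ContinuousLinearMap.comp_apply, inner_add_left, inner_smul_left,
    h1, Complex.conj_ofReal, Complex.add_re, ← Complex.ofReal_mul, Complex.ofReal_re]

/-- The bounded inverse of a coercive shift of the form. -/
theorem exists_inverse_of_coercive (hQ : IsSelfAdjoint Q) {lam c : ℝ} (hc : 0 < c)
    (hco : ∀ e, c * ‖e‖ ^ 2 ≤ (inner ℂ (Q e) e).re + lam * ‖j e‖ ^ 2) :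
    ∃ G : E →L[ℂ] E, IsSelfAdjoint G ∧ Function.Bijective G ∧
      (∀ e, Q (G e) + (lam : ℂ) • (j†) (j (G e)) = e) ∧
      ∀ e, G (Q e + (lam : ℂ) • (j†) (j e)) = e := by
  set A := Q + (lam : ℂ) • ((j†) ∘L j) with hA
  have hAs : IsSelfAdjoint A := by
    refine hQ.add (IsSelfAdjoint.smul (Complex.conj_ofReal lam) ?_)
    rw [ContinuousLinearMap.isSelfAdjoint_iff', ContinuousLinearMap.adjoint_comp,
      ContinuousLinearMap.adjoint_adjoint]
  have hu : IsUnit A := by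
    refine ContinuousLinearMap.isUnit_of_forall_le_norm_inner_map A (c := ⟨c, hc.le⟩) hc fun e => ?_
    refine le_trans ?_ (Complex.re_le_norm _)
    rw [hA, inner_add_smul_re, mul_comm]
    exact hco e
  obtain ⟨U, hU⟩ := hu
  have h1 : ∀ e, A ((↑U⁻¹ : E →L[ℂ] E) e) = e := fun e => by
    rw [← hU, ← mul_apply_eq_comp, Units.mul_inv]; rfl
  have h2 : ∀ e, (↑U⁻¹ : E →L[ℂ] E) (A e) = e := fun e => by
    rw [← hU, ← mul_apply_eq_comp, Units.inv_mul]; rfl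
  refine ⟨↑U⁻¹, ?_, ⟨fun x y hxy => ?_, fun y => ⟨A y, h2 y⟩⟩, h1, h2⟩
  · rw [ContinuousLinearMap.isSelfAdjoint_iff', eq_comm, ContinuousLinearMap.eq_adjoint_iff]
    intro x y
    have h3 := hAs.isSymmetric ((↑U⁻¹ : E →L[ℂ] E) x) ((↑U⁻¹ : E →L[ℂ] E) y)
    simp only [ContinuousLinearMap.coe_coe, h1] at h3
    exact h3.symm
  · rw [← h1 x, hxy, h1]

theorem dense_range_adjoint_of_injective (hj : Function.Injective j) : DenseRange (j†) := by
  have h : (j†).range.topologicalClosure = ⊤ := by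
    rw [Submodule.topologicalClosure_eq_top_iff, ContinuousLinearMap.orthogonal_range,
      ContinuousLinearMap.adjoint_adjoint]
    exact LinearMap.ker_eq_bot.2 hj
  exact (Submodule.dense_iff_topologicalClosure_eq_top).2 h

theorem adjoint_injective_of_denseRange (hj : DenseRange j) : Function.Injective (j†) := by
  rw [injective_iff_map_eq_zero]
  intro z hz
  refine Dense.eq_zero_of_inner_left ℂ hj fun v hv => ?_
  obtain ⟨e, rfl⟩ := hv
  change inner ℂ z (j e) = 0
  rw [← ContinuousLinearMap.adjoint_inner_left, hz, inner_zero_left]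

/-- An operator represented by a coercive form with a dense domain and dense range of a shift is
essentially self-adjoint. -/
theorem closure_formOf (hQ : IsSelfAdjoint Q) (hj : Function.Injective j) (hjd : DenseRange j)
    {lam c : ℝ} (hc : 0 < c) (hco : ∀ e, c * ‖e‖ ^ 2 ≤ (inner ℂ (Q e) e).re + lam * ‖j e‖ ^ 2)
    (hlift : ∀ x y, (x, y) ∈ T.graph → ∃ e, j e = x ∧ Q e = (j†) y)
    (hdense : Dense {e : E | j e ∈ T.domain})
    (hran : DenseRange fun x : T.domain => T x + (lam : ℂ) • (x : H)) :
    T.IsClosable ∧ IsSelfAdjoint T.closure ∧ FormOf T.closure j Q := by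
  obtain ⟨G, hGs, hGb, hG1, hG2⟩ := exists_inverse_of_coercive hQ hc hco
  set K : H →L[ℂ] H := j ∘L G ∘L (j†) with hK
  have hKs : IsSelfAdjoint K := by
    have := IsSelfAdjoint.conj_adjoint hGs j
    rwa [hK]
  have hKi : Function.Injective K :=
    hj.comp (hGb.1.comp (adjoint_injective_of_denseRange hjd))
  -- The kernel of `L` is the graph of `K⁻¹ - lam`. It is closed because `L` is continuous, and it
  -- will be the closure of the graph of `T`.
  let L : H × H →L[ℂ] H := ContinuousLinearMap.fst ℂ H H -
    K ∘L (ContinuousLinearMap.snd ℂ H H + (lam : ℂ) • ContinuousLinearMap.fst ℂ H H)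
  have hL : ∀ x y, (x, y) ∈ L.ker ↔ x = K (y + (lam : ℂ) • x) := fun x y => by
    change x - K (y + (lam : ℂ) • x) = 0 ↔ _
    rw [sub_eq_zero]
  have hgr : L.ker.toLinearPMap.graph = L.ker := by
    refine Submodule.toLinearPMap_graph_eq _ ?_
    rintro ⟨x, y⟩ hxy h0
    dsimp only at h0
    subst h0
    have := (hL _ _).1 hxy
    rw [smul_zero, add_zero] at this
    exact hKi (by rw [← this, map_zero])
  have hle : T.graph ≤ L.ker := by
    rintro ⟨x, y⟩ hxy
    obtain ⟨e, rfl, he⟩ := hlift _ _ hxy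
    rw [hL]
    change j e = j (G ((j†) (y + (lam : ℂ) • j e)))
    rw [map_add, map_smul, ← he, hG2]
  have hcl : T.graph.topologicalClosure = L.ker := by
    refine le_antisymm (Submodule.topologicalClosure_minimal _ hle L.isClosed_ker) ?_
    rintro ⟨x, y⟩ hxy
    rw [hL] at hxy
    have h1 : y + (lam : ℂ) • x ∈ closure (range fun x : T.domain => T x + (lam : ℂ) • (x : H)) := hran _
    -- `Φ` parametrises `ker L` continuously by `z = y + lam x`, so density of the range of `T +
    -- lam` becomes density of the graph of `T` in `ker L`.
    let Φ : H → H × H := fun z => (K z, z - (lam : ℂ) • K z)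
    have hΦ : Continuous Φ := by fun_prop
    have h2 := image_closure_subset_closure_image hΦ ⟨_, h1, rfl⟩
    have h3 : Φ (y + (lam : ℂ) • x) = (x, y) := by
      simp only [Φ]; rw [← hxy, add_sub_cancel_right]
    rw [h3] at h2
    refine closure_mono ?_ h2
    rintro _ ⟨_, ⟨z, rfl⟩, rfl⟩
    have h4 := (hL _ _).1 (hle (T.mem_graph z))
    simp only [Φ]
    rw [← h4, add_sub_cancel_right]
    exact T.mem_graph z
  have hclos : T.IsClosable := ⟨_, hcl.trans hgr.symm⟩
  have hgc : ∀ x y, (x, y) ∈ T.closure.graph ↔ x = K (y + (lam : ℂ) • x) := fun x y => by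
    rw [← hclos.graph_closure_eq_closure_graph, hcl, hL]
  refine ⟨hclos, isSelfAdjoint_of_graph hKs hKi lam hgc, hj, fun x y hxy => ?_,
    hdense.mono fun e he => T.le_closure.1 he⟩
  rw [hgc] at hxy
  refine ⟨G ((j†) (y + (lam : ℂ) • x)), hxy.symm, ?_⟩
  have h1 := hG1 ((j†) (y + (lam : ℂ) • x))
  have h2 : j (G ((j†) (y + (lam : ℂ) • x))) = x := hxy.symm
  rw [h2, map_add, map_smul] at h1
  rw [map_add, map_smul]
  exact add_right_cancel h1

/-- An operator represented by a coercive form, with `0` in its resolvent set. -/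
theorem formOf_of_isResolventAt_zero (hQ : IsSelfAdjoint Q) (hj : Function.Injective j)
    {lam c : ℝ} (hc : 0 < c) (hco : ∀ e, c * ‖e‖ ^ 2 ≤ (inner ℂ (Q e) e).re + lam * ‖j e‖ ^ 2)
    (hlift : ∀ x y, (x, y) ∈ T.graph → ∃ e, j e = x ∧ Q e = (j†) y)
    {R : H →L[ℂ] H} (hR : IsResolventAt T 0 R) :
    IsSelfAdjoint T ∧ FormOf T j Q ∧ Function.Bijective Q ∧
      ∀ z, ∃ x : T.domain, T x + (lam : ℂ) • (x : H) = z := by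
  obtain ⟨G, hGs, hGb, hG1, hG2⟩ := exists_inverse_of_coercive hQ hc hco
  have hg : ∀ x, (R x, x) ∈ T.graph := fun x => by
    have h1 := hR.map_apply x
    rw [zero_smul, add_zero] at h1
    exact (LinearPMap.mem_graph_iff _).2 ⟨_, rfl, h1⟩
  have hRl : ∀ x, ∃ e, j e = R x ∧ Q e = (j†) x := fun x => hlift _ _ (hg x)
  have hQs : ∀ x y, inner ℂ (Q x) y = inner ℂ x (Q y) := fun x y => hQ.isSymmetric x y
  -- Symmetry of `Q` passes to `R`: if `e` and `e'` lift `R x` and `R y`, then `⟨R x, y⟩ = ⟨e, Q e'⟩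
  -- = ⟨Q e, e'⟩ = ⟨x, R y⟩`.
  have hRs : IsSelfAdjoint R := by
    rw [ContinuousLinearMap.isSelfAdjoint_iff', eq_comm, ContinuousLinearMap.eq_adjoint_iff]
    intro x y
    obtain ⟨e, h1, h2⟩ := hRl x
    obtain ⟨e', h3, h4⟩ := hRl y
    rw [← h1, ← h3, ← ContinuousLinearMap.adjoint_inner_left, ← ContinuousLinearMap.adjoint_inner_right,
      ← h2, ← h4, hQs]
  have hgr : ∀ x y, (x, y) ∈ T.graph ↔ x = R (y + ((0 : ℝ) : ℂ) • x) := fun x y => by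
    rw [Complex.ofReal_zero, zero_smul, add_zero]
    constructor
    · intro h
      obtain ⟨z, h1, h2⟩ := (LinearPMap.mem_graph_iff _).1 h
      dsimp only at h1 h2
      have := hR.2 z
      rw [zero_smul, sub_zero, h1, h2] at this
      exact this.symm
    · rintro rfl
      exact hg y
  have hQi : Function.Injective Q := by
    rw [injective_iff_map_eq_zero]
    intro e he
    -- Solving `Q e' = j† j e` gives `‖j e‖² = ⟨Q e', e⟩ = ⟨e', Q e⟩ = 0`.
    obtain ⟨e', h1, h2⟩ := hRl (j e)
    have h3 : inner ℂ (j e) (j e) = 0 := by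
      rw [← ContinuousLinearMap.adjoint_inner_left, ← h2, hQs, he, inner_zero_right]
    exact hj (by rw [inner_self_eq_zero.1 h3, map_zero])
  -- The variational solution for the shifted form lies in `dom T`: it and the lift of `R (z - lam j
  -- e)` have the same image under the injective `Q`.
  have hGj : ∀ z, (j (G ((j†) z)), z - (lam : ℂ) • j (G ((j†) z))) ∈ T.graph := by
    intro z
    set e := G ((j†) z) with he
    have h1 : Q e = (j†) (z - (lam : ℂ) • j e) := by
      rw [map_sub, map_smul, eq_sub_iff_add_eq]
      exact hG1 _
    obtain ⟨e', h2, h3⟩ := hRl (z - (lam : ℂ) • j e)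
    have h4 : e = e' := hQi (h1.trans h3.symm)
    have h5 := hg (z - (lam : ℂ) • j e)
    rwa [← h2, ← h4] at h5
  refine ⟨isSelfAdjoint_of_graph hRs hR.injective 0 hgr, ⟨hj, hlift, ?_⟩, ⟨hQi, fun F => ?_⟩, fun z => ?_⟩
  · have h1 : DenseRange (G ∘ (j†)) :=
      hGb.2.denseRange.comp (dense_range_adjoint_of_injective hj) G.continuous
    refine h1.mono ?_
    rintro _ ⟨z, rfl⟩
    exact LinearPMap.mem_domain_of_mem_graph (hGj z)
  -- `Q (G F)` misses `F` by `lam j† j (G F)`, which the lift of `R (j (G F))` corrects.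
  · obtain ⟨e, h1, h2⟩ := hRl (j (G F))
    refine ⟨G F + (lam : ℂ) • e, ?_⟩
    rw [map_add, map_smul, h2]
    exact hG1 F
  · obtain ⟨x, h1, h2⟩ := (LinearPMap.mem_graph_iff _).1 (hGj z)
    dsimp only at h1 h2
    exact ⟨x, by rw [h1, h2, sub_add_cancel]⟩

/-- The closure of a densely defined bounded operator. -/
theorem closure_eq_toPMap {S : H →L[ℂ] H} (hd : Dense (T.domain : Set H))
    (hS : ∀ x : T.domain, T x = S x) :
    T.IsClosable ∧ T.closure = S.toLinearMap.toPMap ⊤ := by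
  have hmem : ∀ x y, (x, y) ∈ (S.toLinearMap.toPMap ⊤).graph ↔ y = S x := fun x y => by
    rw [LinearPMap.mem_graph_iff]
    constructor
    · rintro ⟨z, h1, h2⟩
      dsimp only at h1 h2
      rw [← h2, ← h1]; rfl
    · rintro rfl
      exact ⟨⟨x, trivial⟩, rfl, rfl⟩
  have hcl : T.graph.topologicalClosure = (S.toLinearMap.toPMap ⊤).graph := by
    refine le_antisymm (Submodule.topologicalClosure_minimal _ ?_ ?_) ?_
    · rintro ⟨x, y⟩ hxy
      obtain ⟨z, h1, h2⟩ := (LinearPMap.mem_graph_iff _).1 hxy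
      dsimp only at h1 h2
      rw [hmem, ← h1, ← h2, hS]
    · have : ((S.toLinearMap.toPMap ⊤).graph : Set (H × H)) = {p | p.2 = S p.1} := by
        ext ⟨x, y⟩; exact hmem x y
      rw [this]
      exact isClosed_eq continuous_snd (S.continuous.comp continuous_fst)
    · rintro ⟨x, y⟩ hxy
      rw [hmem] at hxy
      subst hxy
      have hΦ : Continuous fun z : H => (z, S z) := by fun_prop
      have h2 := image_closure_subset_closure_image hΦ ⟨_, hd x, rfl⟩
      refine closure_mono ?_ h2
      rintro _ ⟨z, hz, rfl⟩
      have := T.mem_graph ⟨z, hz⟩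
      rwa [hS] at this
  have hclos : T.IsClosable := ⟨_, hcl⟩
  exact ⟨hclos, LinearPMap.eq_of_eq_graph (by rw [← hclos.graph_closure_eq_closure_graph, hcl])⟩

theorem isSelfAdjoint_toPMap {S : H →L[ℂ] H} (hS : IsSelfAdjoint S) :
    IsSelfAdjoint (S.toLinearMap.toPMap ⊤) := by
  rw [LinearPMap.isSelfAdjoint_def]
  have := ContinuousLinearMap.toPMap_adjoint_eq_adjoint_toPMap_of_dense S (p := ⊤)
    (by simp)
  rw [ContinuousLinearMap.isSelfAdjoint_iff'.1 hS] at this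
  exact this

theorem formOf_toPMap (S : H →L[ℂ] H) :
    FormOf (S.toLinearMap.toPMap ⊤) (ContinuousLinearMap.id ℂ H) S := by
  refine ⟨Function.injective_id, fun x y hxy => ?_, ?_⟩
  · obtain ⟨z, h1, h2⟩ := (LinearPMap.mem_graph_iff _).1 hxy
    dsimp only at h1 h2
    refine ⟨x, rfl, ?_⟩
    rw [ContinuousLinearMap.adjoint_id, ← h2, ← h1]
    rfl
  · have : {e : H | ContinuousLinearMap.id ℂ H e ∈ (S.toLinearMap.toPMap ⊤).domain} = univ :=
      eq_univ_of_forall fun _ => trivial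
    rw [this]
    exact dense_univ

end Forms

/-! ### The block operator and its form -/

section Block

open scoped InnerProduct

universe u

variable {H E : Type u} [NormedAddCommGroup H] [InnerProductSpace ℂ H] [CompleteSpace H]
  [NormedAddCommGroup E] [InnerProductSpace ℂ E] [CompleteSpace E]

/-- The embedding `(f, g) ↦ (j f, g)`. -/
noncomputable def blockEmb (j : E →L[ℂ] H) : WithLp 2 (E × H) →L[ℂ] WithLp 2 (H × H) :=
  (WithLp.prodContinuousLinearEquiv 2 ℂ H H).symm.toContinuousLinearMap ∘L
    ((j ∘L ContinuousLinearMap.fst ℂ E H).prod (ContinuousLinearMap.snd ℂ E H)) ∘L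
    (WithLp.prodContinuousLinearEquiv 2 ℂ E H).toContinuousLinearMap

/-- The operator `(f, g) ↦ (Q f + ν d† g, ν d f + g)`. -/
noncomputable def blockForm (Q : E →L[ℂ] E) (d : E →L[ℂ] H) (ν : ℝ) :
    WithLp 2 (E × H) →L[ℂ] WithLp 2 (E × H) :=
  (WithLp.prodContinuousLinearEquiv 2 ℂ E H).symm.toContinuousLinearMap ∘L
    ((Q ∘L ContinuousLinearMap.fst ℂ E H + (ν : ℂ) • (d†) ∘L ContinuousLinearMap.snd ℂ E H).prod
      ((ν : ℂ) • d ∘L ContinuousLinearMap.fst ℂ E H + ContinuousLinearMap.snd ℂ E H)) ∘L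
    (WithLp.prodContinuousLinearEquiv 2 ℂ E H).toContinuousLinearMap

variable {T P : H →ₗ.[ℂ] H} {j d : E →L[ℂ] H} {Q : E →L[ℂ] E} {ν : ℝ}

theorem blockEmb_apply (x : WithLp 2 (E × H)) : blockEmb j x = WithLp.toLp 2 (j x.fst, x.snd) := rfl

theorem blockForm_apply (x : WithLp 2 (E × H)) :
    blockForm Q d ν x = WithLp.toLp 2 (Q x.fst + (ν : ℂ) • (d†) x.snd, (ν : ℂ) • d x.fst + x.snd) := rfl

theorem blockEmb_injective (hj : Function.Injective j) : Function.Injective (blockEmb (H := H) j) := by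
  intro x y hxy
  have h1 := congrArg (fun z => z.fst) hxy
  have h2 := congrArg (fun z => z.snd) hxy
  have h3 : x.fst = y.fst := hj h1
  exact (WithLp.ofLp_injective 2) (Prod.ext h3 h2)

theorem blockEmb_adjoint_apply (y : WithLp 2 (H × H)) :
    ((blockEmb j)†) y = WithLp.toLp 2 ((j†) y.fst, y.snd) := by
  refine ext_inner_right ℂ fun x => ?_
  rw [ContinuousLinearMap.adjoint_inner_left, blockEmb_apply, WithLp.prod_inner_apply,
    WithLp.prod_inner_apply]
  change inner ℂ y.fst (j x.fst) + inner ℂ y.snd x.snd = inner ℂ ((j†) y.fst) x.fst + inner ℂ y.snd x.snd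
  rw [ContinuousLinearMap.adjoint_inner_left]

theorem inner_blockForm (x y : WithLp 2 (E × H)) :
    inner ℂ (blockForm Q d ν x) y = inner ℂ (Q x.fst) y.fst + (ν : ℂ) * inner ℂ x.snd (d y.fst) +
      (ν : ℂ) * inner ℂ (d x.fst) y.snd + inner ℂ x.snd y.snd := by
  rw [WithLp.prod_inner_apply]
  change inner ℂ (Q x.fst + (ν : ℂ) • (d†) x.snd) y.fst + inner ℂ ((ν : ℂ) • d x.fst + x.snd) y.snd = _
  rw [inner_add_left, inner_add_left, inner_smul_left, inner_smul_left,
    ContinuousLinearMap.adjoint_inner_left, Complex.conj_ofReal]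
  ring

theorem isSelfAdjoint_blockForm (hQ : IsSelfAdjoint Q) : IsSelfAdjoint (blockForm Q d ν) := by
  rw [ContinuousLinearMap.isSelfAdjoint_iff', eq_comm, ContinuousLinearMap.eq_adjoint_iff]
  intro x y
  have hQs : ∀ x y, inner ℂ (Q x) y = inner ℂ x (Q y) := fun x y => hQ.isSymmetric x y
  rw [← inner_conj_symm x, inner_blockForm, inner_blockForm]
  simp only [map_add, map_mul, inner_conj_symm, Complex.conj_ofReal, hQs]
  ring

theorem re_inner_blockForm_self (x : WithLp 2 (E × H)) :
    (inner ℂ (blockForm Q d ν x) x).re = (inner ℂ (Q x.fst) x.fst).re +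
      2 * ν * (inner ℂ (d x.fst) x.snd).re + ‖x.snd‖ ^ 2 := by
  rw [inner_blockForm]
  have h1 : (inner ℂ x.snd (d x.fst)).re = (inner ℂ (d x.fst) x.snd).re := by
    rw [← inner_conj_symm, Complex.conj_re]
  have h2 : (inner ℂ x.snd x.snd : ℂ).re = ‖x.snd‖ ^ 2 := by
    have := inner_self_eq_norm_sq (𝕜 := ℂ) x.snd
    exact this
  simp only [Complex.add_re, Complex.re_ofReal_mul, h1, h2]
  ring

theorem norm_sq_withLp (x : WithLp 2 (E × H)) : ‖x‖ ^ 2 = ‖x.fst‖ ^ 2 + ‖x.snd‖ ^ 2 :=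
  WithLp.prod_norm_sq_eq_of_L2 x

/-- Young's inequality absorbs the cross term into half of the coercivity in `f` and a large shift
in `g`. The bound `-1 < lam'` keeps the shifted lower right entry `1 + lam'` nonzero. -/
theorem blockForm_coercive {lam c : ℝ} (hc : 0 < c)
    (hco : ∀ e, c * ‖e‖ ^ 2 ≤ (inner ℂ (Q e) e).re + lam * ‖j e‖ ^ 2) :
    ∃ lam' c' : ℝ, 0 < c' ∧ -1 < lam' ∧ lam ≤ lam' ∧
      ∀ x, c' * ‖x‖ ^ 2 ≤ (inner ℂ (blockForm Q d ν x) x).re + lam' * ‖blockEmb j x‖ ^ 2 := by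
  set M := |ν| * ‖d‖ with hM
  have hM0 : 0 ≤ M := by positivity
  refine ⟨max lam (2 * M ^ 2 / c + c), c / 2, by positivity, ?_, le_max_left _ _, fun x => ?_⟩
  · refine lt_of_lt_of_le ?_ (le_max_right _ _)
    have : 0 ≤ 2 * M ^ 2 / c := by positivity
    linarith
  rw [re_inner_blockForm_self, norm_sq_withLp, norm_sq_withLp]
  change _ ≤ _ + _ * (‖j x.fst‖ ^ 2 + ‖x.snd‖ ^ 2)
  set lam' := max lam (2 * M ^ 2 / c + c)
  have h1 : lam * ‖j x.fst‖ ^ 2 ≤ lam' * ‖j x.fst‖ ^ 2 := by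
    gcongr; exact le_max_left _ _
  have h2 : (2 * M ^ 2 / c + c) * ‖x.snd‖ ^ 2 ≤ lam' * ‖x.snd‖ ^ 2 := by
    gcongr; exact le_max_right _ _
  have h3 := hco x.fst
  have h4 : |ν * (inner ℂ (d x.fst) x.snd).re| ≤ M * ‖x.fst‖ * ‖x.snd‖ := by
    rw [abs_mul, hM]
    calc |ν| * |(inner ℂ (d x.fst) x.snd).re| ≤ |ν| * (‖d x.fst‖ * ‖x.snd‖) := by
          gcongr
          exact (Complex.abs_re_le_norm _).trans (norm_inner_le_norm _ _)
      _ ≤ |ν| * (‖d‖ * ‖x.fst‖ * ‖x.snd‖) := by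
          gcongr; exact d.le_opNorm _
      _ = _ := by ring
  have h5 := neg_abs_le (ν * (inner ℂ (d x.fst) x.snd).re)
  have h6 : 2 * (M * ‖x.fst‖ * ‖x.snd‖) ≤ c / 2 * ‖x.fst‖ ^ 2 + 2 * M ^ 2 / c * ‖x.snd‖ ^ 2 := by
    have : c / 2 * ‖x.fst‖ ^ 2 + 2 * M ^ 2 / c * ‖x.snd‖ ^ 2 - 2 * (M * ‖x.fst‖ * ‖x.snd‖)
        = (c * ‖x.fst‖ - 2 * M * ‖x.snd‖) ^ 2 / (2 * c) := by
      field_simp; ring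
    have h7 : 0 ≤ (c * ‖x.fst‖ - 2 * M * ‖x.snd‖) ^ 2 / (2 * c) := by positivity
    linarith
  have h8 : 0 ≤ c * ‖x.snd‖ ^ 2 := by positivity
  nlinarith

/-- The hypotheses on the entries of the block operator matrix: `E` is the domain of the skew-adjoint
operator `P`, with `j` the embedding and `d` the action of `P`. -/
structure SkewData (P : H →ₗ.[ℂ] H) (j d : E →L[ℂ] H) : Prop where
  injective : Function.Injective j
  mem_graph_iff : ∀ x y, (x, y) ∈ P.graph ↔ ∃ e, j e = x ∧ d e = y
  skew : ∀ e e', inner ℂ (d e) (j e') = -inner ℂ (j e) (d e')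
  maximal : ∀ x y, (∀ e, inner ℂ (d e) x = -inner ℂ (j e) y) → ∃ e, j e = x ∧ d e = y

theorem SkewData.mem_domain_iff (h : SkewData P j d) (x : H) : x ∈ P.domain ↔ ∃ e, j e = x := by
  rw [LinearPMap.mem_domain_iff]
  simp_rw [h.mem_graph_iff]
  exact ⟨fun ⟨_, e, he, _⟩ => ⟨e, he⟩, fun ⟨e, he⟩ => ⟨_, e, he, rfl⟩⟩

theorem SkewData.apply_eq (h : SkewData P j d) {e : E} (he : j e ∈ P.domain) : P ⟨j e, he⟩ = d e := by
  obtain ⟨e', h1, h2⟩ := (h.mem_graph_iff _ _).1 (P.mem_graph ⟨j e, he⟩)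
  rw [← h2, h.injective h1]

theorem mem_blockOp_domain_iff (h : SkewData P j d)
    (hlift : ∀ x y, (x, y) ∈ T.graph → ∃ e, j e = x ∧ Q e = (j†) y) (F : WithLp 2 (H × H)) :
    F ∈ (blockOp T (-((ν : ℂ) • P)) ((ν : ℂ) • P) (idOp H)).domain ↔
      F.fst ∈ T.domain ∧ F.snd ∈ P.domain := by
  constructor
  · rintro ⟨⟨h1, -⟩, ⟨h2, -⟩⟩
    exact ⟨h1, h2⟩
  · rintro ⟨h1, h2⟩
    refine ⟨⟨h1, ?_⟩, ⟨h2, trivial⟩⟩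
    obtain ⟨e, he, -⟩ := hlift _ _ (T.mem_graph ⟨_, h1⟩)
    exact (h.mem_domain_iff _).2 ⟨e, he⟩

theorem blockOp_apply (h : SkewData P j d)
    (F : (blockOp T (-((ν : ℂ) • P)) ((ν : ℂ) • P) (idOp H)).domain) {e e' : E}
    (he : j e = F.1.fst) (he' : j e' = F.1.snd) :
    blockOp T (-((ν : ℂ) • P)) ((ν : ℂ) • P) (idOp H) F =
      WithLp.toLp 2 (T ⟨F.1.fst, F.2.1.1⟩ - (ν : ℂ) • d e', (ν : ℂ) • d e + j e') := by
  have h1 : P ⟨F.1.fst, F.2.1.2⟩ = d e := by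
    have h2 : j e ∈ P.domain := (h.mem_domain_iff _).2 ⟨e, rfl⟩
    rw [← h.apply_eq h2]
    congr 1
    exact Subtype.ext he.symm
  have h1' : P ⟨F.1.snd, F.2.2.1⟩ = d e' := by
    have h2 : j e' ∈ P.domain := (h.mem_domain_iff _).2 ⟨e', rfl⟩
    rw [← h.apply_eq h2]
    congr 1
    exact Subtype.ext he'.symm
  change WithLp.toLp 2 (T ⟨F.1.fst, F.2.1.1⟩ + -((ν : ℂ) • P ⟨F.1.snd, F.2.2.1⟩),
    (ν : ℂ) • P ⟨F.1.fst, F.2.1.2⟩ + F.1.snd) = _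
  rw [h1, h1', he', sub_eq_add_neg]

/-- Skewness gives `-j† P = d† j` on `E`, so the entry `-ν P g` becomes `ν d† g`, which is defined
for every `g` in `H`. Hence the second component of the form domain is all of `H`. -/
theorem blockOp_lift (h : SkewData P j d)
    (hlift : ∀ x y, (x, y) ∈ T.graph → ∃ e, j e = x ∧ Q e = (j†) y) (x y : WithLp 2 (H × H))
    (hxy : (x, y) ∈ (blockOp T (-((ν : ℂ) • P)) ((ν : ℂ) • P) (idOp H)).graph) :
    ∃ e, blockEmb j e = x ∧ blockForm Q d ν e = ((blockEmb j)†) y := by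
  obtain ⟨F, h1, h2⟩ := (LinearPMap.mem_graph_iff _).1 hxy
  dsimp only at h1 h2
  subst h1 h2
  obtain ⟨e, he, hQe⟩ := hlift _ _ (T.mem_graph ⟨F.1.fst, F.2.1.1⟩)
  obtain ⟨e', he'⟩ : ∃ e', j e' = F.1.snd := (h.mem_domain_iff _).1 F.2.2.1
  refine ⟨WithLp.toLp 2 (e, F.1.snd), ?_, ?_⟩
  · rw [blockEmb_apply]
    exact (WithLp.ofLp_injective 2) (Prod.ext he rfl)
  · rw [blockOp_apply h F he he', blockEmb_adjoint_apply, blockForm_apply]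
    refine (WithLp.ofLp_injective 2) (Prod.ext ?_ ?_)
    · change Q e + (ν : ℂ) • (d†) F.1.snd = (j†) (_ - (ν : ℂ) • d e')
      rw [map_sub, hQe, sub_eq_add_neg, map_smul, ← smul_neg]
      congr 2
      refine ext_inner_right ℂ fun f => ?_
      rw [inner_neg_left, ContinuousLinearMap.adjoint_inner_left,
        ContinuousLinearMap.adjoint_inner_left, h.skew, neg_neg, ← he']
    · change (ν : ℂ) • d e + F.1.snd = (ν : ℂ) • d e + j e'
      rw [he']

theorem toLp_mem_blockOp_domain (h : SkewData P j d)
    (hlift : ∀ x y, (x, y) ∈ T.graph → ∃ e, j e = x ∧ Q e = (j†) y) {e e' : E}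
    (he : j e ∈ T.domain) :
    WithLp.toLp 2 (j e, j e') ∈ (blockOp T (-((ν : ℂ) • P)) ((ν : ℂ) • P) (idOp H)).domain :=
  (mem_blockOp_domain_iff h hlift _).2 ⟨he, (h.mem_domain_iff _).2 ⟨e', rfl⟩⟩

theorem dense_blockOp_form_domain (h : SkewData P j d) (hT : FormOf T j Q) (hjd : DenseRange j) :
    Dense {x | blockEmb j x ∈ (blockOp T (-((ν : ℂ) • P)) ((ν : ℂ) • P) (idOp H)).domain} := by
  have h1 : Dense ({e : E | j e ∈ T.domain} ×ˢ (range j)) := hT.dense.prod hjd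
  have h2 := (WithLp.prodContinuousLinearEquiv 2 ℂ E H).symm.surjective.denseRange.dense_image
    (WithLp.prodContinuousLinearEquiv 2 ℂ E H).symm.continuous h1
  refine h2.mono ?_
  rintro _ ⟨⟨e, _⟩, ⟨he, ⟨e', rfl⟩⟩, rfl⟩
  exact toLp_mem_blockOp_domain h hT.lift he

theorem denseRange_blockEmb (hjd : DenseRange j) : DenseRange (blockEmb (H := H) j) := by
  have h1 : Dense ((range j) ×ˢ (univ : Set H)) := hjd.prod dense_univ
  have h2 := (WithLp.prodContinuousLinearEquiv 2 ℂ H H).symm.surjective.denseRange.dense_image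
    (WithLp.prodContinuousLinearEquiv 2 ℂ H H).symm.continuous h1
  refine h2.mono ?_
  rintro _ ⟨⟨_, g⟩, ⟨⟨e, rfl⟩, -⟩, rfl⟩
  exact ⟨WithLp.toLp 2 (e, g), rfl⟩

/-- A vector orthogonal to the range is shown to lie in the form domain. By density of the operator
domain there, the shifted form then pairs it to zero with everything, itself included, and
coercivity kills it. -/
theorem denseRange_blockOp_add (h : SkewData P j d) (hT : FormOf T j Q) (hjd : DenseRange j)
    {lam c : ℝ} (hc : 0 < c) (hlam : -1 < lam)
    (hran : ∀ z, ∃ x : T.domain, T x + (lam : ℂ) • (x : H) = z)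
    (hco : ∀ x, c * ‖x‖ ^ 2 ≤ (inner ℂ (blockForm Q d ν x) x).re + lam * ‖blockEmb j x‖ ^ 2) :
    DenseRange fun x : (blockOp T (-((ν : ℂ) • P)) ((ν : ℂ) • P) (idOp H)).domain =>
      blockOp T (-((ν : ℂ) • P)) ((ν : ℂ) • P) (idOp H) x + (lam : ℂ) • (x : WithLp 2 (H × H)) := by
  set A := blockOp T (-((ν : ℂ) • P)) ((ν : ℂ) • P) (idOp H)
  let L : A.domain →ₗ[ℂ] WithLp 2 (H × H) := A.toFun + (lam : ℂ) • A.domain.subtype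
  have hL : ∀ x, L x = A x + (lam : ℂ) • (x : WithLp 2 (H × H)) := fun x => rfl
  suffices hs : (LinearMap.range L).topologicalClosure = ⊤ from
    (Submodule.dense_iff_topologicalClosure_eq_top).2 hs
  rw [Submodule.topologicalClosure_eq_top_iff, Submodule.eq_bot_iff]
  intro z hz
  rw [Submodule.mem_orthogonal] at hz
  have hz' : ∀ x : A.domain, inner ℂ (A x) z + lam * inner ℂ (x : WithLp 2 (H × H)) z = 0 := by
    intro x
    have := hz _ ⟨x, rfl⟩
    rwa [hL, inner_add_left, inner_smul_left, Complex.conj_ofReal] at this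
  have hl1 : (1 + lam : ℂ) ≠ 0 := by
    have : (1 + lam : ℝ) ≠ 0 := by linarith
    exact_mod_cast this
  -- Testing against `(0, j e')` says that `ν z.fst` has a weak `P`-derivative, so maximality of the
  -- skew operator places it in `E`.
  have hsnd : ∀ e', inner ℂ (d e') ((ν : ℂ) • z.fst) = -inner ℂ (j e') (-((1 + lam : ℂ) • z.snd)) := by
    intro e'
    have hm : WithLp.toLp 2 (j 0, j e') ∈ A.domain := toLp_mem_blockOp_domain h hT.lift (by simp)
    have h1 := hz' ⟨_, hm⟩
    rw [show A ⟨_, hm⟩ = _ from blockOp_apply h ⟨_, hm⟩ (e := 0) (e' := e') rfl rfl] at h1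
    have h2 : T ⟨j 0, hm.1.1⟩ = 0 := by
      have : (⟨j 0, hm.1.1⟩ : T.domain) = 0 := Subtype.ext (map_zero j)
      rw [this, T.map_zero]
    rw [WithLp.prod_inner_apply, WithLp.prod_inner_apply] at h1
    change inner ℂ (T ⟨j 0, hm.1.1⟩ - (ν : ℂ) • d e') z.fst + inner ℂ ((ν : ℂ) • d 0 + j e') z.snd +
      lam * (inner ℂ (j 0) z.fst + inner ℂ (j e') z.snd) = 0 at h1
    rw [h2, map_zero, map_zero, smul_zero, zero_add, zero_sub, inner_neg_left, inner_smul_left,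
      inner_zero_left, zero_add, Complex.conj_ofReal] at h1
    rw [inner_smul_right, inner_neg_right, inner_smul_right, neg_neg]
    linear_combination -h1
  obtain ⟨ε, hε⟩ : ∃ ε, blockEmb j ε = z := by
    -- For `ν = 0` this gives no regularity of `z.fst`, but the rows decouple: `1 + lam ≠ 0` and
    -- surjectivity of `T + lam` give `z = 0`.
    rcases eq_or_ne ν 0 with h0 | h0
    · subst h0
      have hs0 : z.snd = 0 := by
        refine Dense.eq_zero_of_inner_right ℂ hjd ?_
        rintro _ ⟨e, rfl⟩
        have := hsnd e
        rw [Complex.ofReal_zero, zero_smul, inner_zero_right, inner_neg_right, neg_neg,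
          inner_smul_right] at this
        exact (mul_eq_zero.1 this.symm).resolve_left hl1
      have hf0 : z.fst = 0 := by
        obtain ⟨x, hx⟩ := hran z.fst
        obtain ⟨e, he⟩ := hT.exists_eq x
        have hm : WithLp.toLp 2 (j e, j 0) ∈ A.domain :=
          toLp_mem_blockOp_domain h hT.lift (by rw [he]; exact x.2)
        have h1 := hz' ⟨_, hm⟩
        rw [show A ⟨_, hm⟩ = _ from blockOp_apply h ⟨_, hm⟩ (e := e) (e' := 0) rfl rfl] at h1
        rw [WithLp.prod_inner_apply, WithLp.prod_inner_apply] at h1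
        change inner ℂ (T ⟨j e, hm.1.1⟩ - ((0 : ℝ) : ℂ) • d 0) z.fst +
          inner ℂ (((0 : ℝ) : ℂ) • d e + j 0) z.snd +
          lam * (inner ℂ (j e) z.fst + inner ℂ (j 0) z.snd) = 0 at h1
        have h3 : (⟨j e, hm.1.1⟩ : T.domain) = x := Subtype.ext he
        rw [hs0, inner_zero_right, inner_zero_right, add_zero, add_zero, h3, he,
          Complex.ofReal_zero, zero_smul, sub_zero, ← Complex.conj_ofReal, ← inner_smul_left, ← inner_add_left, hx] at h1
        exact inner_self_eq_zero.1 h1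
      refine ⟨0, ?_⟩
      rw [map_zero]
      exact (WithLp.ofLp_injective 2) (Prod.ext hf0.symm hs0.symm)
    · have h0' : (ν : ℂ) ≠ 0 := by exact_mod_cast h0
      obtain ⟨e, he, -⟩ := h.maximal _ _ hsnd
      refine ⟨WithLp.toLp 2 ((ν : ℂ)⁻¹ • e, z.snd), ?_⟩
      refine (WithLp.ofLp_injective 2) (Prod.ext ?_ rfl)
      change j ((ν : ℂ)⁻¹ • e) = z.fst
      rw [map_smul, he, smul_smul, inv_mul_cancel₀ h0', one_smul]
  have hcl : ∀ x, inner ℂ (blockForm Q d ν x) ε + lam * inner ℂ (blockEmb j x) z = 0 := by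
    have hC : IsClosed {x | inner ℂ (blockForm Q d ν x) ε + lam * inner ℂ (blockEmb j x) z = 0} :=
      isClosed_eq (by fun_prop) continuous_const
    intro x
    refine hC.closure_subset_iff.2 (fun x hx => ?_) (dense_blockOp_form_domain h hT hjd (ν := ν) x)
    rw [mem_ofPred_eq] at hx ⊢
    have h1 := hz' ⟨_, hx⟩
    obtain ⟨e, h2, h3⟩ := blockOp_lift h hT.lift _ _ (A.mem_graph ⟨_, hx⟩)
    have h4 := blockEmb_injective hT.injective h2
    rw [← h4, h3, ContinuousLinearMap.adjoint_inner_left, hε, h4]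
    exact h1
  have h1 := hcl ε
  have h2 := hco ε
  rw [hε] at h1 h2
  have h3 : (inner ℂ z z : ℂ) = ((‖z‖ ^ 2 : ℝ) : ℂ) := by
    rw [inner_self_eq_norm_sq_to_K]; push_cast; rfl
  rw [h3, ← Complex.ofReal_mul] at h1
  have h4 := congrArg Complex.re h1
  rw [Complex.add_re, Complex.ofReal_re, Complex.zero_re] at h4
  rw [h4] at h2
  have h5 : ε = 0 := by
    have : ‖ε‖ ^ 2 ≤ 0 := by nlinarith [sq_nonneg ‖ε‖]
    exact norm_eq_zero.1 (pow_eq_zero_iff two_ne_zero |>.1 (le_antisymm this (sq_nonneg _)))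
  rw [← hε, h5, map_zero]

end Block

/-! ### Schur complement and factorization of the form -/

section Schur

open scoped InnerProduct

variable {H E : Type} [NormedAddCommGroup H] [InnerProductSpace ℂ H] [CompleteSpace H]
  [NormedAddCommGroup E] [InnerProductSpace ℂ E] [CompleteSpace E]

/-- The Schur complement `I - ν P T⁻¹ (-ν P)`. -/
noncomputable def schurOp (T P : H →ₗ.[ℂ] H) (ν : ℝ) : H →ₗ.[ℂ] H :=
  idOp H - mulOp ((ν : ℂ) • P) (mulOp T.inverse (-((ν : ℂ) • P)))

/-- The bounded operator `I - ν² d Q⁻¹ d†`. -/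
noncomputable def schurForm (Q : E ≃L[ℂ] E) (d : E →L[ℂ] H) (ν : ℝ) : H →L[ℂ] H :=
  ContinuousLinearMap.id ℂ H -
    ((ν ^ 2 : ℝ) : ℂ) • (d ∘L Q.symm.toContinuousLinearMap ∘L (d†))

variable {T P : H →ₗ.[ℂ] H} {j d : E →L[ℂ] H} {Q : E ≃L[ℂ] E} {ν : ℝ}

theorem schurForm_apply (g : H) :
    schurForm Q d ν g = g - ((ν ^ 2 : ℝ) : ℂ) • d (Q.symm ((d†) g)) := rfl

theorem inner_symm_apply (hQ : ∀ e e', inner ℂ (Q e) e' = inner ℂ e (Q e')) (e e' : E) :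
    inner ℂ (Q.symm e) e' = inner ℂ e (Q.symm e') := by
  have := hQ (Q.symm e) (Q.symm e')
  rw [Q.apply_symm_apply, Q.apply_symm_apply] at this
  exact this.symm

theorem isSelfAdjoint_schurForm (hQ : ∀ e e', inner ℂ (Q e) e' = inner ℂ e (Q e')) :
    IsSelfAdjoint (schurForm Q d ν) := by
  rw [ContinuousLinearMap.isSelfAdjoint_iff', eq_comm, ContinuousLinearMap.eq_adjoint_iff]
  intro x y
  rw [schurForm_apply, schurForm_apply, inner_sub_left, inner_sub_right, inner_smul_left,
    inner_smul_right, Complex.conj_ofReal, ← ContinuousLinearMap.adjoint_inner_right,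
    inner_symm_apply hQ, ContinuousLinearMap.adjoint_inner_left]

theorem mem_graph_inverse_iff {R : H →L[ℂ] H} (hR : IsResolventAt T 0 R) (x y : H) :
    (x, y) ∈ T.inverse.graph ↔ (y, x) ∈ T.graph := by
  have hk : LinearMap.ker T.toFun = ⊥ := by
    rw [LinearMap.ker_eq_bot']
    intro x hx
    have h1 := hR.2 x
    have h2 : T x = 0 := hx
    rw [h2, zero_smul, sub_zero, map_zero] at h1
    exact Subtype.ext h1.symm
  rw [LinearPMap.inverse_graph hk, Submodule.mem_map]
  constructor
  · rintro ⟨⟨a, b⟩, hab, h⟩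
    obtain ⟨rfl, rfl⟩ := Prod.mk.inj h
    exact hab
  · intro h
    exact ⟨(y, x), h, rfl⟩

theorem mem_domain_inverse {R : H →L[ℂ] H} (hR : IsResolventAt T 0 R) (x : H) :
    x ∈ T.inverse.domain := by
  have h1 := hR.map_apply x
  rw [zero_smul, add_zero] at h1
  have h2 : (R x, x) ∈ T.graph := (LinearPMap.mem_graph_iff _).2 ⟨_, rfl, h1⟩
  exact LinearPMap.mem_domain_of_mem_graph ((mem_graph_inverse_iff hR _ _).2 h2)

/-- `T⁻¹` is everywhere defined with values in `dom T`, which `hlift` puts inside `dom P`; so the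
only restriction is the innermost factor `P`. -/
theorem schurOp_domain (h : SkewData P j d) {R : H →L[ℂ] H} (hR : IsResolventAt T 0 R)
    (hlift : ∀ x y, (x, y) ∈ T.graph → ∃ e, j e = x ∧ Q e = (j†) y) :
    (schurOp T P ν).domain = P.domain := by
  ext x
  constructor
  · rintro ⟨-, ⟨⟨h1, -⟩, -⟩⟩
    exact h1
  · intro hx
    refine ⟨trivial, ⟨⟨hx, mem_domain_inverse hR _⟩, ?_⟩⟩
    have h1 := T.inverse.mem_graph ⟨(-((ν : ℂ) • P)) ⟨x, hx⟩, mem_domain_inverse hR _⟩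
    rw [mem_graph_inverse_iff hR] at h1
    obtain ⟨e, he, -⟩ := hlift _ _ h1
    exact (h.mem_domain_iff _).2 ⟨e, he⟩

/-- By skewness `j†(-ν P x) = ν d† x` for `x` in `dom P`, so applying `T⁻¹` amounts to applying
`Q⁻¹` to `ν d† x`. The result is bounded in `x`, which makes the closure everywhere defined. -/
theorem schurOp_apply (h : SkewData P j d) {R : H →L[ℂ] H} (hR : IsResolventAt T 0 R)
    (hlift : ∀ x y, (x, y) ∈ T.graph → ∃ e, j e = x ∧ Q e = (j†) y) (x : (schurOp T P ν).domain) :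
    schurOp T P ν x = schurForm Q d ν x := by
  obtain ⟨x, hx⟩ := x
  have hxP : x ∈ P.domain := by rwa [schurOp_domain h hR hlift] at hx
  obtain ⟨e, rfl⟩ := (h.mem_domain_iff _).1 hxP
  have h1 := T.inverse.mem_graph ⟨(-((ν : ℂ) • P)) ⟨j e, hxP⟩, mem_domain_inverse hR _⟩
  rw [mem_graph_inverse_iff hR] at h1
  obtain ⟨e', he', hQe'⟩ := hlift _ _ h1
  dsimp only at he' hQe'
  have hmem : T.inverse ⟨(-((ν : ℂ) • P)) ⟨j e, hxP⟩, mem_domain_inverse hR _⟩ ∈ P.domain :=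
    (h.mem_domain_iff _).2 ⟨e', he'⟩
  have hval : schurOp T P ν ⟨j e, hx⟩ = j e - (ν : ℂ) • P ⟨_, hmem⟩ := rfl
  have h2 : P ⟨_, hmem⟩ = d e' := by
    have h3 : j e' ∈ P.domain := (h.mem_domain_iff _).2 ⟨e', rfl⟩
    rw [← h.apply_eq h3]
    congr 1
    exact Subtype.ext he'.symm
  have h4 : (-((ν : ℂ) • P)) ⟨j e, hxP⟩ = -((ν : ℂ) • d e) := by
    rw [← h.apply_eq hxP]; rfl
  have h5 : Q e' = (ν : ℂ) • (d†) (j e) := by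
    rw [hQe', h4]
    refine ext_inner_right ℂ fun f => ?_
    rw [ContinuousLinearMap.adjoint_inner_left, inner_neg_left, inner_smul_left, inner_smul_left, h.skew,
      ContinuousLinearMap.adjoint_inner_left]
    ring
  have h6 : e' = (ν : ℂ) • Q.symm ((d†) (j e)) := by
    rw [← map_smul, ← h5, Q.symm_apply_apply]
  rw [hval, h2, h6, schurForm_apply, map_smul, smul_smul, pow_two, Complex.ofReal_mul]

/-- The shear `(f, g) ↦ (f + ν Q⁻¹ d† g, g)`. -/
noncomputable def shear (Q : E ≃L[ℂ] E) (d : E →L[ℂ] H) (ν : ℝ) :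
    WithLp 2 (E × H) ≃ₗ[ℂ] E × H where
  toFun x := (x.fst + (ν : ℂ) • Q.symm ((d†) x.snd), x.snd)
  map_add' x y := by
    refine Prod.ext ?_ rfl
    change x.fst + y.fst + (ν : ℂ) • Q.symm ((d†) (x.snd + y.snd)) = _
    rw [map_add, map_add, smul_add]
    exact add_add_add_comm _ _ _ _
  map_smul' c x := by
    refine Prod.ext ?_ rfl
    change c • x.fst + (ν : ℂ) • Q.symm ((d†) (c • x.snd)) =
      c • (x.fst + (ν : ℂ) • Q.symm ((d†) x.snd))
    rw [map_smul, map_smul, smul_add, smul_comm]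
  invFun y := WithLp.toLp 2 (y.1 - (ν : ℂ) • Q.symm ((d†) y.2), y.2)
  left_inv x := by
    refine (WithLp.ofLp_injective 2) (Prod.ext ?_ rfl)
    exact add_sub_cancel_right _ _
  right_inv y := Prod.ext (sub_add_cancel _ _) rfl

/-- Completing the square in `f`: the term `ν² ⟨Q⁻¹ d† g, d† g⟩` added to the first form is what the
Schur complement subtracts from `‖g‖²`. -/
theorem inner_blockForm_eq_shear (hQ : ∀ e e', inner ℂ (Q e) e' = inner ℂ e (Q e'))
    (x : WithLp 2 (E × H)) :
    (inner ℂ (blockForm Q.toContinuousLinearMap d ν x) x).re =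
      (inner ℂ (Q (shear Q d ν x).1) (shear Q d ν x).1).re +
        (inner ℂ (schurForm Q d ν (shear Q d ν x).2) (shear Q d ν x).2).re := by
  rw [← Complex.add_re, inner_blockForm]
  change _ = (inner ℂ (Q (x.fst + (ν : ℂ) • Q.symm ((d†) x.snd))) (x.fst + (ν : ℂ) • Q.symm ((d†) x.snd)) +
    inner ℂ (schurForm Q d ν x.snd) x.snd).re
  congr 1
  have h1 : inner ℂ (Q x.fst) (Q.symm ((d†) x.snd)) = inner ℂ (d x.fst) x.snd := by
    rw [hQ, Q.apply_symm_apply, ContinuousLinearMap.adjoint_inner_right]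
  have h2 : inner ℂ (d (Q.symm ((d†) x.snd))) x.snd =
      inner ℂ ((d†) x.snd) (Q.symm ((d†) x.snd)) := by
    rw [← ContinuousLinearMap.adjoint_inner_right, inner_symm_apply hQ]
  rw [schurForm_apply, map_add, map_smul, Q.apply_symm_apply, inner_add_left, inner_add_right,
    inner_add_right, inner_sub_left]
  simp only [inner_smul_left, inner_smul_right, Complex.conj_ofReal, h1, h2]
  rw [ContinuousLinearMap.adjoint_inner_left]
  push_cast
  ring

theorem blockForm_nonneg_iff (hQ : ∀ e e', inner ℂ (Q e) e' = inner ℂ e (Q e')) :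
    (∀ x, 0 ≤ (inner ℂ (blockForm Q.toContinuousLinearMap d ν x) x).re) ↔
      (∀ e, 0 ≤ (inner ℂ (Q e) e).re) ∧ ∀ g, 0 ≤ (inner ℂ (schurForm Q d ν g) g).re := by
  constructor
  · intro h
    have key : ∀ y : E × H, 0 ≤ (inner ℂ (Q y.1) y.1).re + (inner ℂ (schurForm Q d ν y.2) y.2).re := by
      intro y
      have := h ((shear Q d ν).symm y)
      rwa [inner_blockForm_eq_shear hQ, LinearEquiv.apply_symm_apply] at this
    exact ⟨fun e => by simpa using key (e, 0), fun g => by simpa using key (0, g)⟩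
  · rintro ⟨h1, h2⟩ x
    rw [inner_blockForm_eq_shear hQ]
    exact add_nonneg (h1 _) (h2 _)

/-- The first row forces `f = -ν Q⁻¹ d† g`; substituted into the second row this leaves the Schur
complement applied to `g`. -/
theorem blockForm_injective_iff :
    Function.Injective (blockForm Q.toContinuousLinearMap d ν) ↔ Function.Injective (schurForm Q d ν) := by
  rw [injective_iff_map_eq_zero, injective_iff_map_eq_zero]
  constructor
  · intro h g hg
    have h1 := h (WithLp.toLp 2 (-((ν : ℂ) • Q.symm ((d†) g)), g)) (by
      rw [blockForm_apply]
      refine (WithLp.ofLp_injective 2) (Prod.ext ?_ ?_)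
      · change Q (-((ν : ℂ) • Q.symm ((d†) g))) + (ν : ℂ) • (d†) g = 0
        rw [map_neg, map_smul, Q.apply_symm_apply, neg_add_cancel]
      · change (ν : ℂ) • d (-((ν : ℂ) • Q.symm ((d†) g))) + g = 0
        rw [schurForm_apply, pow_two, Complex.ofReal_mul] at hg
        rw [map_neg, map_smul, smul_neg, smul_smul, neg_add_eq_sub, hg])
    exact congrArg (fun x => x.snd) h1
  · intro h x hx
    have h1 : Q x.fst + (ν : ℂ) • (d†) x.snd = 0 := congrArg (fun x => x.fst) hx
    have h2 : (ν : ℂ) • d x.fst + x.snd = 0 := congrArg (fun x => x.snd) hx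
    have h3 : x.fst = -((ν : ℂ) • Q.symm ((d†) x.snd)) := by
      rw [← map_smul, ← map_neg, ← eq_neg_of_add_eq_zero_left h1, Q.symm_apply_apply]
    have h4 : x.snd = 0 := h _ (by
      rw [h3, map_neg, map_smul, smul_neg, smul_smul, neg_add_eq_sub] at h2
      rw [schurForm_apply, pow_two, Complex.ofReal_mul, h2])
    rw [h4, map_zero, map_zero, smul_zero, neg_zero] at h3
    exact (WithLp.ofLp_injective 2) (Prod.ext h3 h4)

/-- The Schur complement factorization of the block operator matrix and of its negative index. -/
theorem blockOp_schur {Q : E →L[ℂ] E} (h : SkewData P j d) (hQ : IsSelfAdjoint Q) {lam c : ℝ} (hc : 0 < c)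
    (hco : ∀ e, c * ‖e‖ ^ 2 ≤ (inner ℂ (Q e) e).re + lam * ‖j e‖ ^ 2)
    (hlift : ∀ x y, (x, y) ∈ T.graph → ∃ e, j e = x ∧ Q e = (j†) y)
    {R : H →L[ℂ] H} (hR : IsResolventAt T 0 R) {n : ℕ} (φ : E →ₗ[ℂ] (Fin n → ℂ))
    (hφ : ∀ e, φ e = 0 → ν ^ 2 * ‖d e‖ ^ 2 ≤ (inner ℂ (Q e) e).re) :
    (IsSelfAdjoint T ∧ T.domain ≤ P.domain ∧
      (blockOp T (-((ν : ℂ) • P)) ((ν : ℂ) • P) (idOp H)).IsClosable ∧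
      IsSelfAdjoint (blockOp T (-((ν : ℂ) • P)) ((ν : ℂ) • P) (idOp H)).closure ∧
      (schurOp T P ν).domain = P.domain ∧ (schurOp T P ν).IsClosable ∧
      IsSelfAdjoint (schurOp T P ν).closure) ∧
    (kappaMinus (blockOp T (-((ν : ℂ) • P)) ((ν : ℂ) • P) (idOp H)).closure =
        kappaMinus T + kappaMinus (schurOp T P ν).closure ∧
      kappaMinus T + kappaMinus (schurOp T P ν).closure < ⊤) ∧
    (IsPositiveOp (blockOp T (-((ν : ℂ) • P)) ((ν : ℂ) • P) (idOp H)).closure ↔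
      IsPositiveOp T ∧ IsPositiveOp (schurOp T P ν).closure) ∧
    (IsNonnegativeOp (blockOp T (-((ν : ℂ) • P)) ((ν : ℂ) • P) (idOp H)).closure ↔
      IsNonnegativeOp T ∧ IsNonnegativeOp (schurOp T P ν).closure) := by
  obtain ⟨hTs, hTf, hQb, -⟩ := formOf_of_isResolventAt_zero hQ h.injective hc hco hlift hR
  have hjd : DenseRange j := by
    refine hTs.dense_domain.mono fun x hx => ?_
    exact hTf.exists_eq ⟨x, hx⟩
  obtain ⟨Q', rfl⟩ : ∃ Q' : E ≃L[ℂ] E, Q'.toContinuousLinearMap = Q :=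
    ⟨ContinuousLinearEquiv.ofBijective Q (LinearMap.ker_eq_bot.2 hQb.1) (LinearMap.range_eq_top.2 hQb.2),
      by ext; rfl⟩
  have hQs : ∀ e e', inner ℂ (Q' e) e' = inner ℂ e (Q' e') := fun x y => hQ.isSymmetric x y
  obtain ⟨lam', c', hc', hlam1, hlam2, hco'⟩ := blockForm_coercive (ν := ν) (d := d) hc hco
  -- Coercivity is restated with the shift of the block form, since the dense range argument needs
  -- `T + lam'` onto for that same `lam'`.
  have hcoT : ∀ e, c * ‖e‖ ^ 2 ≤ (inner ℂ (Q'.toContinuousLinearMap e) e).re + lam' * ‖j e‖ ^ 2 :=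
    fun e => (hco e).trans (by gcongr)
  obtain ⟨-, -, -, hran⟩ := formOf_of_isResolventAt_zero hQ h.injective hc hcoT hlift hR
  obtain ⟨hAc, hAs, hAf⟩ := closure_formOf (isSelfAdjoint_blockForm hQ) (blockEmb_injective h.injective)
    (denseRange_blockEmb hjd) hc' hco' (blockOp_lift h hlift) (dense_blockOp_form_domain h hTf hjd)
    (denseRange_blockOp_add h hTf hjd hc' hlam1 hran hco')
  have hSd : (schurOp T P ν).domain = P.domain := schurOp_domain h hR hlift
  have hPd : Dense (P.domain : Set H) := hjd.mono (by
    rintro _ ⟨e, rfl⟩; exact (h.mem_domain_iff _).2 ⟨e, rfl⟩)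
  obtain ⟨hSc, hSe⟩ := closure_eq_toPMap (S := schurForm Q' d ν) (by rw [hSd]; exact hPd)
    (schurOp_apply h hR hlift)
  have hSs := isSelfAdjoint_schurForm (d := d) (ν := ν) hQs
  have hSs' := isSelfAdjoint_toPMap hSs
  have hSf := formOf_toPMap (schurForm Q' d ν)
  obtain ⟨cT, hcT⟩ := exists_negIndex hQ
  obtain ⟨cS, hcS⟩ := exists_negIndex hSs
  have hcA : NegIndex (fun x => (inner ℂ (blockForm Q'.toContinuousLinearMap d ν x) x).re) (cT + cS) := by
    refine (hcT.prod hcS (by simp) (by simp)).of_equiv (shear Q' d ν).symm fun x => ?_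
    rw [inner_blockForm_eq_shear hQs, LinearEquiv.apply_symm_apply]
    rfl
  -- Where `φ f = 0` the block form is at least `(|ν|‖d f‖ - ‖g‖)²`, so the index is at most `n`,
  -- with no condition imposed on `g`.
  have hfin : cT + cS < Cardinal.aleph0 := by
    let φ' : WithLp 2 (E × H) →ₗ[ℂ] (Fin n → ℂ) := φ ∘ₗ (WithLp.fstₗ 2 ℂ E H)
    refine (hcA.le_rank φ' fun x hx => ?_).trans_lt (Module.rank_lt_aleph0 ℂ (Fin n → ℂ))
    rw [re_inner_blockForm_self]
    have h1 := hφ x.fst hx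
    have h2 := (Complex.abs_re_le_norm _).trans (norm_inner_le_norm (𝕜 := ℂ) (d x.fst) x.snd)
    have h3 : -(|ν| * (‖d x.fst‖ * ‖x.snd‖)) ≤ ν * (inner ℂ (d x.fst) x.snd).re := by
      refine le_trans ?_ (neg_abs_le _)
      rw [abs_mul]
      gcongr
    have h4 : 0 ≤ (|ν| * ‖d x.fst‖ - ‖x.snd‖) ^ 2 := sq_nonneg _
    rw [← sq_abs ν] at h1
    nlinarith
  rw [hSe]
  have hkT := hTf.kappaMinus_eq hTs hcT (lt_of_le_of_lt (self_le_add_right _ _) hfin)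
  have hkS := hSf.kappaMinus_eq hSs' hcS (lt_of_le_of_lt (self_le_add_left _ _) hfin)
  have hkA := hAf.kappaMinus_eq hAs hcA hfin
  refine ⟨⟨hTs, fun x hx => ?_, hAc, hAs, hSd, hSc, hSs'⟩, ⟨?_, ?_⟩, ?_, ?_⟩
  · obtain ⟨e, he⟩ := hTf.exists_eq ⟨x, hx⟩
    exact (h.mem_domain_iff _).2 ⟨e, he⟩
  · rw [hkA, hkT, hkS, map_add]
  · rw [hkT, hkS, ← map_add, lt_top_iff_ne_top, Ne, Cardinal.toENat_eq_top, not_le]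
    exact hfin
  · rw [hAf.isPositiveOp_iff hAs (isSelfAdjoint_blockForm hQ), hTf.isPositiveOp_iff hTs hQ,
      hSf.isPositiveOp_iff hSs' hSs, blockForm_nonneg_iff hQs, blockForm_injective_iff]
    have hi : Function.Injective Q'.toContinuousLinearMap := hQb.1
    tauto
  · rw [hAf.isNonnegativeOp_iff, hTf.isNonnegativeOp_iff, hSf.isNonnegativeOp_iff, blockForm_nonneg_iff hQs]
    rfl

end Schur

/-! ### Locally absolutely continuous functions -/

section ACLoc

open scoped ComplexConjugate

theorem ACLoc.comp_isometry {u : ℝ → ℂ} {f : ℂ → ℂ} (hu : ACLoc u) (hf : Isometry f) :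
    ACLoc fun x => f (u x) := fun a b => by
  have := hu a b
  unfold AbsolutelyContinuousOnInterval at this ⊢
  simpa only [hf.dist_eq] using this

theorem ACLoc.conj {u : ℝ → ℂ} (hu : ACLoc u) : ACLoc fun x => conj (u x) :=
  hu.comp_isometry Complex.isometry_conj

theorem ACLoc.mul {u v : ℝ → ℂ} (hu : ACLoc u) (hv : ACLoc v) : ACLoc fun x => u x * v x :=
  fun a b => (hu a b).smul (hv a b)

theorem ACLoc.sub {u v : ℝ → ℂ} (hu : ACLoc u) (hv : ACLoc v) : ACLoc fun x => u x - v x :=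
  fun a b => (hu a b).sub (hv a b)

theorem ACLoc.add_const {u : ℝ → ℂ} (hu : ACLoc u) (c : ℂ) : ACLoc fun x => u x + c := fun a b => by
  have := hu a b
  unfold AbsolutelyContinuousOnInterval at this ⊢
  simpa only [dist_add_right] using this

theorem ACLoc.of_contDiff {u : ℝ → ℂ} (hu : ContDiff ℝ 1 u) : ACLoc u := fun _ _ =>
  hu.contDiffOn.absolutelyContinuousOnInterval

theorem intervalIntegrable_of_locallyIntegrable {E : Type*} [NormedAddCommGroup E] {g : ℝ → E}
    (hg : LocallyIntegrable g volume) (a b : ℝ) : IntervalIntegrable g volume a b :=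
  intervalIntegrable_iff.2 ((hg.integrableOn_isCompact isCompact_uIcc).mono_set uIoc_subset_uIcc)

theorem ACLoc.integral {g : ℝ → ℂ} (hg : LocallyIntegrable g volume) (c : ℝ) :
    ACLoc fun x => ∫ t in c..x, g t := by
  have hre : LocallyIntegrable (fun t => (g t).re) volume := fun x => by
    obtain ⟨s, hs, h⟩ := hg x
    exact ⟨s, hs, h.re⟩
  have him : LocallyIntegrable (fun t => (g t).im) volume := fun x => by
    obtain ⟨s, hs, h⟩ := hg x
    exact ⟨s, hs, h.im⟩
  have key : ∀ {f : ℝ → ℝ}, LocallyIntegrable f volume → ∀ a b,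
      AbsolutelyContinuousOnInterval (fun x => ((∫ t in c..x, f t : ℝ) : ℂ)) a b := by
    intro f hf a b
    have h1 := (intervalIntegrable_of_locallyIntegrable hf (min a c) (max b c)
      ).absolutelyContinuousOnInterval_intervalIntegral (c := c) (by
        rw [uIcc_of_le (by simp)]; exact ⟨min_le_right _ _, le_max_right _ _⟩)
    -- The base point `c` must lie in the interval, so the interval is enlarged to contain it and
    -- then restricted back.
    have h2 := (intervalIntegrable_of_locallyIntegrable hf (min (min a b) c) (max (max a b) c)
      ).absolutelyContinuousOnInterval_intervalIntegral (c := c) (by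
        rw [uIcc_of_le (by simp)]; exact ⟨min_le_right _ _, le_max_right _ _⟩)
    have h3 : AbsolutelyContinuousOnInterval (fun x => ∫ t in c..x, f t) a b := by
      refine h2.mono ?_
      rw [uIcc_of_le (show min (min a b) c ≤ max (max a b) c by simp)]
      exact Icc_subset_Icc (min_le_left _ _) (le_max_left _ _)
    unfold AbsolutelyContinuousOnInterval at h3 ⊢
    simpa only [Complex.dist_of_im_eq, Complex.ofReal_im, Complex.ofReal_re] using h3
  intro a b
  have h1 := (key hre a b).add ((key him a b).const_smul Complex.I)
  refine h1.congr fun p => ?_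
  have : ∀ x, ((fun x => ((∫ t in c..x, (g t).re : ℝ) : ℂ)) +
      fun x => Complex.I • ((∫ t in c..x, (g t).im : ℝ) : ℂ)) x = ∫ t in c..x, g t := by
    intro x
    have h2 : IntervalIntegrable (fun t => ((g t).re : ℂ)) volume c x :=
      have h := intervalIntegrable_of_locallyIntegrable hre c x
      ⟨h.1.ofReal, h.2.ofReal⟩
    have h3 : IntervalIntegrable (fun t => ((g t).im : ℂ)) volume c x :=
      have h := intervalIntegrable_of_locallyIntegrable him c x
      ⟨h.1.ofReal, h.2.ofReal⟩
    simp only [Pi.add_apply, smul_eq_mul]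
    rw [← intervalIntegral.integral_ofReal, ← intervalIntegral.integral_ofReal,
      ← intervalIntegral.integral_const_mul, ← intervalIntegral.integral_add h2
      (h3.const_mul _)]
    refine intervalIntegral.integral_congr fun t _ => ?_
    rw [mul_comm, Complex.re_add_im]
  simp only [this]

/-- `u` minus a primitive of `g` is absolutely continuous with zero derivative almost everywhere,
hence constant. -/
theorem ACLoc.integral_eq_sub {u g : ℝ → ℂ} (hu : ACLoc u) (hg : LocallyIntegrable g volume)
    (hd : ∀ᵐ x, HasDerivAt u (g x) x) (a b : ℝ) : ∫ t in a..b, g t = u b - u a := by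
  have h1 : ACLoc fun x => u x - ∫ t in a..x, g t := hu.sub (ACLoc.integral hg a)
  have h2 : ∀ᵐ x : ℝ, x ∈ uIcc a b → HasDerivAt (fun x => u x - ∫ t in a..x, g t) 0 x := by
    filter_upwards [hd, LocallyIntegrable.ae_hasDerivAt_integral hg] with x hx1 hx2 _
    have := hx1.sub (hx2 a)
    rwa [sub_self] at this
  obtain ⟨C, hC⟩ := (h1 a b).const_of_ae_hasDerivAt_zero h2
  have h3 := hC a left_mem_uIcc
  have h4 := hC b right_mem_uIcc
  rw [intervalIntegral.integral_same, sub_zero] at h3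
  rw [h3, ← h4]; ring

/-- Integrability of `u'` gives limits of `u` at `±∞`, and integrability of `u` forces them to
vanish. Applied to products, this is integration by parts on the line without boundary terms. -/
theorem ACLoc.integral_eq_zero {u g : ℝ → ℂ} (hu : ACLoc u) (hui : Integrable u)
    (hg : Integrable g) (hd : ∀ᵐ x, HasDerivAt u (g x) x) : ∫ t, g t = 0 := by
  have hsub := hu.integral_eq_sub hg.locallyIntegrable hd
  have htop : Tendsto u atTop (𝓝 0) := by
    have h1 : Tendsto (fun x => u 0 + ∫ t in (0 : ℝ)..x, g t) atTop (𝓝 (u 0 + ∫ t in Ioi 0, g t)) :=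
      (intervalIntegral_tendsto_integral_Ioi 0 hg.integrableOn tendsto_id).const_add _
    have h2 : (fun x => u 0 + ∫ t in (0 : ℝ)..x, g t) = u := by
      ext x; rw [hsub]; ring
    rw [h2] at h1
    have h3 : u 0 + ∫ t in Ioi 0, g t = 0 := by
      refine IntegrableAtFilter.eq_zero_of_tendsto (μ := volume) (hui.integrableAtFilter _)
        (fun s hs => ?_) h1
      obtain ⟨b, hb⟩ := mem_atTop_sets.1 hs
      exact top_le_iff.1 ((Real.volume_Ici (a := b)).symm.trans_le (measure_mono hb))
    rwa [h3] at h1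
  have hbot : Tendsto u atBot (𝓝 0) := by
    have h1 : Tendsto (fun x => u 0 - ∫ t in x..(0 : ℝ), g t) atBot (𝓝 (u 0 - ∫ t in Iic 0, g t)) :=
      (intervalIntegral_tendsto_integral_Iic 0 hg.integrableOn tendsto_id).const_sub _
    have h2 : (fun x => u 0 - ∫ t in x..(0 : ℝ), g t) = u := by
      ext x; rw [hsub]; ring
    rw [h2] at h1
    have h3 : u 0 - ∫ t in Iic 0, g t = 0 := by
      refine IntegrableAtFilter.eq_zero_of_tendsto (μ := volume) (hui.integrableAtFilter _)
        (fun s hs => ?_) h1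
      obtain ⟨b, hb⟩ := mem_atBot_sets.1 hs
      exact top_le_iff.1 ((Real.volume_Iic (a := b)).symm.trans_le (measure_mono hb))
    rwa [h3] at h1
  have h1 := intervalIntegral_tendsto_integral hg tendsto_neg_atTop_atBot tendsto_id
  have h2 : Tendsto (fun x : ℝ => ∫ t in (-x)..x, g t) atTop (𝓝 (0 - 0)) := by
    simp_rw [hsub]
    exact htop.sub (hbot.comp tendsto_neg_atTop_atBot)
  rw [sub_zero] at h2
  exact tendsto_nhds_unique h1 h2

end ACLoc

/-! ### The space `W^{1,2}(ℝ)` and skew symmetry of the derivative -/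

section Sobolev

open scoped ComplexConjugate

/-- The Sobolev space `W^{1,2}(ℝ)` as the graph of `d/dx`, with the graph inner product. -/
noncomputable def sobolev : Submodule ℂ (WithLp 2 (L2R × L2R)) :=
  derivGraph.comap (WithLp.linearEquiv 2 ℂ (L2R × L2R)).toLinearMap

/-- The embedding of `W^{1,2}(ℝ)` into `L²(ℝ)`. -/
noncomputable def sobolevEmb : sobolev →L[ℂ] L2R := (WithLp.fstL 2 ℂ L2R L2R) ∘L sobolev.subtypeL

/-- The weak derivative on `W^{1,2}(ℝ)`. -/
noncomputable def sobolevDeriv : sobolev →L[ℂ] L2R := (WithLp.sndL 2 ℂ L2R L2R) ∘L sobolev.subtypeL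

theorem sobolev_norm_sq (e : sobolev) : ‖e‖ ^ 2 = ‖sobolevEmb e‖ ^ 2 + ‖sobolevDeriv e‖ ^ 2 :=
  WithLp.prod_norm_sq_eq_of_L2 (e : WithLp 2 (L2R × L2R))

theorem exists_rep (e : sobolev) : ∃ u : ℝ → ℂ, ACLoc u ∧ sobolevEmb e =ᵐ[volume] u ∧
    ∀ᵐ x : ℝ, HasDerivAt u (sobolevDeriv e x) x := e.2

/-- The continuous representative of a Sobolev function. -/
noncomputable def rep (e : sobolev) : ℝ → ℂ := (exists_rep e).choose

theorem rep_acLoc (e : sobolev) : ACLoc (rep e) := (exists_rep e).choose_spec.1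

theorem emb_ae_eq_rep (e : sobolev) : sobolevEmb e =ᵐ[volume] rep e := (exists_rep e).choose_spec.2.1

theorem rep_hasDerivAt (e : sobolev) : ∀ᵐ x : ℝ, HasDerivAt (rep e) (sobolevDeriv e x) x :=
  (exists_rep e).choose_spec.2.2

theorem rep_eq_of_ae_eq {e : sobolev} {u : ℝ → ℂ} (hu : Continuous u) (h : sobolevEmb e =ᵐ[volume] u) :
    rep e = u :=
  (rep_acLoc e).continuous.ae_eq_iff_eq volume hu |>.1 ((emb_ae_eq_rep e).symm.trans h)

theorem rep_add (e e' : sobolev) : rep (e + e') = rep e + rep e' := by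
  refine rep_eq_of_ae_eq ((rep_acLoc e).continuous.add (rep_acLoc e').continuous) ?_
  rw [map_add]
  exact (Lp.coeFn_add _ _).trans ((emb_ae_eq_rep e).add (emb_ae_eq_rep e'))

theorem rep_smul (c : ℂ) (e : sobolev) : rep (c • e) = c • rep e := by
  refine rep_eq_of_ae_eq ((rep_acLoc e).continuous.const_smul c) ?_
  rw [map_smul]
  exact (Lp.coeFn_smul _ _).trans ((emb_ae_eq_rep e).const_smul c)

theorem locallyIntegrable_L2R (f : L2R) : LocallyIntegrable f volume :=
  (Lp.memLp f).locallyIntegrable (by norm_num)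

theorem exists_sobolev_of_rep {u : ℝ → ℂ} (hu : ACLoc u) (f g : L2R) (hf : f =ᵐ[volume] u)
    (hd : ∀ᵐ x : ℝ, HasDerivAt u (g x) x) :
    ∃ e : sobolev, sobolevEmb e = f ∧ sobolevDeriv e = g ∧ rep e = u := by
  let e : sobolev := ⟨WithLp.toLp 2 (f, g), ⟨u, hu, hf, hd⟩⟩
  exact ⟨e, rfl, rfl, rep_eq_of_ae_eq hu.continuous hf⟩

theorem sobolev_skew (e e' : sobolev) :
    inner ℂ (sobolevDeriv e) (sobolevEmb e') = -inner ℂ (sobolevEmb e) (sobolevDeriv e') := by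
  rw [eq_neg_iff_add_eq_zero, L2.inner_def, L2.inner_def,
    ← integral_add (L2.integrable_inner _ _) (L2.integrable_inner _ _)]
  refine ((rep_acLoc e).conj.mul (rep_acLoc e')).integral_eq_zero ?_
    ((L2.integrable_inner _ _).add (L2.integrable_inner _ _)) ?_
  · refine (L2.integrable_inner (𝕜 := ℂ) (sobolevEmb e) (sobolevEmb e')).congr ?_
    filter_upwards [emb_ae_eq_rep e, emb_ae_eq_rep e'] with x h1 h2
    rw [h1, h2, RCLike.inner_apply, mul_comm]
  · filter_upwards [emb_ae_eq_rep e, emb_ae_eq_rep e', rep_hasDerivAt e, rep_hasDerivAt e']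
      with x h1 h2 h3 h4
    rw [h1, h2, RCLike.inner_apply, RCLike.inner_apply]
    have := (HasDerivAt.star h3).mul h4
    refine this.congr_deriv ?_
    simp only [starRingEnd_apply]
    ring

end Sobolev

/-! ### Skew-adjointness of the derivative, completeness of `W^{1,2}(ℝ)` -/

section SobolevComplete

open scoped ComplexConjugate ContDiff

theorem mem_derivOp_graph_iff (x y : L2R) :
    (x, y) ∈ derivOp.graph ↔ ∃ e, sobolevEmb e = x ∧ sobolevDeriv e = y := by
  rw [derivOp, Submodule.toLinearPMap_graph_eq _ derivGraph_single_valued]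
  constructor
  · exact fun h => ⟨⟨WithLp.toLp 2 (x, y), h⟩, rfl, rfl⟩
  · rintro ⟨e, rfl, rfl⟩
    exact e.2

theorem sobolevEmb_injective : Function.Injective sobolevEmb := by
  rw [injective_iff_map_eq_zero]
  intro e he
  have h1 : sobolevDeriv e = 0 := derivGraph_single_valued (sobolevEmb e, sobolevDeriv e) e.2 he
  have := sobolev_norm_sq e
  rw [he, h1] at this
  simpa using this

/-- A continuous compactly supported function of mean zero is the derivative of a compactly
supported Sobolev function. -/
theorem exists_sobolev_deriv_eq {k : ℝ → ℝ} (hk : Continuous k) (hc : HasCompactSupport k)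
    (h0 : ∫ t, k t = 0) : ∃ (K : ℝ → ℝ) (e : sobolev), HasCompactSupport K ∧ Continuous K ∧
      (∀ x, HasDerivAt K (k x) x) ∧ (sobolevEmb e =ᵐ[volume] fun x => (K x : ℂ)) ∧
      sobolevDeriv e =ᵐ[volume] fun x => (k x : ℂ) := by
  obtain ⟨r, hr⟩ := hc.isCompact.isBounded.subset_closedBall 0
  have hsupp : ∀ x, k x ≠ 0 → -r ≤ x ∧ x ≤ r := fun x hx => by
    have := hr (subset_tsupport k hx)
    rwa [Real.closedBall_eq_Icc, zero_sub, zero_add] at this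
  -- `K` vanishes to the left because `k` does, and to the right because `k` has mean zero.
  let K : ℝ → ℝ := fun x => ∫ t in (-(r + 1))..x, k t
  have hKd : ∀ x, HasDerivAt K (k x) x := fun x =>
    intervalIntegral.integral_hasDerivAt_right (hk.intervalIntegrable _ _)
      (hk.stronglyMeasurableAtFilter _ _) hk.continuousAt
  have hKc : Continuous K := continuous_iff_continuousAt.2 fun x => (hKd x).continuousAt
  have hKs : HasCompactSupport K := by
    refine HasCompactSupport.intro (isCompact_Icc (a := -(r + 1)) (b := r + 1)) fun x hx => ?_
    rw [mem_Icc, not_and_or, not_le, not_le] at hx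
    rcases hx with hx | hx
    · refine (intervalIntegral.integral_congr (g := fun _ => 0) fun t ht => ?_).trans (by simp)
      rw [uIcc_of_ge hx.le] at ht
      by_contra hne
      have := (hsupp t hne).1
      linarith [ht.2]
    · refine (intervalIntegral.integral_eq_integral_of_support_subset fun t ht => ?_).trans h0
      have := hsupp t ht
      exact ⟨by linarith, by linarith⟩
  have hK2 : MemLp (fun x => (K x : ℂ)) 2 volume :=
    (Complex.continuous_ofReal.comp hKc).memLp_of_hasCompactSupport
      (hKs.comp_left Complex.ofReal_zero)
  have hk2 : MemLp (fun x => (k x : ℂ)) 2 volume :=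
    (Complex.continuous_ofReal.comp hk).memLp_of_hasCompactSupport
      (hc.comp_left Complex.ofReal_zero)
  have hac : ACLoc fun x => (K x : ℂ) := by
    refine ACLoc.of_contDiff (contDiff_one_iff_deriv.2 ⟨fun x => (hKd x).ofReal_comp.differentiableAt, ?_⟩)
    rw [show deriv (fun x => (K x : ℂ)) = fun x => (k x : ℂ) from
      funext fun x => (hKd x).ofReal_comp.deriv]
    exact Complex.continuous_ofReal.comp hk
  obtain ⟨e, he1, he2, -⟩ := exists_sobolev_of_rep hac (hK2.toLp _) (hk2.toLp _) hK2.coeFn_toLp (by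
    filter_upwards [hk2.coeFn_toLp] with x hx
    rw [hx]
    exact (hKd x).ofReal_comp)
  exact ⟨K, e, hKs, hKc, hKd, he1 ▸ hK2.coeFn_toLp, he2 ▸ hk2.coeFn_toLp⟩

/-- The lemma of du Bois-Reymond: a function with a weak derivative in `L²` is a Sobolev function. -/
theorem sobolev_maximal (x y : L2R)
    (h : ∀ e, inner ℂ (sobolevDeriv e) x = -inner ℂ (sobolevEmb e) y) :
    ∃ e, sobolevEmb e = x ∧ sobolevDeriv e = y := by
  have hyl := locallyIntegrable_L2R y
  set Y : ℝ → ℂ := fun t => ∫ s in (0 : ℝ)..t, y s with hY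
  have hYac : ACLoc Y := ACLoc.integral hyl 0
  have hYd : ∀ᵐ t, HasDerivAt Y (y t) t := by
    filter_upwards [LocallyIntegrable.ae_hasDerivAt_integral hyl] with t ht using ht 0
  have hz : LocallyIntegrable (fun t => x t - Y t) volume :=
    (locallyIntegrable_L2R x).sub hYac.continuous.locallyIntegrable
  -- `x - Y` has weak derivative zero, so it annihilates every `k` that is the derivative of a
  -- compactly supported function.
  have hmean : ∀ k : ℝ → ℝ, Continuous k → HasCompactSupport k → ∫ t, k t = 0 →
      ∫ t, k t • (x t - Y t) = 0 := by
    intro k hk hc h0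
    obtain ⟨K, e, hKs, hKc, hKd, he1, he2⟩ := exists_sobolev_deriv_eq hk hc h0
    have hi1 : Integrable fun t => k t • x t :=
      (locallyIntegrable_L2R x).integrable_smul_left_of_hasCompactSupport hk hc
    have hi2 : Integrable fun t => k t • Y t :=
      hYac.continuous.locallyIntegrable.integrable_smul_left_of_hasCompactSupport hk hc
    have hi3 : Integrable fun t => K t • y t :=
      hyl.integrable_smul_left_of_hasCompactSupport hKc hKs
    have hi4 : Integrable fun t => (K t : ℂ) * Y t :=
      hYac.continuous.locallyIntegrable.integrable_smul_left_of_hasCompactSupport hKc hKs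
    have h1 : ∫ t, k t • x t = -∫ t, K t • y t := by
      have h2 : ∫ t, k t • x t = inner ℂ (sobolevDeriv e) x := by
        rw [L2.inner_def]
        refine integral_congr_ae ?_
        filter_upwards [he2] with t ht
        rw [ht, RCLike.inner_apply, Complex.conj_ofReal, mul_comm, Complex.real_smul]
      have h3 : ∫ t, K t • y t = inner ℂ (sobolevEmb e) y := by
        rw [L2.inner_def]
        refine integral_congr_ae ?_
        filter_upwards [he1] with t ht
        rw [ht, RCLike.inner_apply, Complex.conj_ofReal, mul_comm, Complex.real_smul]
      rw [h2, h3, h e]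
    have hKac : ACLoc fun t => (K t : ℂ) := by
      refine ACLoc.of_contDiff (contDiff_one_iff_deriv.2
        ⟨fun x => (hKd x).ofReal_comp.differentiableAt, ?_⟩)
      rw [show deriv (fun x => (K x : ℂ)) = fun x => (k x : ℂ) from
        funext fun x => (hKd x).ofReal_comp.deriv]
      exact Complex.continuous_ofReal.comp hk
    have h2 : ∫ t, (k t • Y t + K t • y t) = 0 := by
      refine (hKac.mul hYac).integral_eq_zero hi4 (hi2.add hi3) ?_
      filter_upwards [hYd] with t ht
      refine ((hKd t).ofReal_comp.mul ht).congr_deriv ?_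
      simp only [Complex.real_smul]
    rw [integral_add hi2 hi3] at h2
    simp_rw [smul_sub]
    rw [integral_sub hi1 hi2, h1]
    linear_combination -h2
  let ρ : ContDiffBump (0 : ℝ) := ⟨1, 2, one_pos, one_lt_two⟩
  have hρi : ∫ t, ρ.normed volume t = 1 := ρ.integral_normed
  have hρc : Continuous (ρ.normed volume) := ρ.continuous_normed
  have hρs : HasCompactSupport (ρ.normed volume) := ρ.hasCompactSupport_normed
  set c : ℂ := ∫ t, ρ.normed volume t • (x t - Y t) with hcdef
  have hzc : ∀ᵐ t, (x t - Y t) - c = 0 := by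
    refine ae_eq_zero_of_integral_contDiff_smul_eq_zero (hz.sub (locallyIntegrable_const c))
      fun g hg hgs => ?_
    have hgi : Integrable g := hg.continuous.integrable_of_hasCompactSupport hgs
    -- Subtracting a multiple of the unit bump makes the test function mean-zero; hence `x - Y` acts
    -- on `g` as the constant `c`.
    have h1 := hmean (fun t => g t - (∫ s, g s) * ρ.normed volume t)
      (hg.continuous.sub (hρc.const_mul _)) (hgs.sub hρs.mul_left) (by
        rw [integral_sub hgi ((hρc.integrable_of_hasCompactSupport hρs).const_mul _),
          integral_const_mul, hρi]; ring)
    have hi1 : Integrable fun t => g t • (x t - Y t) :=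
      hz.integrable_smul_left_of_hasCompactSupport hg.continuous hgs
    have hi2 : Integrable fun t => ρ.normed volume t • (x t - Y t) :=
      hz.integrable_smul_left_of_hasCompactSupport hρc hρs
    simp_rw [sub_smul, mul_smul] at h1
    rw [integral_sub hi1 (by exact hi2.smul (∫ s, g s)), integral_smul, ← hcdef] at h1
    simp_rw [smul_sub _ _ c]
    rw [integral_sub hi1 (hgi.smul_const c), integral_smul_const]
    exact h1
  obtain ⟨e, h1, h2, -⟩ := exists_sobolev_of_rep (hYac.add_const c) x y (by
    filter_upwards [hzc] with t ht
    linear_combination ht) (by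
    filter_upwards [hYd] with t ht using ht.add_const c)
  exact ⟨e, h1, h2⟩

theorem skewData_deriv : SkewData derivOp sobolevEmb sobolevDeriv where
  injective := sobolevEmb_injective
  mem_graph_iff := mem_derivOp_graph_iff
  skew := sobolev_skew
  maximal := sobolev_maximal

/-- Skew symmetry and maximality exhibit the graph as an intersection of kernels of continuous
functionals, hence closed. -/
instance : CompleteSpace sobolev := by
  have h : (sobolev : Set (WithLp 2 (L2R × L2R))) = ⋂ e : sobolev,
      {p | inner ℂ (sobolevDeriv e) p.fst + inner ℂ (sobolevEmb e) p.snd = 0} := by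
    ext p
    simp only [mem_iInter, SetLike.mem_coe]
    constructor
    · intro hp e
      exact eq_neg_iff_add_eq_zero.1 (sobolev_skew e ⟨p, hp⟩)
    · intro hp
      obtain ⟨e, h1, h2⟩ := sobolev_maximal p.fst p.snd fun e => eq_neg_iff_add_eq_zero.2 (hp e)
      have : (e : WithLp 2 (L2R × L2R)) = p := (WithLp.linearEquiv 2 ℂ (L2R × L2R)).injective
        (Prod.ext h1 h2)
      exact this ▸ e.2
  refine IsClosed.completeSpace_coe (s := (sobolev : Set (WithLp 2 (L2R × L2R)))) (hs := ?_)
  rw [h]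
  refine isClosed_iInter fun e => isClosed_eq ?_ continuous_const
  exact (continuous_const.inner (WithLp.fstL 2 ℂ L2R L2R).continuous).add
    (continuous_const.inner (WithLp.sndL 2 ℂ L2R L2R).continuous)

end SobolevComplete

/-! ### Form bounds for the potential -/

section Potential

open scoped ENNReal NNReal

theorem lintegral_enorm_sq_L2R (f : L2R) : ∫⁻ x, ‖f x‖ₑ ^ 2 = ENNReal.ofReal (‖f‖ ^ 2) := by
  have h := eLpNorm_nnreal_pow_eq_lintegral (μ := (volume : Measure ℝ)) (f := (f : ℝ → ℂ))
    (p := 2) two_ne_zero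
  simp only [NNReal.coe_ofNat, ENNReal.rpow_ofNat, ENNReal.coe_ofNat] at h
  rw [← h, ENNReal.ofReal_pow (norm_nonneg _), ofReal_norm, Lp.enorm_def]

theorem lintegral_eq_tsum_Ioc {δ : ℝ} (hδ : 0 < δ) (φ : ℝ → ℝ≥0∞) :
    ∫⁻ x, φ x = ∑' k : ℤ, ∫⁻ x in Ioc (k • δ) ((k + 1) • δ), φ x := by
  rw [← lintegral_iUnion (fun _ => measurableSet_Ioc) (pairwise_disjoint_Ioc_zsmul δ),
    iUnion_Ioc_zsmul hδ, setLIntegral_univ]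

theorem enorm_sq_le_two_mul (a b : ℂ) : ‖a‖ₑ ^ 2 ≤ 2 * ‖b‖ₑ ^ 2 + 2 * ‖a - b‖ₑ ^ 2 := by
  simp only [← ofReal_norm, ← ENNReal.ofReal_pow (norm_nonneg _)]
  rw [← ENNReal.ofReal_ofNat 2, ← ENNReal.ofReal_mul zero_le_two, ← ENNReal.ofReal_mul zero_le_two,
    ← ENNReal.ofReal_add (by positivity) (by positivity)]
  refine ENNReal.ofReal_le_ofReal ?_
  have h : ‖a‖ ≤ ‖b‖ + ‖a - b‖ := by simpa using norm_add_le b (a - b)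
  nlinarith [sq_nonneg (‖b‖ - ‖a - b‖), norm_nonneg a]

theorem lintegral_enorm_sq_le {g : ℝ → ℂ} (hg : AEStronglyMeasurable g volume) (s : Set ℝ) :
    (∫⁻ t in s, ‖g t‖ₑ) ^ 2 ≤ (∫⁻ t in s, ‖g t‖ₑ ^ 2) * volume s := by
  have h1 := eLpNorm_le_eLpNorm_mul_rpow_measure_univ (μ := volume.restrict s) (f := g)
    (show (1 : ℝ≥0∞) ≤ 2 by norm_num) hg.restrict
  have h := eLpNorm_nnreal_pow_eq_lintegral (μ := volume.restrict s) (f := g) (p := 2) two_ne_zero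
  simp only [NNReal.coe_ofNat, ENNReal.rpow_ofNat, ENNReal.coe_ofNat] at h
  rw [eLpNorm_one_eq_lintegral_enorm, Measure.restrict_apply_univ] at h1
  refine (pow_le_pow_left' h1 2).trans ?_
  rw [mul_pow, h, ← ENNReal.rpow_natCast, ← ENNReal.rpow_mul]
  norm_num

theorem rep_sub (e : sobolev) (a b : ℝ) : rep e b - rep e a = ∫ t in a..b, sobolevDeriv e t :=
  ((rep_acLoc e).integral_eq_sub (locallyIntegrable_L2R _) (rep_hasDerivAt e) a b).symm

theorem enorm_rep_sub_sq_le (e : sobolev) {a b x t : ℝ} (hx : x ∈ Icc a b) (ht : t ∈ Icc a b) :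
    ‖rep e x - rep e t‖ₑ ^ 2 ≤
      (∫⁻ s in Ioc a b, ‖sobolevDeriv e s‖ₑ ^ 2) * ENNReal.ofReal (b - a) := by
  rw [← Real.volume_Ioc, rep_sub]
  refine le_trans ?_ (lintegral_enorm_sq_le (Lp.aestronglyMeasurable _) _)
  gcongr
  have h1 : ‖∫ s in t..x, sobolevDeriv e s‖ₑ = ‖∫ s in uIoc t x, sobolevDeriv e s‖ₑ := by
    rw [← ofReal_norm, intervalIntegral.norm_intervalIntegral_eq, ofReal_norm]
  rw [h1]
  refine (enorm_integral_le_lintegral_enorm _).trans (lintegral_mono_set ?_)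
  exact Ioc_subset_Ioc (le_min ht.1 hx.1) (max_le ht.2 hx.2)

/-- Average `|u(x)|² ≤ 2|u(s)|² + 2|u(x) - u(s)|²` over `s`, bounding the difference by
Cauchy–Schwarz. Short intervals make the derivative coefficient small. -/
theorem enorm_rep_sq_le (e : sobolev) {a b x : ℝ} (hab : a < b) (hx : x ∈ Icc a b) :
    ‖rep e x‖ₑ ^ 2 ≤ ENNReal.ofReal (2 / (b - a)) * (∫⁻ s in Ioc a b, ‖sobolevEmb e s‖ₑ ^ 2) +
      ENNReal.ofReal (2 * (b - a)) * ∫⁻ s in Ioc a b, ‖sobolevDeriv e s‖ₑ ^ 2 := by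
  have hd : 0 < b - a := sub_pos.2 hab
  set A := ∫⁻ s in Ioc a b, ‖sobolevEmb e s‖ₑ ^ 2 with hA
  set B := ∫⁻ s in Ioc a b, ‖sobolevDeriv e s‖ₑ ^ 2 with hB
  have hA' : A = ∫⁻ s in Ioc a b, ‖rep e s‖ₑ ^ 2 := by
    refine lintegral_congr_ae (ae_restrict_of_ae ?_)
    filter_upwards [emb_ae_eq_rep e] with s hs
    rw [hs]
  have h1 : ‖rep e x‖ₑ ^ 2 * ENNReal.ofReal (b - a) ≤
      2 * A + 2 * (B * ENNReal.ofReal (b - a)) * ENNReal.ofReal (b - a) := by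
    calc ‖rep e x‖ₑ ^ 2 * ENNReal.ofReal (b - a) = ∫⁻ _ in Ioc a b, ‖rep e x‖ₑ ^ 2 := by
          rw [setLIntegral_const, Real.volume_Ioc]
      _ ≤ ∫⁻ s in Ioc a b, (2 * ‖rep e s‖ₑ ^ 2 + 2 * (B * ENNReal.ofReal (b - a))) := by
          refine setLIntegral_mono' measurableSet_Ioc fun s hs => ?_
          refine (enorm_sq_le_two_mul _ (rep e s)).trans ?_
          gcongr
          exact enorm_rep_sub_sq_le e hx (Ioc_subset_Icc_self hs)
      _ = _ := by
          rw [lintegral_add_right _ measurable_const, setLIntegral_const, Real.volume_Ioc, hA',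
            lintegral_const_mul]
          exact ((rep_acLoc e).continuous.measurable.enorm.pow_const 2)
  have hne : ENNReal.ofReal (b - a) ≠ 0 := by simpa using hd
  have h2 : ‖rep e x‖ₑ ^ 2 ≤ (2 * A + 2 * (B * ENNReal.ofReal (b - a)) * ENNReal.ofReal (b - a)) *
      (ENNReal.ofReal (b - a))⁻¹ := by
    rw [← div_eq_mul_inv, ENNReal.le_div_iff_mul_le (Or.inl hne) (Or.inl ENNReal.ofReal_ne_top)]
    exact h1
  refine h2.trans (le_of_eq ?_)
  rw [add_mul, mul_assoc (2 * (B * ENNReal.ofReal (b - a))),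
    ENNReal.mul_inv_cancel hne ENNReal.ofReal_ne_top, mul_one, div_eq_mul_inv,
    ENNReal.ofReal_mul zero_le_two, ENNReal.ofReal_mul zero_le_two, ENNReal.ofReal_inv_of_pos hd,
    ENNReal.ofReal_ofNat]
  ring

theorem enorm_rep_sq_le_of_eq_zero (e : sobolev) {a b x : ℝ} (hx : x ∈ Icc a b) (h0 : rep e a = 0) :
    ‖rep e x‖ₑ ^ 2 ≤ ENNReal.ofReal (b - a) * ∫⁻ s in Ioc a b, ‖sobolevDeriv e s‖ₑ ^ 2 := by
  have := enorm_rep_sub_sq_le e hx (left_mem_Icc.2 (hx.1.trans hx.2))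
  rwa [h0, sub_zero, mul_comm] at this

variable {V : ℝ → ℝ}

/-- Summation of local bounds over the intervals `(kδ, (k + 1)δ]`. -/
theorem lintegral_potential_le {δ : ℝ} (hδ : 0 < δ) (e : sobolev) (c : ℤ → ℝ≥0∞) {α β : ℝ≥0∞}
    (hc : ∀ k : ℤ, ∀ x ∈ Ioc (k • δ) ((k + 1) • δ), ‖rep e x‖ₑ ^ 2 ≤ c k)
    (h : ∀ k : ℤ, (∫⁻ x in Ioc (k • δ) ((k + 1) • δ), ‖V x‖ₑ) * c k ≤
      α * (∫⁻ x in Ioc (k • δ) ((k + 1) • δ), ‖sobolevEmb e x‖ₑ ^ 2) +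
      β * ∫⁻ x in Ioc (k • δ) ((k + 1) • δ), ‖sobolevDeriv e x‖ₑ ^ 2)
    (hV : AEMeasurable V volume) :
    ∫⁻ x, ‖V x‖ₑ * ‖rep e x‖ₑ ^ 2 ≤
      α * ENNReal.ofReal (‖sobolevEmb e‖ ^ 2) + β * ENNReal.ofReal (‖sobolevDeriv e‖ ^ 2) := by
  rw [← lintegral_enorm_sq_L2R, ← lintegral_enorm_sq_L2R, lintegral_eq_tsum_Ioc hδ,
    lintegral_eq_tsum_Ioc hδ fun x => ‖sobolevEmb e x‖ₑ ^ 2,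
    lintegral_eq_tsum_Ioc hδ fun x => ‖sobolevDeriv e x‖ₑ ^ 2, ← ENNReal.tsum_mul_left,
    ← ENNReal.tsum_mul_left, ← ENNReal.tsum_add]
  refine ENNReal.tsum_le_tsum fun k => le_trans ?_ (h k)
  rw [← lintegral_mul_const'' _ hV.enorm.restrict]
  refine setLIntegral_mono' measurableSet_Ioc fun x hx => ?_
  gcongr
  exact hc k x hx

theorem unit_interval_bound (hV : LocallyIntegrable V volume)
    (hV0 : Tendsto (fun x : ℝ => ∫ t in x..(x + 1), |V t|) (cocompact ℝ) (𝓝 0)) :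
    (∀ ε > 0, ∃ r : ℝ, ∀ x, r ≤ |x| → ∫⁻ t in Ioc x (x + 1), ‖V t‖ₑ ≤ ENNReal.ofReal ε) ∧
      ∃ M : ℝ, 0 ≤ M ∧ ∀ x, ∫⁻ t in Ioc x (x + 1), ‖V t‖ₑ ≤ ENNReal.ofReal M := by
  have hi : ∀ a b : ℝ, IntegrableOn V (Ioc a b) := fun a b =>
    (hV.integrableOn_isCompact isCompact_Icc).mono_set Ioc_subset_Icc_self
  have h1 : ∀ ε > 0, ∃ r : ℝ, ∀ x, r ≤ |x| →
      ∫⁻ t in Ioc x (x + 1), ‖V t‖ₑ ≤ ENNReal.ofReal ε := by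
    intro ε hε
    have h2 := hV0.eventually (Iio_mem_nhds hε)
    obtain ⟨K, hK, hKε⟩ := (hasBasis_cocompact.eventually_iff).1 h2
    obtain ⟨r, hr⟩ := hK.isBounded.subset_closedBall 0
    refine ⟨r + 1, fun x hx => ?_⟩
    have hxK : x ∈ Kᶜ := fun hxK => by
      have := hr hxK
      rw [mem_closedBall_zero_iff, Real.norm_eq_abs] at this
      linarith
    have h3 := hKε hxK
    rw [← ofReal_integral_norm_eq_lintegral_enorm (hi _ _)]
    refine ENNReal.ofReal_le_ofReal ?_
    rw [intervalIntegral.integral_of_le (by linarith)] at h3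
    exact h3.le
  refine ⟨h1, ?_⟩
  obtain ⟨r, hr⟩ := h1 1 one_pos
  -- Unit intervals starting at `|x| < r` all lie in `(-r, r + 1]`; the others carry mass at most
  -- `1`.
  refine ⟨max 1 (∫ t in Ioc (-r) (r + 1), ‖V t‖), by positivity, fun x => ?_⟩
  rcases le_or_gt r |x| with hx | hx
  · exact (hr x hx).trans (ENNReal.ofReal_le_ofReal (le_max_left _ _))
  · refine le_trans ?_ (ENNReal.ofReal_le_ofReal (le_max_right _ _))
    rw [ofReal_integral_norm_eq_lintegral_enorm (hi _ _)]
    obtain ⟨h2, h3⟩ := abs_lt.1 hx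
    exact lintegral_mono_set (Ioc_subset_Ioc (by linarith) (by linarith))

theorem lintegral_tile_le {M : ℝ≥0∞} {δ x : ℝ} (hδ1 : δ ≤ 1)
    (hM : ∫⁻ t in Ioc x (x + 1), ‖V t‖ₑ ≤ M) : ∫⁻ t in Ioc x (x + δ), ‖V t‖ₑ ≤ M :=
  (lintegral_mono_set (Ioc_subset_Ioc_right (by linarith))).trans hM

theorem zsmul_succ (k : ℤ) (δ : ℝ) : (k + 1) • δ = k • δ + δ := by rw [add_smul, one_smul]

theorem exists_small_step {M ε : ℝ} (hM0 : 0 ≤ M) (hε : 0 < ε) :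
    ∃ δ : ℝ, 0 < δ ∧ δ ≤ 1 ∧ M * (2 * δ) ≤ ε := by
  refine ⟨min 1 (ε / (2 * (M + 1))), by positivity, min_le_left _ _, ?_⟩
  calc M * (2 * min 1 (ε / (2 * (M + 1)))) ≤ M * (2 * (ε / (2 * (M + 1)))) := by
        gcongr; exact min_le_right _ _
    _ = ε * (M / (M + 1)) := by field_simp
    _ ≤ ε * 1 := by gcongr; rw [div_le_one (by linarith)]; linarith
    _ = ε := mul_one ε

/-- The potential is infinitesimally form bounded relative to `-d²/dx²`. -/
theorem potential_form_bound (hV : LocallyIntegrable V volume)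
    (hV0 : Tendsto (fun x : ℝ => ∫ t in x..(x + 1), |V t|) (cocompact ℝ) (𝓝 0)) {ε : ℝ} (hε : 0 < ε) :
    ∃ C : ℝ, 0 ≤ C ∧ ∀ e : sobolev, ∫⁻ x, ‖V x‖ₑ * ‖rep e x‖ₑ ^ 2 ≤
      ENNReal.ofReal (ε * ‖sobolevDeriv e‖ ^ 2 + C * ‖sobolevEmb e‖ ^ 2) := by
  obtain ⟨-, M, hM0, hM⟩ := unit_interval_bound hV hV0
  -- With tiles of length `δ` the derivative term costs `M · 2δ ≤ ε` and the mass term `M · 2/δ`,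
  -- which becomes `C`.
  obtain ⟨δ, hδ, hδ1, hδM⟩ := exists_small_step hM0 hε
  refine ⟨M * (2 / δ), by positivity, fun e => ?_⟩
  rw [add_comm, ENNReal.ofReal_add (by positivity) (by positivity),
    ENNReal.ofReal_mul (by positivity) (p := M * (2 / δ)), ENNReal.ofReal_mul hε.le]
  refine lintegral_potential_le hδ e _ (fun k x hx => enorm_rep_sq_le e (hx.1.trans_le hx.2)
    (Ioc_subset_Icc_self hx)) (fun k => ?_) hV.aestronglyMeasurable.aemeasurable
  rw [zsmul_succ, add_sub_cancel_left, mul_add, ← mul_assoc, ← mul_assoc]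
  have h := lintegral_tile_le hδ1 (hM (k • δ))
  gcongr
  · rw [ENNReal.ofReal_mul hM0]; gcongr
  · refine le_trans ?_ (ENNReal.ofReal_le_ofReal hδM)
    rw [ENNReal.ofReal_mul hM0]; gcongr

/-- On Sobolev functions vanishing at suitable finitely many points the potential is small. -/
theorem potential_small_of_zeros (hV : LocallyIntegrable V volume)
    (hV0 : Tendsto (fun x : ℝ => ∫ t in x..(x + 1), |V t|) (cocompact ℝ) (𝓝 0)) {ε : ℝ} (hε : 0 < ε) :
    ∃ S : Finset ℝ, ∀ e : sobolev, (∀ p ∈ S, rep e p = 0) → ∫⁻ x, ‖V x‖ₑ * ‖rep e x‖ₑ ^ 2 ≤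
      ENNReal.ofReal (ε * (‖sobolevDeriv e‖ ^ 2 + ‖sobolevEmb e‖ ^ 2)) := by
  obtain ⟨hr, M, hM0, hM⟩ := unit_interval_bound hV hV0
  obtain ⟨δ, hδ, hδ1, hδM⟩ := exists_small_step hM0 hε
  -- On far tiles the mass `εδ/2` of `|V|` cancels the factor `2/δ` of the mass term. On the
  -- finitely many near tiles the function vanishes at the left endpoint `kδ`, so only the
  -- derivative term occurs.
  obtain ⟨r, hr⟩ := hr (ε * (δ / 2)) (by positivity)
  obtain ⟨n, hn⟩ := exists_nat_gt (r / δ)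
  refine ⟨(Finset.Icc (-n : ℤ) n).image fun k => k • δ, fun e he => ?_⟩
  rw [mul_add, add_comm, ENNReal.ofReal_add (by positivity) (by positivity),
    ENNReal.ofReal_mul (by positivity), ENNReal.ofReal_mul (by positivity)]
  classical
  refine lintegral_potential_le hδ e (fun k => if k ∈ Finset.Icc (-n : ℤ) n then
      ENNReal.ofReal ((k + 1) • δ - k • δ) *
        ∫⁻ s in Ioc (k • δ) ((k + 1) • δ), ‖sobolevDeriv e s‖ₑ ^ 2
    else ENNReal.ofReal (2 / ((k + 1) • δ - k • δ)) *
        (∫⁻ s in Ioc (k • δ) ((k + 1) • δ), ‖sobolevEmb e s‖ₑ ^ 2) +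
        ENNReal.ofReal (2 * ((k + 1) • δ - k • δ)) *
        ∫⁻ s in Ioc (k • δ) ((k + 1) • δ), ‖sobolevDeriv e s‖ₑ ^ 2) (fun k x hx => ?_) (fun k => ?_) hV.aestronglyMeasurable.aemeasurable
  · split_ifs with hk
    · exact enorm_rep_sq_le_of_eq_zero e (Ioc_subset_Icc_self hx)
        (he _ (Finset.mem_image_of_mem _ hk))
    · exact enorm_rep_sq_le e (hx.1.trans_le hx.2) (Ioc_subset_Icc_self hx)
  · have h := lintegral_tile_le hδ1 (hM (k • δ))
    rw [zsmul_succ, add_sub_cancel_left]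
    split_ifs with hk
    · refine le_add_left ?_
      rw [← mul_assoc]
      gcongr
      refine le_trans ?_ (ENNReal.ofReal_le_ofReal hδM)
      rw [ENNReal.ofReal_mul hM0]
      gcongr
      linarith
    · rw [mul_add, ← mul_assoc, ← mul_assoc]
      have hk' : r ≤ |k • δ| := by
        rw [Finset.mem_Icc, ← abs_le, not_le] at hk
        have h1 : (n : ℝ) < |(k : ℝ)| := by exact_mod_cast hk
        rw [zsmul_eq_mul, abs_mul, abs_of_pos hδ]
        rw [div_lt_iff₀ hδ] at hn
        nlinarith
      have h' := lintegral_tile_le hδ1 (hr (k • δ) hk')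
      gcongr
      · calc _ ≤ ENNReal.ofReal (ε * (δ / 2)) * ENNReal.ofReal (2 / δ) := by gcongr
          _ = ENNReal.ofReal ε := by
            rw [← ENNReal.ofReal_mul (by positivity)]
            congr 1
            field_simp
      · refine le_trans ?_ (ENNReal.ofReal_le_ofReal hδM)
        rw [ENNReal.ofReal_mul hM0]; gcongr

end Potential

/-! ### The bounded form operator of `H_V` -/

section SchrodingerForm

open scoped ENNReal NNReal ComplexConjugate InnerProduct

variable {V : ℝ → ℝ}

/-- Multiplication by the square root of a form bounded potential is bounded on `W^{1,2}(ℝ)`. -/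
theorem exists_mul_sobolev {C : ℝ} (hC : 0 ≤ C)
    (hVC : ∀ e : sobolev, ∫⁻ x, ‖V x‖ₑ * ‖rep e x‖ₑ ^ 2 ≤
      ENNReal.ofReal (1 * ‖sobolevDeriv e‖ ^ 2 + C * ‖sobolevEmb e‖ ^ 2))
    {σ : ℝ → ℝ} (hσ : AEStronglyMeasurable σ volume) (hσV : ∀ x, σ x ^ 2 ≤ |V x|) :
    ∃ W : sobolev →L[ℂ] L2R, ∀ e, W e =ᵐ[volume] fun x => (σ x : ℂ) * rep e x := by
  have hbound : ∀ e : sobolev, ∫⁻ x, ‖(σ x : ℂ) * rep e x‖ₑ ^ 2 ≤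
      ENNReal.ofReal (1 * ‖sobolevDeriv e‖ ^ 2 + C * ‖sobolevEmb e‖ ^ 2) := by
    intro e
    refine le_trans (lintegral_mono fun x => ?_) (hVC e)
    rw [enorm_mul, mul_pow]
    gcongr
    rw [← ofReal_norm, ← ofReal_norm, ← ENNReal.ofReal_pow (norm_nonneg _), Complex.norm_real,
      Real.norm_eq_abs, Real.norm_eq_abs, sq_abs]
    exact ENNReal.ofReal_le_ofReal (hσV x)
  have hm : ∀ e : sobolev, MemLp (fun x => (σ x : ℂ) * rep e x) 2 volume := by
    intro e
    refine ⟨(Complex.continuous_ofReal.comp_aestronglyMeasurable hσ).mul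
      (rep_acLoc e).continuous.aestronglyMeasurable, ?_⟩
    rw [eLpNorm_lt_top_iff_lintegral_rpow_enorm_lt_top two_ne_zero ENNReal.ofNat_ne_top]
    simpa using (hbound e).trans_lt ENNReal.ofReal_lt_top
  let W : sobolev →ₗ[ℂ] L2R :=
    { toFun := fun e => (hm e).toLp _
      map_add' := fun e e' => by
        rw [← MemLp.toLp_add]
        refine MemLp.toLp_congr _ _ (Eventually.of_forall fun x => ?_)
        simp only [rep_add, Pi.add_apply, mul_add]
      map_smul' := fun c e => by
        rw [RingHom.id_apply, ← MemLp.toLp_const_smul]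
        refine MemLp.toLp_congr _ _ (Eventually.of_forall fun x => ?_)
        simp only [rep_smul, Pi.smul_apply, smul_eq_mul]
        ring }
  refine ⟨W.mkContinuous (√(1 + C)) fun e => ?_, fun e => (hm e).coeFn_toLp⟩
  rw [← abs_of_nonneg (norm_nonneg (W e)), ← Real.sqrt_sq_eq_abs,
    ← Real.sqrt_sq (norm_nonneg e), ← Real.sqrt_mul (by positivity)]
  refine Real.sqrt_le_sqrt ?_
  rw [← ENNReal.ofReal_le_ofReal_iff (by positivity), ← lintegral_enorm_sq_L2R]
  refine le_trans (le_of_eq (lintegral_congr_ae ?_)) ((hbound e).trans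
    (ENNReal.ofReal_le_ofReal ?_))
  · filter_upwards [(hm e).coeFn_toLp] with x hx
    exact congrArg (‖·‖ₑ ^ 2) hx
  · rw [sobolev_norm_sq]
    nlinarith [sq_nonneg ‖sobolevDeriv e‖, sq_nonneg ‖sobolevEmb e‖,
      mul_nonneg hC (sq_nonneg ‖sobolevDeriv e‖)]

/-- The sesquilinear form of multiplication by `V`. -/
noncomputable def potentialForm (V : ℝ → ℝ) (e e' : sobolev) : ℂ :=
  ∫ x, (V x : ℂ) * (conj (rep e x) * rep e' x)

theorem norm_potentialForm_self_le {e : sobolev} {B : ℝ} (hB : 0 ≤ B)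
    (h : ∫⁻ x, ‖V x‖ₑ * ‖rep e x‖ₑ ^ 2 ≤ ENNReal.ofReal B) : ‖potentialForm V e e‖ ≤ B := by
  rw [← ENNReal.ofReal_le_ofReal_iff hB, ofReal_norm]
  refine (enorm_integral_le_lintegral_enorm _).trans (le_trans (le_of_eq ?_) h)
  refine lintegral_congr fun x => ?_
  rw [enorm_mul, enorm_mul, ← ofReal_norm (conj _), RCLike.norm_conj, ofReal_norm, sq,
    ← ofReal_norm (V x : ℂ), Complex.norm_real, ofReal_norm]

/-- Factor `V = √|V| · (V/√|V|)`. Multiplication by either factor is bounded from `W^{1,2}` to `L²`,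
so the potential contributes the bounded operator `W'† W`. Where `V = 0` the quotient is `0`, so the
factorization still holds. -/
theorem exists_schrodingerForm (m : ℝ) (hV : LocallyIntegrable V volume)
    (hV0 : Tendsto (fun x : ℝ => ∫ t in x..(x + 1), |V t|) (cocompact ℝ) (𝓝 0)) :
    ∃ Q : sobolev →L[ℂ] sobolev, IsSelfAdjoint Q ∧ ∀ e e' : sobolev,
      Integrable (fun x => (V x : ℂ) * (conj (rep e x) * rep e' x)) ∧
      inner ℂ (Q e) e' = inner ℂ (sobolevDeriv e) (sobolevDeriv e') +
        (m : ℂ) ^ 2 * inner ℂ (sobolevEmb e) (sobolevEmb e') + potentialForm V e e' := by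
  obtain ⟨C, hC, hVC⟩ := potential_form_bound hV hV0 one_pos
  have hVm := hV.aestronglyMeasurable
  have hσm : AEStronglyMeasurable (fun x => √|V x|) volume :=
    Real.continuous_sqrt.comp_aestronglyMeasurable (hVm.norm)
  have hτm : AEStronglyMeasurable (fun x => V x / √|V x|) volume :=
    (hVm.aemeasurable.div hσm.aemeasurable).aestronglyMeasurable
  obtain ⟨W, hW⟩ := exists_mul_sobolev hC hVC hσm fun x => by rw [Real.sq_sqrt (abs_nonneg _)]
  obtain ⟨W', hW'⟩ := exists_mul_sobolev hC hVC hτm fun x => by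
    rw [div_pow, Real.sq_sqrt (abs_nonneg _), ← sq_abs, sq, mul_self_div_self]
  have hWW : ∀ e e', inner ℂ (W e) (W' e') = potentialForm V e e' ∧
      Integrable (fun x => (V x : ℂ) * (conj (rep e x) * rep e' x)) := by
    intro e e'
    have h : (fun x => inner ℂ (W e x) (W' e' x)) =ᵐ[volume]
        fun x => (V x : ℂ) * (conj (rep e x) * rep e' x) := by
      filter_upwards [hW e, hW' e'] with x h1 h2
      have h3 : (V x : ℂ) = √|V x| * (V x / √|V x| : ℝ) := by
        rw [← Complex.ofReal_mul]
        congr 1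
        rcases eq_or_ne (V x) 0 with h0 | h0
        · simp [h0]
        · rw [mul_div_cancel₀ _ (Real.sqrt_ne_zero'.2 (abs_pos.2 h0))]
      rw [h1, h2, RCLike.inner_apply, map_mul, Complex.conj_ofReal, h3]
      ring
    exact ⟨(L2.inner_def _ _).trans (integral_congr_ae h), (L2.integrable_inner _ _).congr h⟩
  let Q : sobolev →L[ℂ] sobolev := sobolevDeriv† ∘L sobolevDeriv +
    sobolevEmb† ∘L (((m : ℂ) ^ 2) • sobolevEmb) + W'† ∘L W
  have hQ : ∀ e e', inner ℂ (Q e) e' = inner ℂ (sobolevDeriv e) (sobolevDeriv e') +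
        (m : ℂ) ^ 2 * inner ℂ (sobolevEmb e) (sobolevEmb e') + potentialForm V e e' := by
    intro e e'
    have : Q e = (sobolevDeriv†) (sobolevDeriv e) + (sobolevEmb†) (((m : ℂ) ^ 2) • sobolevEmb e) +
      (W'†) (W e) := rfl
    rw [this, inner_add_left, inner_add_left,
      ContinuousLinearMap.adjoint_inner_left, ContinuousLinearMap.adjoint_inner_left,
      ContinuousLinearMap.adjoint_inner_left, inner_smul_left, (hWW e e').1, map_pow, Complex.conj_ofReal]
  refine ⟨Q, ?_, fun e e' => ⟨(hWW e e').2, hQ e e'⟩⟩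
  rw [ContinuousLinearMap.isSelfAdjoint_iff_isSymmetric]
  intro e e'
  change inner ℂ (Q e) e' = inner ℂ e (Q e')
  rw [← inner_conj_symm e (Q e'), hQ, hQ, map_add, map_add, map_mul, inner_conj_symm,
    inner_conj_symm, map_pow, Complex.conj_ofReal]
  congr 1
  rw [potentialForm, potentialForm, ← integral_conj]
  refine integral_congr_ae (Eventually.of_forall fun x => ?_)
  simp only [map_mul, Complex.conj_ofReal, Complex.conj_conj]
  ring

end SchrodingerForm

/-! ### Caccioppoli inequality -/

section Caccioppoli

open scoped ENNReal NNReal ComplexConjugate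

variable {V : ℝ → ℝ}

theorem integral_norm_sq_L2R (f : L2R) : ∫ x, ‖f x‖ ^ 2 = ‖f‖ ^ 2 := by
  have h := L2.inner_def (𝕜 := ℂ) f f
  rw [inner_self_eq_norm_sq_to_K] at h
  simp only [inner_self_eq_norm_sq_to_K] at h
  simp only [Complex.coe_algebraMap, ← Complex.ofReal_pow] at h
  exact Complex.ofReal_injective ((integral_ofReal (𝕜 := ℂ)).symm.trans h.symm)

theorem integrable_norm_sq_L2R (f : L2R) : Integrable fun x => ‖f x‖ ^ 2 :=
  (memLp_two_iff_integrable_sq_norm (Lp.aestronglyMeasurable f)).1 (Lp.memLp f)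

theorem integrable_norm_sq_of_ae_eq {f : L2R} {u : ℝ → ℂ} (hf : f =ᵐ[volume] u) :
    Integrable fun x => ‖u x‖ ^ 2 := (integrable_norm_sq_L2R f).congr (by
  filter_upwards [hf] with x hx
  rw [hx])

theorem integral_norm_sq_of_ae_eq {f : L2R} {u : ℝ → ℂ} (hf : f =ᵐ[volume] u) :
    ∫ x, ‖u x‖ ^ 2 = ‖f‖ ^ 2 := by
  rw [← integral_norm_sq_L2R]
  refine integral_congr_ae ?_
  filter_upwards [hf] with x hx
  rw [hx]

theorem hasCompactSupport_sq {ψ : ℝ → ℝ} (hψc : HasCompactSupport ψ) :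
    HasCompactSupport fun x => ψ x ^ 2 :=
  hψc.comp_left (g := fun t : ℝ => t ^ 2) (by norm_num)

theorem integrable_cutoff_sq {ψ : ℝ → ℝ} {v : ℝ → ℂ} (hv : Continuous v) (hψ : Continuous ψ)
    (hψc : HasCompactSupport ψ) : Integrable fun x => ψ x ^ 2 * ‖v x‖ ^ 2 :=
  Continuous.integrable_of_hasCompactSupport (by fun_prop) (hasCompactSupport_sq hψc).mul_right

/-- Multiplication of a Sobolev function by a cut-off function. -/
theorem exists_cutoff_sobolev {K : ℝ} {u v : ℝ → ℂ} (hu : ACLoc u) (hvc : Continuous v)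
    (huv : ∀ x, HasDerivAt u (v x) x) {f : L2R} (hf : f =ᵐ[volume] u)
    {ψ : ℝ → ℝ} (hψ : ContDiff ℝ 1 ψ) (hψc : HasCompactSupport ψ) (hψ1 : ∀ x, |ψ x| ≤ 1)
    (hψK : ∀ x, |deriv ψ x| ≤ K) : ∃ e : sobolev, (rep e = fun x => (ψ x : ℂ) * u x) ∧
      ‖sobolevEmb e‖ ^ 2 ≤ ‖f‖ ^ 2 ∧
      ‖sobolevDeriv e‖ ^ 2 ≤ 2 * K ^ 2 * ‖f‖ ^ 2 + 2 * ∫ x, ψ x ^ 2 * ‖v x‖ ^ 2 := by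
  have hd : ∀ x, HasDerivAt ψ (deriv ψ x) x := fun x =>
    (hψ.differentiable one_ne_zero x).hasDerivAt
  have hψ'c : Continuous (deriv ψ) := hψ.continuous_deriv le_rfl
  have hψ's : HasCompactSupport (deriv ψ) := hψc.deriv
  have huc := hu.continuous
  have hui := integrable_norm_sq_of_ae_eq hf
  have hu2 := integral_norm_sq_of_ae_eq hf
  have hX := integrable_cutoff_sq hvc hψ.continuous hψc
  have hψC : Continuous fun x => (ψ x : ℂ) := Complex.continuous_ofReal.comp hψ.continuous
  have hψCs : HasCompactSupport fun x => (ψ x : ℂ) := hψc.comp_left Complex.ofReal_zero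
  have hψC' : Continuous fun x => ((deriv ψ x : ℝ) : ℂ) := Complex.continuous_ofReal.comp hψ'c
  have hψCs' : HasCompactSupport fun x => ((deriv ψ x : ℝ) : ℂ) := hψ's.comp_left Complex.ofReal_zero
  have hm1 : MemLp (fun x => (ψ x : ℂ) * u x) 2 volume :=
    (hψC.mul huc).memLp_of_hasCompactSupport hψCs.mul_right
  have hm2 : MemLp (fun x => ((deriv ψ x : ℝ) : ℂ) * u x + (ψ x : ℂ) * v x) 2 volume :=
    ((hψC'.mul huc).add (hψC.mul hvc)).memLp_of_hasCompactSupport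
      (hψCs'.mul_right.add hψCs.mul_right)
  obtain ⟨e, h1, h2, h3⟩ := exists_sobolev_of_rep
    ((ACLoc.of_contDiff (Complex.ofRealCLM.contDiff.comp hψ)).mul hu) (hm1.toLp _) (hm2.toLp _)
    hm1.coeFn_toLp (by
      filter_upwards [hm2.coeFn_toLp] with x hx
      rw [hx]
      exact (hd x).ofReal_comp.mul (huv x))
  refine ⟨e, h3, ?_, ?_⟩
  · rw [h1, ← integral_norm_sq_L2R, ← hu2]
    refine integral_mono_ae (integrable_norm_sq_L2R _) hui ?_
    filter_upwards [hm1.coeFn_toLp] with x hx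
    rw [hx, norm_mul, mul_pow, Complex.norm_real, Real.norm_eq_abs]
    exact mul_le_of_le_one_left (sq_nonneg _) (pow_le_one₀ (abs_nonneg _) (hψ1 x))
  · rw [h2, ← integral_norm_sq_L2R, ← hu2, ← integral_const_mul, ← integral_const_mul,
      ← integral_add (hui.const_mul _) (hX.const_mul _)]
    refine integral_mono_ae (integrable_norm_sq_L2R _)
      ((hui.const_mul _).add (hX.const_mul _)) ?_
    filter_upwards [hm2.coeFn_toLp] with x hx
    rw [hx]
    have h4 := norm_add_le (((deriv ψ x : ℝ) : ℂ) * u x) ((ψ x : ℂ) * v x)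
    rw [norm_mul, norm_mul, Complex.norm_real, Complex.norm_real, Real.norm_eq_abs,
      Real.norm_eq_abs] at h4
    have h5 : (|deriv ψ x| * ‖u x‖) ^ 2 ≤ K ^ 2 * ‖u x‖ ^ 2 := by
      rw [mul_pow]; gcongr; exact hψK x
    have h6 : (|ψ x| * ‖v x‖) ^ 2 = ψ x ^ 2 * ‖v x‖ ^ 2 := by rw [mul_pow, sq_abs]
    have h7 := pow_le_pow_left₀ (norm_nonneg _) h4 2
    nlinarith [sq_nonneg (|deriv ψ x| * ‖u x‖ - |ψ x| * ‖v x‖)]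

/-- Young's inequality on the cross term gives up a quarter of `p²‖v‖²`, leaving `3/4`, at the price
`4K²‖u‖²`; the nonnegative `m²` term is dropped. -/
theorem caccioppoli_pointwise {m K p p' V : ℝ} {u v g : ℂ} (hp : |p| ≤ 1) (hp' : |p'| ≤ K) :
    3 / 4 * (p ^ 2 * ‖v‖ ^ 2) - (p ^ 2 * ‖u‖ ^ 2) * |V| -
      ((4 * K ^ 2 + 1 / 2) * ‖u‖ ^ 2 + 1 / 2 * ‖g‖ ^ 2) ≤
    2 * p * p' * (conj u * v).re + p ^ 2 * ‖v‖ ^ 2 + p ^ 2 * m ^ 2 * ‖u‖ ^ 2 +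
      p ^ 2 * ‖u‖ ^ 2 * V - p ^ 2 * (conj u * g).re := by
  have h2 : |(conj (u) * v).re| ≤ ‖u‖ * ‖v‖ := by
    refine (Complex.abs_re_le_norm _).trans ?_
    rw [norm_mul, RCLike.norm_conj]
  have h3 : |(conj (u) * g).re| ≤ ‖u‖ * ‖g‖ := by
    refine (Complex.abs_re_le_norm _).trans ?_
    rw [norm_mul, RCLike.norm_conj]
  have h4 : -(2 * (|p| * ‖v‖) * (K * ‖u‖)) ≤
      2 * p * p' * (conj (u) * v).re := by
    refine neg_le_of_abs_le ?_
    rw [abs_mul, abs_mul, abs_mul, abs_two]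
    calc 2 * |p| * |p'| * |(conj (u) * v).re| ≤
        2 * |p| * K * (‖u‖ * ‖v‖) := by
          gcongr
          exact mul_nonneg (by positivity) ((abs_nonneg _).trans hp')
      _ = _ := by ring
  have h5 : 2 * (|p| * ‖v‖) * (K * ‖u‖) ≤
      1 / 4 * (p ^ 2 * ‖v‖ ^ 2) + 4 * K ^ 2 * ‖u‖ ^ 2 := by
    rw [← sq_abs (p)]
    nlinarith [sq_nonneg (1 / 2 * (|p| * ‖v‖) - 2 * (K * ‖u‖))]
  have h6 : p ^ 2 * (conj (u) * g).re ≤ 1 / 2 * ‖u‖ ^ 2 + 1 / 2 * ‖g‖ ^ 2 := by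
    have h7 : p ^ 2 ≤ 1 := by rw [← sq_abs]; exact pow_le_one₀ (abs_nonneg _) hp
    calc p ^ 2 * (conj (u) * g).re ≤ 1 * (‖u‖ * ‖g‖) :=
          (mul_le_mul_of_nonneg_left ((le_abs_self _).trans h3) (sq_nonneg _)).trans
            (mul_le_mul_of_nonneg_right h7 (by positivity))
      _ ≤ _ := by nlinarith [sq_nonneg (‖u‖ - ‖g‖)]
  have h8 : -(p ^ 2 * ‖u‖ ^ 2 * |V|) ≤ p ^ 2 * ‖u‖ ^ 2 * V := by
    rw [← mul_neg]
    exact mul_le_mul_of_nonneg_left (neg_abs_le _) (by positivity)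
  have h9 : 0 ≤ p ^ 2 * m ^ 2 * ‖u‖ ^ 2 := by positivity
  linarith

/-- The integrand is the real part of the derivative of `ψ² ū u'`, with `u''` eliminated by the
equation. -/
theorem integral_cutoff_identity {m : ℝ} (hV : LocallyIntegrable V volume)
    {u v w : ℝ → ℂ} (hu : ACLoc u) (hv : ACLoc v) (huv : ∀ x, HasDerivAt u (v x) x)
    (hvw : ∀ᵐ x, HasDerivAt v (w x) x) {g : L2R}
    (hg : ∀ᵐ x, g x = -w x + ((m ^ 2 + V x : ℝ) : ℂ) * u x)
    {ψ : ℝ → ℝ} (hψ : ContDiff ℝ 1 ψ) (hψc : HasCompactSupport ψ) :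
    Integrable (fun x => 2 * ψ x * deriv ψ x * (conj (u x) * v x).re + ψ x ^ 2 * ‖v x‖ ^ 2 +
        ψ x ^ 2 * m ^ 2 * ‖u x‖ ^ 2 + ψ x ^ 2 * ‖u x‖ ^ 2 * V x -
        ψ x ^ 2 * (conj (u x) * g x).re) ∧
      ∫ x, (2 * ψ x * deriv ψ x * (conj (u x) * v x).re + ψ x ^ 2 * ‖v x‖ ^ 2 +
        ψ x ^ 2 * m ^ 2 * ‖u x‖ ^ 2 + ψ x ^ 2 * ‖u x‖ ^ 2 * V x -
        ψ x ^ 2 * (conj (u x) * g x).re) = 0 := by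
  have hd : ∀ x, HasDerivAt ψ (deriv ψ x) x := fun x =>
    (hψ.differentiable one_ne_zero x).hasDerivAt
  have hψ'c : Continuous (deriv ψ) := hψ.continuous_deriv le_rfl
  have huc := hu.continuous
  have hvc := hv.continuous
  have hψ2s := hasCompactSupport_sq hψc
  let F : ℝ → ℂ := fun x => (2 * ψ x * deriv ψ x : ℝ) * (conj (u x) * v x) +
    ((ψ x ^ 2 : ℝ) * (conj (v x) * v x) + (ψ x ^ 2 : ℝ) * conj (u x) * ((m ^ 2 : ℝ) * u x) +
      (((ψ x ^ 2 : ℝ) * conj (u x) * u x) • (V x : ℂ) - ((ψ x ^ 2 : ℝ) * conj (u x)) • g x))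
  have hψ2C : Continuous fun x => ((ψ x ^ 2 : ℝ) : ℂ) :=
    Complex.continuous_ofReal.comp (hψ.continuous.pow 2)
  have hψ2Cs : HasCompactSupport fun x => ((ψ x ^ 2 : ℝ) : ℂ) := hψ2s.comp_left Complex.ofReal_zero
  have hucj : Continuous fun x => conj (u x) := Complex.continuous_conj.comp huc
  have hvcj : Continuous fun x => conj (v x) := Complex.continuous_conj.comp hvc
  have hF1 : Integrable fun x => ((2 * ψ x * deriv ψ x : ℝ) : ℂ) * (conj (u x) * v x) :=
    Continuous.integrable_of_hasCompactSupport
      (Continuous.mul (Complex.continuous_ofReal.comp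
        ((continuous_const.mul hψ.continuous).mul hψ'c)) (hucj.mul hvc))
      (HasCompactSupport.mul_right ((hψc.mul_left (f := fun _ => (2 : ℝ))).mul_right (f' := deriv ψ).comp_left
        Complex.ofReal_zero))
  have hF2 : Integrable fun x => ((ψ x ^ 2 : ℝ) : ℂ) * (conj (v x) * v x) :=
    (hψ2C.mul (hvcj.mul hvc)).integrable_of_hasCompactSupport hψ2Cs.mul_right
  have hF3 : Integrable fun x => ((ψ x ^ 2 : ℝ) : ℂ) * conj (u x) * ((m ^ 2 : ℝ) * u x) :=
    ((hψ2C.mul hucj).mul (continuous_const.mul huc)).integrable_of_hasCompactSupport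
      (hψ2Cs.mul_right).mul_right
  have hVC' : LocallyIntegrable (fun x => (V x : ℂ)) volume := fun x => by
    obtain ⟨s, hs, h⟩ := hV x
    exact ⟨s, hs, h.ofReal⟩
  have hF4 : Integrable fun x => (((ψ x ^ 2 : ℝ) : ℂ) * conj (u x) * u x) • (V x : ℂ) :=
    hVC'.integrable_smul_left_of_hasCompactSupport ((hψ2C.mul hucj).mul huc)
      (hψ2Cs.mul_right).mul_right
  have hF5 : Integrable fun x => (((ψ x ^ 2 : ℝ) : ℂ) * conj (u x)) • g x :=
    (locallyIntegrable_L2R g).integrable_smul_left_of_hasCompactSupport (hψ2C.mul hucj)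
      hψ2Cs.mul_right
  have hFi : Integrable F := hF1.add ((hF2.add hF3).add (hF4.sub hF5))
  have hF0 : ∫ x, F x = 0 := by
    have hac : ACLoc fun x => ((ψ x ^ 2 : ℝ) : ℂ) * (conj (u x) * v x) :=
      (ACLoc.of_contDiff (Complex.ofRealCLM.contDiff.comp (hψ.pow 2))).mul (hu.conj.mul hv)
    refine hac.integral_eq_zero
      ((hψ2C.mul (hucj.mul hvc)).integrable_of_hasCompactSupport hψ2Cs.mul_right) hFi ?_
    filter_upwards [hvw, hg] with x hx hgx
    have h1 := ((hd x).pow 2).ofReal_comp.mul ((huv x).star.mul hx)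
    refine h1.congr_deriv ?_
    simp only [F, hgx, starRingEnd_apply, smul_eq_mul, Pi.mul_apply, Pi.pow_apply]
    push_cast
    ring
  have h1 : ∀ x, RCLike.re (F x) = 2 * ψ x * deriv ψ x * (conj (u x) * v x).re +
      ψ x ^ 2 * ‖v x‖ ^ 2 + ψ x ^ 2 * m ^ 2 * ‖u x‖ ^ 2 + ψ x ^ 2 * ‖u x‖ ^ 2 * V x -
      ψ x ^ 2 * (conj (u x) * g x).re := by
    intro x
    simp only [F, ← Complex.normSq_eq_norm_sq, Complex.normSq_apply, RCLike.re_to_complex]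
    simp only [Complex.add_re, Complex.sub_re, Complex.mul_re, Complex.mul_im, Complex.ofReal_re,
      Complex.ofReal_im, Complex.conj_re, Complex.conj_im, smul_eq_mul]
    ring
  simp_rw [← h1]
  exact ⟨hFi.re, by rw [integral_re hFi, hF0]; simp⟩

/-- The Caccioppoli inequality for `-u'' + (m² + V) u = g`. -/
theorem caccioppoli {m C K : ℝ} (hV : LocallyIntegrable V volume) (hC : 0 ≤ C)
    (hVC : ∀ e : sobolev, ∫⁻ x, ‖V x‖ₑ * ‖rep e x‖ₑ ^ 2 ≤
      ENNReal.ofReal (1 / 8 * ‖sobolevDeriv e‖ ^ 2 + C * ‖sobolevEmb e‖ ^ 2))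
    {u v w : ℝ → ℂ} (hu : ACLoc u) (hv : ACLoc v) (huv : ∀ x, HasDerivAt u (v x) x)
    (hvw : ∀ᵐ x, HasDerivAt v (w x) x) {f g : L2R} (hf : f =ᵐ[volume] u)
    (hg : ∀ᵐ x, g x = -w x + ((m ^ 2 + V x : ℝ) : ℂ) * u x)
    {ψ : ℝ → ℝ} (hψ : ContDiff ℝ 1 ψ) (hψc : HasCompactSupport ψ) (hψ1 : ∀ x, |ψ x| ≤ 1)
    (hψK : ∀ x, |deriv ψ x| ≤ K) :
    ∫ x, ψ x ^ 2 * ‖v x‖ ^ 2 ≤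
      2 * ((4 * K ^ 2 + 1 / 2 + K ^ 2 / 4 + C) * ‖f‖ ^ 2 + 1 / 2 * ‖g‖ ^ 2) := by
  have huc := hu.continuous
  have hvc := hv.continuous
  have hui := integrable_norm_sq_of_ae_eq hf
  have hu2 := integral_norm_sq_of_ae_eq hf
  have hX := integrable_cutoff_sq hvc hψ.continuous hψc
  have hψ2s := hasCompactSupport_sq hψc
  obtain ⟨e, he1, he2, he3⟩ := exists_cutoff_sobolev hu hvc huv hf hψ hψc hψ1 hψK
  have hYl : LocallyIntegrable (fun x => |V x|) volume := fun x => by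
    obtain ⟨s, hs, h⟩ := hV x
    exact ⟨s, hs, h.norm⟩
  have hY : Integrable fun x => (ψ x ^ 2 * ‖u x‖ ^ 2) * |V x| :=
    hYl.integrable_smul_left_of_hasCompactSupport (g := fun x => ψ x ^ 2 * ‖u x‖ ^ 2)
      (by have := hψ.continuous; fun_prop) hψ2s.mul_right
  -- The form bound applied to `ψ u` with constant `1/8` costs a further quarter of `∫ψ²‖v‖²`; one
  -- half survives, whence the overall factor `2`.
  have hYle : ∫ x, (ψ x ^ 2 * ‖u x‖ ^ 2) * |V x| ≤
      1 / 8 * (2 * K ^ 2 * ‖f‖ ^ 2 + 2 * ∫ x, ψ x ^ 2 * ‖v x‖ ^ 2) + C * ‖f‖ ^ 2 := by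
    refine le_trans ?_ (add_le_add (mul_le_mul_of_nonneg_left he3 (by norm_num))
      (mul_le_mul_of_nonneg_left he2 hC))
    rw [← ENNReal.ofReal_le_ofReal_iff (by positivity)]
    refine le_trans (le_of_eq ?_) (hVC e)
    rw [ofReal_integral_eq_lintegral_ofReal hY (Eventually.of_forall fun x => by positivity), he1]
    refine lintegral_congr fun x => ?_
    rw [enorm_mul, ← ofReal_norm (V x), ← ofReal_norm (ψ x : ℂ), ← ofReal_norm (u x),
      ← ENNReal.ofReal_mul (norm_nonneg _), ← ENNReal.ofReal_pow (by positivity),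
      ← ENNReal.ofReal_mul (norm_nonneg _), Complex.norm_real, Real.norm_eq_abs, Real.norm_eq_abs,
      mul_pow, sq_abs, mul_comm]
  obtain ⟨hFi, hF0⟩ := integral_cutoff_identity hV hu hv huv hvw hg hψ hψc
  have hG := fun x => caccioppoli_pointwise (m := m) (V := V x) (u := u x) (v := v x) (g := g x)
    (hψ1 x) (hψK x)
  have hi1 : Integrable fun x => 3 / 4 * (ψ x ^ 2 * ‖v x‖ ^ 2) := hX.const_mul _
  have hi2 : Integrable fun x => (4 * K ^ 2 + 1 / 2) * ‖u x‖ ^ 2 := hui.const_mul _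
  have hi3 : Integrable fun x => 1 / 2 * ‖g x‖ ^ 2 := (integrable_norm_sq_L2R g).const_mul _
  have hint := integral_mono (by exact (hi1.sub hY).sub (hi2.add hi3)) hFi hG
  rw [hF0, integral_sub (by exact hi1.sub hY) (by exact hi2.add hi3), integral_sub hi1 hY,
    integral_add hi2 hi3, integral_const_mul, integral_const_mul, integral_const_mul, hu2,
    integral_norm_sq_L2R] at hint
  linarith

end Caccioppoli

/-! ### The maximal domain lies in `W^{1,2}(ℝ)` -/

section MaximalDomain

open scoped ENNReal NNReal ComplexConjugate InnerProduct

variable {V : ℝ → ℝ}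

theorem exists_unit_cutoff : ∃ χ : ℝ → ℝ, ContDiff ℝ 1 χ ∧ HasCompactSupport χ ∧
    (∀ x, |χ x| ≤ 1) ∧ ∀ x, |x| ≤ 1 → χ x = 1 := by
  let χ : ContDiffBump (0 : ℝ) := ⟨1, 2, one_pos, one_lt_two⟩
  have h1 : ∀ x, |χ x| ≤ 1 := fun x => (abs_of_nonneg χ.nonneg).trans_le χ.le_one
  have h2 : ∀ x : ℝ, |x| ≤ 1 → χ x = 1 := fun x hx =>
    χ.one_of_mem_closedBall (mem_closedBall_zero_iff.2 hx)
  exact ⟨χ, χ.contDiff, χ.hasCompactSupport, h1, h2⟩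

theorem exists_cutoff : ∃ K : ℝ, ∀ n : ℕ, ∃ ψ : ℝ → ℝ, ContDiff ℝ 1 ψ ∧ HasCompactSupport ψ ∧
    (∀ x, |ψ x| ≤ 1) ∧ (∀ x, |deriv ψ x| ≤ K) ∧ ∀ x ∈ Metric.closedBall (0 : ℝ) n, ψ x = 1 := by
  obtain ⟨χ, hχd, hχs, hχ1, hχb⟩ := exists_unit_cutoff
  obtain ⟨K, hK⟩ := hχs.deriv.exists_bound_of_continuous (hχd.continuous_deriv le_rfl)
  refine ⟨K, fun n => ?_⟩
  -- Dilating one bump by `c = 1/(n + 1)`: `c ≤ 1` keeps the derivative bound independent of `n`,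
  -- and `c n ≤ 1` keeps the value `1` on the ball of radius `n`.
  obtain ⟨c, hc, hc1, hcn⟩ : ∃ c : ℝ, 0 < c ∧ c ≤ 1 ∧ c * n ≤ 1 := by
    have h : (0 : ℝ) ≤ n := n.cast_nonneg
    refine ⟨((n : ℝ) + 1)⁻¹, by positivity, inv_le_one_of_one_le₀ (by linarith), ?_⟩
    rw [inv_mul_le_iff₀ (by positivity)]
    linarith
  refine ⟨fun x => χ (c * x), hχd.comp (contDiff_const.mul contDiff_id), hχs.comp_homeomorph (Homeomorph.mulLeft₀ c hc.ne'),
    fun x => hχ1 _, fun x => ?_, fun x hx => hχb _ ?_⟩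
  · rw [deriv_comp_mul_left c χ x, smul_eq_mul, abs_mul, abs_of_pos hc]
    calc c * |deriv χ (c * x)| ≤ 1 * |deriv χ (c * x)| := by gcongr
      _ ≤ K := by rw [one_mul]; exact hK _
  · rw [mem_closedBall_zero_iff, Real.norm_eq_abs] at hx
    rw [abs_mul, abs_of_pos hc]
    exact (mul_le_mul_of_nonneg_left hx hc.le).trans hcn

/-- The maximal domain of `-d²/dx² + m² + V` consists of Sobolev functions. -/
theorem memLp_deriv_of_schrodinger {m : ℝ} (hV : LocallyIntegrable V volume)
    (hV0 : Tendsto (fun x : ℝ => ∫ t in x..(x + 1), |V t|) (cocompact ℝ) (𝓝 0))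
    {u v w : ℝ → ℂ} (hu : ACLoc u) (hv : ACLoc v) (huv : ∀ x, HasDerivAt u (v x) x)
    (hvw : ∀ᵐ x, HasDerivAt v (w x) x) {f g : L2R} (hf : f =ᵐ[volume] u)
    (hg : ∀ᵐ x, g x = -w x + ((m ^ 2 + V x : ℝ) : ℂ) * u x) : MemLp v 2 volume := by
  obtain ⟨C, hC, hVC⟩ := potential_form_bound hV hV0 (ε := 1 / 8) (by norm_num)
  have hvc := hv.continuous
  obtain ⟨K, hK⟩ := exists_cutoff
  have hbound : ∀ n : ℕ, ∫ x in Metric.closedBall (0 : ℝ) n, ‖‖v x‖ ^ 2‖ ≤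
      2 * ((4 * K ^ 2 + 1 / 2 + K ^ 2 / 4 + C) * ‖f‖ ^ 2 + 1 / 2 * ‖g‖ ^ 2) := by
    intro n
    obtain ⟨ψ, hψ, hψs, hψ1, hψK, hψe⟩ := hK n
    refine le_trans ?_ (caccioppoli hV hC hVC hu hv huv hvw hf hg hψ hψs hψ1 hψK)
    refine le_trans (le_of_eq ?_) (setIntegral_le_integral (s := Metric.closedBall (0 : ℝ) n)
      (integrable_cutoff_sq hvc hψ.continuous hψs) (Eventually.of_forall fun x => by positivity))
    refine setIntegral_congr_fun Metric.isClosed_closedBall.measurableSet fun x hx => ?_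
    simp only [hψe x hx, norm_pow, norm_norm, one_pow, one_mul]
  rw [memLp_two_iff_integrable_sq_norm hvc.aestronglyMeasurable]
  have hcover : AECover (volume : Measure ℝ) atTop fun n : ℕ => Metric.closedBall (0 : ℝ) n :=
    aecover_closedBall tendsto_natCast_atTop_atTop
  exact hcover.integrable_of_integral_norm_bounded _
    (fun n => (hvc.norm.pow 2).continuousOn.integrableOn_compact (isCompact_closedBall _ _))
    (Eventually.of_forall hbound)

theorem mem_schrodingerOp_graph_iff (m : ℝ) (V : ℝ → ℝ) (p : L2R × L2R) :
    p ∈ (schrodingerOp m V).graph ↔ p ∈ schrodingerGraph m V := by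
  rw [schrodingerOp, Submodule.toLinearPMap_graph_eq _ (schrodingerGraph_single_valued m V)]

/-- The maximal operator `-d²/dx² + m² + V` is associated with its quadratic form. -/
theorem exists_sobolev_of_mem_graph {m : ℝ} (hV : LocallyIntegrable V volume)
    (hV0 : Tendsto (fun x : ℝ => ∫ t in x..(x + 1), |V t|) (cocompact ℝ) (𝓝 0))
    {Q : sobolev →L[ℂ] sobolev}
    (hQ : ∀ e e' : sobolev, Integrable (fun x => (V x : ℂ) * (conj (rep e x) * rep e' x)) ∧
      inner ℂ (Q e) e' = inner ℂ (sobolevDeriv e) (sobolevDeriv e') +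
        (m : ℂ) ^ 2 * inner ℂ (sobolevEmb e) (sobolevEmb e') + potentialForm V e e')
    (x y : L2R) (hxy : (x, y) ∈ (schrodingerOp m V).graph) :
    ∃ e, sobolevEmb e = x ∧ Q e = (sobolevEmb†) y := by
  rw [mem_schrodingerOp_graph_iff] at hxy
  obtain ⟨u, v, w, hu, hv, hxu, huv, hvw, hy⟩ := hxy
  have hv2 := memLp_deriv_of_schrodinger hV hV0 hu hv huv hvw hxu hy
  obtain ⟨e, he1, he2, he3⟩ := exists_sobolev_of_rep hu x (hv2.toLp v) hxu (by
    filter_upwards [hv2.coeFn_toLp] with t ht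
    rw [ht]
    exact huv t)
  refine ⟨e, he1, ext_inner_right ℂ fun e' => ?_⟩
  rw [ContinuousLinearMap.adjoint_inner_left, (hQ e e').2, he1, he2, potentialForm, L2.inner_def,
    L2.inner_def, L2.inner_def, ← sub_eq_zero, ← integral_const_mul]
  have hi1 := L2.integrable_inner (𝕜 := ℂ) (hv2.toLp v) (sobolevDeriv e')
  have hi2 := (L2.integrable_inner (𝕜 := ℂ) x (sobolevEmb e')).const_mul ((m : ℂ) ^ 2)
  have hi3 := (hQ e e').1
  have hi4 := L2.integrable_inner (𝕜 := ℂ) y (sobolevEmb e')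
  rw [← integral_add hi1 hi2, ← integral_add (by exact hi1.add hi2) hi3,
    ← integral_sub (by exact (hi1.add hi2).add hi3) hi4]
  -- By the equation for `u`, the combined integrand is the derivative of the conjugate of `u'`
  -- times `e'`.
  refine (hv.conj.mul (rep_acLoc e')).integral_eq_zero ?_ ((hi1.add hi2).add hi3 |>.sub hi4) ?_
  · refine (L2.integrable_inner (𝕜 := ℂ) (hv2.toLp v) (sobolevEmb e')).congr ?_
    filter_upwards [hv2.coeFn_toLp, emb_ae_eq_rep e'] with t h1 h2
    rw [h1, h2, RCLike.inner_apply, mul_comm]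
  · filter_upwards [hv2.coeFn_toLp, emb_ae_eq_rep e', rep_hasDerivAt e', hvw, hxu, hy]
      with t h1 h2 h3 h4 h5 h6
    refine (h4.star.mul h3).congr_deriv ?_
    rw [h1, h2, h5, h6, he3]
    simp only [RCLike.inner_apply, map_add, map_neg, map_mul, Complex.conj_ofReal,
      ← starRingEnd_apply]
    push_cast
    ring

end MaximalDomain

end BlockMatrixOp

/-! ### The main theorem -/

open BlockMatrixOp in
theorem corollary4p4 (m ν : ℝ) (hm : 0 < m) (hν : |ν| < 1) (V : ℝ → ℝ)
    (hV : LocallyIntegrable V volume)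
    (hV0 : Tendsto (fun x : ℝ => ∫ t in x..(x + 1), |V t|) (cocompact ℝ) (𝓝 0))
    (h0 : (0 : ℂ) ∉ BlockMatrixOp.spectrumOf (BlockMatrixOp.schrodingerOp m V)) :
    -- the operators in question are well defined and self-adjoint
    (IsSelfAdjoint (BlockMatrixOp.schrodingerOp m V) ∧
      ((BlockMatrixOp.schrodingerOp m V).domain ≤ BlockMatrixOp.derivOp.domain) ∧
      (BlockMatrixOp.blockA0 m ν V).IsClosable ∧
      IsSelfAdjoint (BlockMatrixOp.blockA m ν V) ∧
      (BlockMatrixOp.schurS0 m ν V).domain = BlockMatrixOp.derivOp.domain ∧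
      (BlockMatrixOp.schurS0 m ν V).IsClosable ∧
      IsSelfAdjoint (BlockMatrixOp.schurS0 m ν V).closure) ∧
    -- the numbers of negative eigenvalues
    (BlockMatrixOp.kappaMinus (BlockMatrixOp.blockA m ν V) =
        BlockMatrixOp.kappaMinus (BlockMatrixOp.schrodingerOp m V) +
          BlockMatrixOp.kappaMinus (BlockMatrixOp.schurS0 m ν V).closure ∧
      BlockMatrixOp.kappaMinus (BlockMatrixOp.schrodingerOp m V) +
          BlockMatrixOp.kappaMinus (BlockMatrixOp.schurS0 m ν V).closure < ⊤) ∧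
    -- positivity, in the strict sense and in the sense of nonnegativity
    (BlockMatrixOp.IsPositiveOp (BlockMatrixOp.blockA m ν V) ↔
      BlockMatrixOp.IsPositiveOp (BlockMatrixOp.schrodingerOp m V) ∧
        BlockMatrixOp.IsPositiveOp (BlockMatrixOp.schurS0 m ν V).closure) ∧
    (BlockMatrixOp.IsNonnegativeOp (BlockMatrixOp.blockA m ν V) ↔
      BlockMatrixOp.IsNonnegativeOp (BlockMatrixOp.schrodingerOp m V) ∧
        BlockMatrixOp.IsNonnegativeOp (BlockMatrixOp.schurS0 m ν V).closure) := by
  obtain ⟨R, hR⟩ : ∃ R, IsResolventAt (schrodingerOp m V) 0 R := not_not.1 h0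
  obtain ⟨Q, hQsa, hQ⟩ := exists_schrodingerForm m hV hV0
  obtain ⟨C, hC, hVC⟩ := potential_form_bound hV hV0 (ε := 1 / 2) (by norm_num)
  have hre : ∀ e : sobolev, ∀ B : ℝ, 0 ≤ B →
      ∫⁻ x, ‖V x‖ₑ * ‖rep e x‖ₑ ^ 2 ≤ ENNReal.ofReal B →
      ‖sobolevDeriv e‖ ^ 2 + m ^ 2 * ‖sobolevEmb e‖ ^ 2 - B ≤ (inner ℂ (Q e) e).re := by
    intro e B hB h
    have h1 := (abs_le.1 ((Complex.abs_re_le_norm _).trans (norm_potentialForm_self_le hB h))).1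
    rw [(hQ e e).2, inner_self_eq_norm_sq_to_K, inner_self_eq_norm_sq_to_K]
    simp only [Complex.coe_algebraMap, ← Complex.ofReal_pow, ← Complex.ofReal_mul, Complex.add_re,
      Complex.ofReal_re]
    linarith
  have hν2 : ν ^ 2 < 1 := (sq_lt_one_iff_abs_lt_one ν).2 hν
  -- On functions with the prescribed zeros the potential may consume `1 - ν²` of the kinetic term
  -- and all of the `m²` term, leaving `ν²‖e'‖²`.
  have hε : 0 < min (1 - ν ^ 2) (m ^ 2) := lt_min (by linarith) (by positivity)
  obtain ⟨S, hS⟩ := potential_small_of_zeros hV hV0 hε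
  let φ : sobolev →ₗ[ℂ] (Fin S.card → ℂ) :=
    { toFun := fun e i => rep e (S.equivFin.symm i)
      map_add' := fun e e' => by ext i; simp only [rep_add, Pi.add_apply]
      map_smul' := fun c e => by ext i; simp only [rep_smul, Pi.smul_apply, RingHom.id_apply] }
  -- The bound with `ε = 1/2` leaves half of the kinetic term; the shift cancels `C` and adds a full
  -- `‖e‖²`.
  refine blockOp_schur skewData_deriv hQsa (lam := C + 1) (c := 1 / 2) (by norm_num) (fun e => ?_)
    (exists_sobolev_of_mem_graph hV hV0 hQ) hR φ fun e he => ?_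
  · have := hre e _ (by positivity) (hVC e)
    rw [sobolev_norm_sq]
    nlinarith [sq_nonneg ‖sobolevEmb e‖, mul_nonneg (sq_nonneg m) (sq_nonneg ‖sobolevEmb e‖)]
  · have hz : ∀ p ∈ S, rep e p = 0 := fun p hp => by
      have := congrFun he (S.equivFin ⟨p, hp⟩)
      simpa [φ] using this
    have := hre e _ (by positivity) (hS e hz)
    have h1 := mul_le_mul_of_nonneg_right (min_le_left (1 - ν ^ 2) (m ^ 2))
      (sq_nonneg ‖sobolevDeriv e‖)
    have h2 := mul_le_mul_of_nonneg_right (min_le_right (1 - ν ^ 2) (m ^ 2))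
      (sq_nonneg ‖sobolevEmb e‖)
    linarith
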